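/- For probability measures $P,Q$ on $\mathbb R^d$ let $$S(P,Q)=\inf_{\pi\in\Pi(P,Q)}\Big[\int \tfrac12\|x-y\|^2\,d\pi(x,y)+H(\pi\mid P\otimes Q)\Big],$$ where $\Pi(P,Q)$ is the set of couplings of $P$ and $Q$ and $H$ is the relative entropy, with $H(\pi\mid P\otimes Q)=+\infty$ if $\pi\not\ll P\otimes Q$. A probability measure $P$ on $\mathbb R^d$ is called subgaussian if $\int e^{\|x\|^2/(2d\sigma^2)}\,dP(x)\le 2$ for some $\sigma>0$. A pair $(f,g)$ is called a pair of optimal potentials for $(P,Q)$ if $f\in L_1(P)$, $g\in L_1(Q)$ and $(f,g)$ attains the supremum, over all such pairs, of $$\int f\,dP+\int g\,dQ-\iint e^{f(x)+g(y)-\frac12\|x-y\|^2}\,dP(x)\,dQ(y)+1 .$$ Let $P$ and $Q$ be subgaussian and let $(f,g)$ be any pair of optimal potentials for $(P,Q)$ (in particular, a smooth one that satisfies the optimality conditions $\int e^{f(x)+g(y)-\frac12\|x-y\|^2}\,dQ(y)=1$ and $\int e^{f(x)+g(y)-\frac12\|x-y\|^2}\,dP(x)=1$ for all $x,y\in\mathbb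 R^d$). Let $X_1,X_2,\dots$ be i.i.d. with law $P$, let $P_n=\frac1n\sum_{i=1}^n\delta_{X_i}$, and set $$R_n=S(P_n,Q)-\int f\,dP_n .$$ Then $R_n$ has a finite second moment for every $n\ge1$, and $$\lim_{n\to\infty} n\,\mathrm{Var}(R_n)=0 .$$ -/

import Mathlib

open MeasureTheory ProbabilityTheory Filter Topology
open scoped ENNReal

noncomputable section

namespace EntropicOT

/-- `P` is subgaussian: `E_P exp (‖X‖² / (2 d σ²)) ≤ 2` for some `σ`. Taking `σ > 0` loses nothing,
since the left side decreases in `σ`, and the degenerate case `σ = 0` (the point mass at the origin)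
satisfies the bound for every `σ > 0`. -/
def IsSubgaussian {d : ℕ} (P : Measure (EuclideanSpace ℝ (Fin d))) : Prop :=
  ∃ σ : ℝ, 0 < σ ∧
    ∫⁻ x, ENNReal.ofReal (Real.exp (‖x‖ ^ 2 / (2 * (d : ℝ) * σ ^ 2))) ∂P ≤ 2

/-- `π` is a coupling of `P` and `Q`: its marginals are `P` and `Q`. -/
def IsCoupling {d : ℕ} (P Q : Measure (EuclideanSpace ℝ (Fin d)))
    (π : Measure (EuclideanSpace ℝ (Fin d) × EuclideanSpace ℝ (Fin d))) : Prop :=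
  π.map Prod.fst = P ∧ π.map Prod.snd = Q

/-- `∫ ½‖x - y‖² dπ(x, y) + H(π | P ⊗ Q)`, with values in `[0, ∞]`. For probability measures
`InformationTheory.klDiv` is the relative entropy (`∞` when `π` is not absolutely continuous). -/
def primalCost {d : ℕ} (P Q : Measure (EuclideanSpace ℝ (Fin d)))
    (π : Measure (EuclideanSpace ℝ (Fin d) × EuclideanSpace ℝ (Fin d))) : ℝ≥0∞ :=
  ∫⁻ z, ENNReal.ofReal (‖z.1 - z.2‖ ^ 2 / 2) ∂π + InformationTheory.klDiv π (P.prod Q)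

/-- The entropic transportation cost `S(P, Q)` (regularization parameter `1`): the infimum of the
primal cost over all couplings. The infimum is finite when `P` and `Q` are probability measures
with finite second moments, because `P ⊗ Q` is then a coupling of finite cost. -/
def entropicCost {d : ℕ} (P Q : Measure (EuclideanSpace ℝ (Fin d))) : ℝ :=
  (⨅ (π : Measure (EuclideanSpace ℝ (Fin d) × EuclideanSpace ℝ (Fin d))) (_ : IsCoupling P Q π),
    primalCost P Q π).toReal

/-- The dual functional
`∫ f dP + ∫ g dQ - ∫∫ exp (f(x) + g(y) - ½‖x - y‖²) dP(x) dQ(y) + 1`, which is `-∞` when the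
exponential integral diverges. -/
def dualValue {d : ℕ} (P Q : Measure (EuclideanSpace ℝ (Fin d)))
    (f g : EuclideanSpace ℝ (Fin d) → ℝ) : EReal :=
  ((∫ x, f x ∂P + ∫ y, g y ∂Q : ℝ) : EReal)
    - ((∫⁻ z, ENNReal.ofReal (Real.exp (f z.1 + g z.2 - ‖z.1 - z.2‖ ^ 2 / 2)) ∂(P.prod Q) :
        ℝ≥0∞) : EReal) + 1

/-- `(f, g)` is a pair of optimal potentials for `S(P, Q)`: it attains the supremum of the dual
functional over `L¹(P) × L¹(Q)`. -/
structure IsOptimalPotentials {d : ℕ} (P Q : Measure (EuclideanSpace ℝ (Fin d)))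
    (f g : EuclideanSpace ℝ (Fin d) → ℝ) : Prop where
  integrable_left : Integrable f P
  integrable_right : Integrable g Q
  le_dualValue : ∀ f' g' : EuclideanSpace ℝ (Fin d) → ℝ, Integrable f' P → Integrable g' Q →
    dualValue P Q f' g' ≤ dualValue P Q f g

/-- The empirical measure `P_n = n⁻¹ ∑_{i < n} δ_{X_i}` of the first `n` terms of a sequence
(it is only meant for `n ≥ 1`). -/
def empiricalMeasure {d : ℕ} (n : ℕ) (x : ℕ → EuclideanSpace ℝ (Fin d)) :
    Measure (EuclideanSpace ℝ (Fin d)) :=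
  (n : ℝ≥0∞)⁻¹ • ∑ i ∈ Finset.range n, Measure.dirac (x i)

/-- The remainder `R_n = S(P_n, Q) - ∫ f dP_n`, where `P_n` is the empirical measure of
`x 0, …, x (n - 1)`. -/
def remainder {d : ℕ} (Q : Measure (EuclideanSpace ℝ (Fin d)))
    (f : EuclideanSpace ℝ (Fin d) → ℝ) (n : ℕ) (x : ℕ → EuclideanSpace ℝ (Fin d)) : ℝ :=
  entropicCost (empiricalMeasure n x) Q - ∫ z, f z ∂(empiricalMeasure n x)

end EntropicOT

end

/-! Write Δ_n for the change of R_n when one sample point is replaced by an independent one. R_n is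
symmetric in the sample, so Efron–Stein (`variance_le_of_symmetric`) gives n Var(R_n) ≤ ½ E[(n
Δ_n)²], and it suffices to show n Δ_n → 0 in L².

Pointwise limit. Let F be the first empirical potential, normalized so that its partner G has Q-mean
zero. F is extended off the sample by the soft transform of G, so (F, G) is feasible in the dual
problem of every other sample. Replacing the point a by b therefore lowers n S(P_n, Q) by at most
F(a) - F(b) (`mul_entropicCost_sub_le`), and exchanging the two samples bounds it from the other
side. The linear term n ∫ f dP_n drops by exactly f(a) - f(b). So n Δ_n is squeezed between
differences of "empirical minus population potential" at two fixed points, and these tend to 0 by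
`IsTypical.tendsto_sub`.

Stability of potentials. The population dual gap of a normalized pair dominates a squared Hellinger
distance of Gibbs densities (`IsSchrodingerPair.integral_densityGap_le`). Empirical potentials are
uniformly of quadratic growth and locally Lipschitz, by semiconcavity; a uniform law of large
numbers along a fixed typical sample then combines with weak duality to send their gap to 0. Along
subsequences this gives almost everywhere convergence up to additive constants. The soft transform
and dominated convergence turn it into convergence of differences at given points, where the
constants cancel.

Domination. Jensen and the exponential moments bound all potentials by C(1 + ‖z‖² + sample mean of
‖·‖²). Hence (n Δ_n)² is at most a fixed integrable function plus sample means of ‖·‖⁴ that converge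
in L¹, and `tendsto_integral_zero_of_le_add` concludes. The same growth bounds give the second
moment of R_n.

Empirical potentials come from a finite-dimensional maximization (`exists_isMax_semiDual`), whose
first-order condition is the Schrödinger system; strong duality then follows from the Gibbs
coupling. -/

namespace EntropicOT

/-! ### Invariance of the i.i.d. law under injective reindexing. -/

section Reindexing

variable {E : Type*} [MeasurableSpace E]

/-- The law of an i.i.d. sequence with marginal law `P`. -/
noncomputable abbrev iidLaw (P : Measure E) [IsProbabilityMeasure P] : Measure (ℕ → E) :=
  Measure.infinitePi (fun _ : ℕ => P)

theorem measurePreserving_reindex (P : Measure E) [IsProbabilityMeasure P] {e : ℕ → ℕ}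
    (he : Function.Injective e) :
    MeasurePreserving (fun (x : ℕ → E) (j : ℕ) => x (e j)) (iidLaw P) (iidLaw P) := by
  have hm : ∀ i : ℕ, Measurable (fun x : ℕ → E => x i) := fun i => measurable_pi_apply i
  have hind : iIndepFun (fun (i : ℕ) (x : ℕ → E) => x i) (iidLaw P) :=
    iIndepFun_infinitePi (P := fun _ : ℕ => P) (X := fun _ x => x) (fun _ => measurable_id)
  refine ⟨measurable_pi_lambda _ fun j => hm _, ?_⟩
  have h := (hind.precomp he).map_fun_eq_infinitePi_map (fun i => hm (e i))
  rw [h]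
  congr 1
  funext i
  exact Measure.infinitePi_map_eval _ _

theorem iidLaw_map_eq {Ω : Type*} [MeasurableSpace Ω] {P : Measure E} [IsProbabilityMeasure P]
    {μ : Measure Ω} [IsProbabilityMeasure μ] {X : ℕ → Ω → E} (hlaw : ∀ i, HasLaw (X i) P μ)
    (hindep : iIndepFun X μ) :
    MeasureTheory.Measure.map (fun ω i => X i ω) μ = iidLaw P := by
  rw [hindep.map_fun_eq_infinitePi_map₀' (fun i => (hlaw i).aemeasurable)]
  congr 1
  funext i
  exact (hlaw i).map_eq

theorem measurePreserving_eval (P : Measure E) [IsProbabilityMeasure P] (i : ℕ) :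
    MeasurePreserving (fun x : ℕ → E => x i) (iidLaw P) P :=
  ⟨measurable_pi_apply i, Measure.infinitePi_map_eval _ _⟩

theorem iIndepFun_eval (P : Measure E) [IsProbabilityMeasure P] :
    iIndepFun (fun (i : ℕ) (x : ℕ → E) => x i) (iidLaw P) :=
  iIndepFun_infinitePi (P := fun _ : ℕ => P) (X := fun _ x => x) (fun _ => measurable_id)

theorem identDistrib_eval (P : Measure E) [IsProbabilityMeasure P] (i : ℕ) :
    IdentDistrib (fun x : ℕ → E => x i) (fun x : ℕ → E => x 0) (iidLaw P) (iidLaw P) :=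
  ⟨(measurable_pi_apply i).aemeasurable, (measurable_pi_apply 0).aemeasurable, by
    rw [(measurePreserving_eval P i).map_eq, (measurePreserving_eval P 0).map_eq]⟩

theorem integral_comp_measurePreserving {α : Type*} [MeasurableSpace α] {μ : Measure α} {β : Type*}
    [MeasurableSpace β] {ν : Measure β} {T : α → β} (hT : MeasurePreserving T μ ν) {G : β → ℝ}
    (hG : Measurable G) : ∫ x, G (T x) ∂μ = ∫ y, G y ∂ν := by
  rw [← hT.map_eq, integral_map hT.measurable.aemeasurable hG.aestronglyMeasurable]

end Reindexing

/-! ### The Efron–Stein inequality for symmetric statistics. -/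

section EfronStein

/-- Exchanges the coordinates `j` and `j + n` for all `j < i`. -/
def exchange (n i : ℕ) (j : ℕ) : ℕ :=
  if j < i then j + n else if n ≤ j ∧ j < n + i then j - n else j

theorem exchange_injective {n i : ℕ} (hi : i ≤ n) : Function.Injective (exchange n i) := by
  intro a b h
  unfold exchange at h
  split_ifs at h <;> omega

variable {E : Type*} [MeasurableSpace E]

/-- The full exchange replaces the first n coordinates by the block n, …, 2n - 1, so the two factors
are independent with equal means. The functions `ext₁`, `ext₂` pad finite blocks to sequences, which
is harmless because F reads only the first n terms. -/
theorem integral_mul_exchange [Nonempty E] (P : Measure E) [IsProbabilityMeasure P] {n : ℕ}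
    {F : (ℕ → E) → ℝ} (hF : Measurable F) (hdep : ∀ x y : ℕ → E, (∀ i < n, x i = y i) → F x = F y) :
    ∫ x, F x * F (fun j => x (exchange n n j)) ∂(iidLaw P) = (∫ x, F x ∂(iidLaw P)) ^ 2 := by
  obtain ⟨e₀⟩ := ‹Nonempty E›
  have hind := (iIndepFun_eval P).indepFun_finset (Finset.range n) (Finset.Ico n (n + n))
    (by
      rw [Finset.disjoint_left]
      intro a ha hb
      simp only [Finset.mem_range, Finset.mem_Ico] at ha hb
      omega)
    (fun i => measurable_pi_apply i)
  let ext₁ : (Finset.range n → E) → ℕ → E := fun y j =>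
    if h : j ∈ Finset.range n then y ⟨j, h⟩ else e₀
  let ext₂ : (Finset.Ico n (n + n) → E) → ℕ → E := fun y j =>
    if h : j + n ∈ Finset.Ico n (n + n) then y ⟨j + n, h⟩ else e₀
  have hm₁ : Measurable ext₁ := by
    refine measurable_pi_lambda _ fun j => ?_
    by_cases h : j ∈ Finset.range n
    · simp only [ext₁, h, dite_true]; exact measurable_pi_apply _
    · simp only [ext₁, h, dite_false]; exact measurable_const
  have hm₂ : Measurable ext₂ := by
    refine measurable_pi_lambda _ fun j => ?_
    by_cases h : j + n ∈ Finset.Ico n (n + n)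
    · simp only [ext₂, h, dite_true]; exact measurable_pi_apply _
    · simp only [ext₂, h, dite_false]; exact measurable_const
  have hind' := hind.comp (hF.comp hm₁) (hF.comp hm₂)
  have e₁ : (F ∘ ext₁) ∘ (fun (x : ℕ → E) (i : Finset.range n) => x i) = F := by
    funext x
    refine hdep _ _ fun i hi => ?_
    simp [ext₁, hi]
  have e₂ : (F ∘ ext₂) ∘ (fun (x : ℕ → E) (i : Finset.Ico n (n + n)) => x i)
      = fun x => F (fun j => x (exchange n n j)) := by
    funext x
    refine hdep _ _ fun i hi => ?_
    simp [ext₂, hi, exchange]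
  rw [e₁, e₂] at hind'
  have hmp := measurePreserving_reindex P (exchange_injective (le_refl n))
  rw [hind'.integral_fun_mul_eq_mul_integral hF.aestronglyMeasurable
    (hF.comp hmp.measurable).aestronglyMeasurable, sq]
  congr 1
  exact integral_comp_measurePreserving hmp hF

theorem integral_reindex (P : Measure E) [IsProbabilityMeasure P] {e : ℕ → ℕ}
    (he : Function.Injective e) {G : (ℕ → E) → ℝ} (hG : Measurable G) :
    ∫ x, G (fun j => x (e j)) ∂(iidLaw P) = ∫ x, G x ∂(iidLaw P) :=
  integral_comp_measurePreserving (measurePreserving_reindex P he) hG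

/-- The Efron–Stein inequality for a symmetric function of the first `n` terms of an i.i.d.
sequence; the resampled value of the first term is the term with index `n`. -/
theorem variance_le_of_symmetric [Nonempty E] (P : Measure E) [IsProbabilityMeasure P] {n : ℕ}
    {F : (ℕ → E) → ℝ} (hF : Measurable F) (hF2 : MemLp F 2 (iidLaw P))
    (hdep : ∀ x y : ℕ → E, (∀ i < n, x i = y i) → F x = F y)
    (hsymm : ∀ (x : ℕ → E) (i : ℕ), i < n → F (fun j => x (Equiv.swap 0 i j)) = F x) :
    variance F (iidLaw P) ≤
      (n : ℝ) / 2 * ∫ x, (F x - F (fun j => x (Equiv.swap 0 n j))) ^ 2 ∂(iidLaw P) := by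
  set ν := iidLaw P
  have hmF : ∀ e : ℕ → ℕ, Measurable (fun x : ℕ → E => F (fun j => x (e j))) := fun e =>
    hF.comp (measurable_pi_lambda _ fun j => measurable_pi_apply _)
  have hLF : ∀ e : ℕ → ℕ, Function.Injective e → MemLp (fun x : ℕ → E => F (fun j =>
      x (e j))) 2 ν :=
    fun e he => hF2.comp_measurePreserving (measurePreserving_reindex P he)
  have key : ∀ i < n, ∫ x, F x * (F (fun j => x (exchange n i j))
      - F (fun j => x (exchange n (i + 1) j))) ∂ν
      ≤ 1 / 2 * ∫ x, (F x - F (fun j => x (Equiv.swap 0 n j))) ^ 2 ∂ν := by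
    intro i hi
    set τ : Equiv.Perm ℕ := Equiv.swap i (i + n) with hτ
    -- Composition with τ turns the exchange of the first i coordinates into that of the first i + 1
    -- and back, at indices below n; only these are seen by F.
    have hA : ∀ x : ℕ → E, F (fun j => x (τ (exchange n i j)))
        = F (fun j => x (exchange n (i + 1) j)) := by
      intro x
      refine hdep _ _ fun j hj => ?_
      congr 1
      simp only [hτ, Equiv.swap_apply_def, exchange]
      split_ifs <;> omega
    have hB : ∀ x : ℕ → E, F (fun j => x (τ (exchange n (i + 1) j)))
        = F (fun j => x (exchange n i j)) := by
      intro x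
      refine hdep _ _ fun j hj => ?_
      congr 1
      simp only [hτ, Equiv.swap_apply_def, exchange]
      split_ifs <;> omega
    have hC : ∀ x : ℕ → E, F (fun j => x (exchange n i (τ j)))
        = F (fun j => x (exchange n (i + 1) j)) := by
      intro x
      refine hdep _ _ fun j hj => ?_
      congr 1
      simp only [hτ, Equiv.swap_apply_def, exchange]
      split_ifs <;> omega
    have hinj₁ : Function.Injective (exchange n i) := exchange_injective hi.le
    have hinj₂ : Function.Injective (exchange n (i + 1)) := exchange_injective hi
    set G : (ℕ → E) → ℝ := fun x => (F x - F (fun j => x (τ j))) ^ 2 with hG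
    have hGm : Measurable G := (hF.sub (hmF τ)).pow_const 2
    have hGi : Integrable G ν := (hF2.sub (hLF τ τ.injective)).integrable_sq
    set D : (ℕ → E) → ℝ := fun x => F (fun j => x (exchange n i j))
      - F (fun j => x (exchange n (i + 1) j)) with hD
    have hDL : MemLp D 2 ν := (hLF _ hinj₁).sub (hLF _ hinj₂)
    have hDm : Measurable D := (hmF _).sub (hmF _)
    -- τ preserves the law and reverses the sign of D.
    have h1 : ∫ x, F x * D x ∂ν = - ∫ x, F (fun j => x (τ j)) * D x ∂ν := by
      rw [← integral_reindex P τ.injective (G := fun x => F x * D x) (hF.mul hDm), ← integral_neg]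
      congr 1
      funext x
      simp only [hD, hA, hB]
      ring
    have hi1 : Integrable (fun x => F x * D x) ν := hF2.integrable_mul hDL
    have hi2 : Integrable (fun x => F (fun j => x (τ j)) * D x) ν :=
      (hLF τ τ.injective).integrable_mul hDL
    have h2 : 2 * ∫ x, F x * D x ∂ν = ∫ x, (F x - F (fun j => x (τ j))) * D x ∂ν := by
      have : ∫ x, (F x - F (fun j => x (τ j))) * D x ∂ν
          = ∫ x, F x * D x ∂ν - ∫ x, F (fun j => x (τ j)) * D x ∂ν := by
        rw [← integral_sub hi1 hi2]
        congr 1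
        funext x
        ring
      rw [this]
      linarith
    have h3 : ∫ x, (D x) ^ 2 ∂ν = ∫ x, G x ∂ν := by
      rw [← integral_reindex P hinj₁ hGm]
      congr 1
      funext x
      simp only [hG, hD, hC]
    have h4 : ∫ x, (F x - F (fun j => x (τ j))) * D x ∂ν
        ≤ ∫ x, (1 / 2 * G x + 1 / 2 * (D x) ^ 2) ∂ν := by
      refine integral_mono ((hF2.sub (hLF τ τ.injective)).integrable_mul hDL)
        ((hGi.const_mul _).add (hDL.integrable_sq.const_mul _)) fun x => ?_
      simp only [hG]
      nlinarith [sq_nonneg (F x - F (fun j => x (τ j)) - D x)]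
    rw [integral_add (hGi.const_mul _) (hDL.integrable_sq.const_mul _), integral_const_mul,
      integral_const_mul, h3] at h4
    -- By symmetry of F the resampled index i may be moved to 0, while ρ moves its copy i + n to n.
    have h5 : ∫ x, G x ∂ν = ∫ x, (F x - F (fun j => x (Equiv.swap 0 n j))) ^ 2 ∂ν := by
      set ρ : ℕ → ℕ := fun j => Equiv.swap 0 i (Equiv.swap n (i + n) j) with hρ
      have hρi : Function.Injective ρ :=
        (Equiv.swap 0 i).injective.comp (Equiv.swap n (i + n)).injective
      rw [← integral_reindex P hρi hGm]
      congr 1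
      funext x
      simp only [hG]
      congr 2
      · rw [← hsymm x i hi]
        refine hdep _ _ fun j hj => ?_
        simp only [hρ]
        rw [Equiv.swap_apply_of_ne_of_ne (a := n) (by omega) (by omega)]
      · rw [← hsymm (fun j => x (Equiv.swap 0 n j)) i hi]
        refine hdep _ _ fun j hj => ?_
        congr 1
        simp only [hρ, hτ, Equiv.swap_apply_def]
        split_ifs <;> omega
    rw [← h5]
    linarith
  -- Telescoping leaves E[F²] at i = 0 and, by independence, (E F)² at i = n.
  have htel : ∑ i ∈ Finset.range n, ∫ x, F x * (F (fun j => x (exchange n i j))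
      - F (fun j => x (exchange n (i + 1) j))) ∂ν = variance F ν := by
    have hI : ∀ i ≤ n, Integrable (fun x => F x * F (fun j => x (exchange n i j))) ν :=
      fun i hi => hF2.integrable_mul (hLF _ (exchange_injective hi))
    have : ∀ i ∈ Finset.range n, ∫ x, F x * (F (fun j => x (exchange n i j))
        - F (fun j => x (exchange n (i + 1) j))) ∂ν
        = ∫ x, F x * F (fun j => x (exchange n i j)) ∂ν
          - ∫ x, F x * F (fun j => x (exchange n (i + 1) j)) ∂ν := by
      intro i hi
      rw [Finset.mem_range] at hi
      rw [← integral_sub (hI i hi.le) (hI (i + 1) hi)]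
      congr 1
      funext x
      ring
    rw [Finset.sum_congr rfl this, Finset.sum_range_sub', integral_mul_exchange P hF hdep,
      variance_eq_sub hF2]
    congr 1
    have h0 : ∀ j, exchange n 0 j = j := by
      intro j
      simp only [exchange]
      split_ifs <;> omega
    simp only [h0, Pi.pow_apply, sq]
  rw [← htel]
  calc _ ≤ ∑ i ∈ Finset.range n,
        1 / 2 * ∫ x, (F x - F (fun j => x (Equiv.swap 0 n j))) ^ 2 ∂ν :=
        Finset.sum_le_sum fun i hi => key i (Finset.mem_range.mp hi)
    _ = _ := by rw [Finset.sum_const, Finset.card_range, nsmul_eq_mul]; ring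

end EfronStein

/-! ### Sample averages and the strong law. -/

section StrongLaw

variable {E : Type*}

/-- The average of `ψ` over the first `n` terms of the sequence `x`. -/
noncomputable def avg (n : ℕ) (ψ : E → ℝ) (x : ℕ → E) : ℝ :=
  (n : ℝ)⁻¹ * ∑ i ∈ Finset.range n, ψ (x i)

variable [MeasurableSpace E]

theorem integral_eval (P : Measure E) [IsProbabilityMeasure P] (i : ℕ) {ψ : E → ℝ}
    (hm : Measurable ψ) : ∫ x, ψ (x i) ∂(iidLaw P) = ∫ z, ψ z ∂P :=
  integral_comp_measurePreserving (measurePreserving_eval P i) hm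

theorem ae_tendsto_avg (P : Measure E) [IsProbabilityMeasure P] {ψ : E → ℝ} (hψ : Integrable ψ P)
    (hm : Measurable ψ) :
    ∀ᵐ x ∂(iidLaw P), Tendsto (fun n => avg n ψ x) atTop (𝓝 (∫ z, ψ z ∂P)) := by
  have h := strong_law_ae (μ := iidLaw P) (fun (i : ℕ) (x : ℕ → E) => ψ (x i))
    ((measurePreserving_eval P 0).integrable_comp_of_integrable hψ)
    (fun i j hij => ((iIndepFun_eval P).indepFun hij).comp hm hm)
    fun i => (identDistrib_eval P i).comp hm
  simpa only [integral_eval P 0 hm, smul_eq_mul, avg] using h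

end StrongLaw

/-! ### From subgaussianity to exponential moments. -/

section ExpMoments

variable {E : Type*} [NormedAddCommGroup E] [MeasurableSpace E]

/-- The exponential moments of `‖y‖` under `Q` grow at most like `2 exp (κ t²)`. -/
structure HasExpMoments (κ : ℝ) (Q : Measure E) : Prop where
  nonneg : 0 ≤ κ
  integrable : ∀ t : ℝ, 0 ≤ t → Integrable (fun y => Real.exp (t * ‖y‖)) Q
  integral_le : ∀ t : ℝ, 0 ≤ t → ∫ y, Real.exp (t * ‖y‖) ∂Q ≤ 2 * Real.exp (κ * t ^ 2)

theorem HasExpMoments.integrable_norm_pow [BorelSpace E] [SecondCountableTopology E]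
    {κ : ℝ} {Q : Measure E} (h : HasExpMoments κ Q)
    (k : ℕ) : Integrable (fun y => ‖y‖ ^ k) Q := by
  refine ((h.integrable 1 zero_le_one).const_mul (k.factorial : ℝ)).mono'
    (by fun_prop) (Eventually.of_forall fun y => ?_)
  rw [Real.norm_eq_abs, abs_of_nonneg (by positivity), one_mul]
  have := Real.pow_div_factorial_le_exp ‖y‖ (norm_nonneg y) k
  rwa [div_le_iff₀' (by positivity)] at this

theorem IsSubgaussian.exists_hasExpMoments {d : ℕ} {P : Measure (EuclideanSpace ℝ (Fin d))}
    (h : IsSubgaussian P) : ∃ κ : ℝ, HasExpMoments κ P := by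
  obtain ⟨σ, hσ, hP⟩ := h
  set φ : EuclideanSpace ℝ (Fin d) → ℝ := fun x => Real.exp (‖x‖ ^ 2 / (2 * (d : ℝ)
      * σ ^ 2)) with hφ
  have hφm : Measurable φ := by fun_prop
  have hφ0 : ∀ x, 0 ≤ φ x := fun x => (Real.exp_pos _).le
  have hφi : Integrable φ P := by
    refine ⟨hφm.aestronglyMeasurable, ?_⟩
    rw [hasFiniteIntegral_iff_ofReal (Eventually.of_forall hφ0)]
    exact hP.trans_lt (by simp)
  have hφ2 : ∫ x, φ x ∂P ≤ 2 := by
    rw [integral_eq_lintegral_of_nonneg_ae (Eventually.of_forall hφ0) hφm.aestronglyMeasurable]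
    exact ENNReal.toReal_le_of_le_ofReal (by norm_num) (by simpa using hP)
  -- This κ makes the exponents differ by a perfect square: t‖x‖ ≤ κ t² + ‖x‖² / (2 d σ²).
  set κ : ℝ := (d : ℝ) * σ ^ 2 / 2 with hκ
  have hle : ∀ t : ℝ, ∀ x : EuclideanSpace ℝ (Fin d),
      Real.exp (t * ‖x‖) ≤ Real.exp (κ * t ^ 2) * φ x := by
    intro t x
    rw [hφ, ← Real.exp_add, Real.exp_le_exp]
    -- For d = 0 the denominator in φ vanishes, but the space is a single point and both sides equal
    -- 1.
    rcases Nat.eq_zero_or_pos d with hd | hd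
    · subst hd
      have : x = 0 := Subsingleton.elim _ _
      simp [this, hκ]
    · have hd' : (0 : ℝ) < d := by exact_mod_cast hd
      have hs : 0 < (d : ℝ) * σ ^ 2 := by positivity
      have e : κ * t ^ 2 + ‖x‖ ^ 2 / (2 * (d : ℝ) * σ ^ 2) - t * ‖x‖
          = ((d : ℝ) * σ ^ 2 * t - ‖x‖) ^ 2 / (2 * ((d : ℝ) * σ ^ 2)) := by
        rw [hκ]
        field_simp
        ring
      have : 0 ≤ ((d : ℝ) * σ ^ 2 * t - ‖x‖) ^ 2 / (2 * ((d : ℝ) * σ ^ 2)) := by positivity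
      linarith
  have hint : ∀ t : ℝ, Integrable (fun y => Real.exp (t * ‖y‖)) P := fun t =>
    (hφi.const_mul (Real.exp (κ * t ^ 2))).mono' (by fun_prop) (Eventually.of_forall fun x => by
      rw [Real.norm_eq_abs, Real.abs_exp]
      exact hle t x)
  refine ⟨κ, by positivity, fun t _ => hint t, fun t _ => ?_⟩
  calc ∫ y, Real.exp (t * ‖y‖) ∂P ≤ ∫ y, Real.exp (κ * t ^ 2) * φ y ∂P :=
        integral_mono (hint t) (hφi.const_mul _) (hle t)
    _ = Real.exp (κ * t ^ 2) * ∫ y, φ y ∂P := integral_const_mul _ _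
    _ ≤ Real.exp (κ * t ^ 2) * 2 := by gcongr
    _ = _ := mul_comm _ _

end ExpMoments

/-! ### Pointwise bounds for potentials from the normalization equation. -/

section Potentials

variable {E : Type*} [NormedAddCommGroup E]

/-- The quadratic cost `½‖x - y‖²`. -/
noncomputable def cost (x y : E) : ℝ := ‖x - y‖ ^ 2 / 2

theorem cost_nonneg (x y : E) : 0 ≤ cost x y := by unfold cost; positivity

theorem continuous_cost : Continuous (fun z : E × E => cost z.1 z.2) := by
  unfold cost; fun_prop

theorem cost_le (x y : E) : cost x y ≤ ‖x‖ ^ 2 / 2 + ‖x‖ * ‖y‖ + ‖y‖ ^ 2 / 2 := by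
  have := norm_sub_le x y
  have h0 := norm_nonneg (x - y)
  unfold cost
  nlinarith

theorem le_cost (x y : E) : ‖x‖ ^ 2 / 2 - ‖x‖ * ‖y‖ + ‖y‖ ^ 2 / 2 ≤ cost x y := by
  have := sq_le_sq' (by linarith [norm_sub_norm_le y x, norm_sub_rev x y, norm_nonneg (x - y)])
    (norm_sub_norm_le x y)
  unfold cost
  nlinarith

/-- The term ‖y‖² / 2 allowed in g cancels against the one in the cost, so only an exponential that
is linear in ‖y‖ survives. This is why upper bounds on second potentials keep the leading
coefficient exactly ½. -/
theorem exp_sub_cost_le {g : E → ℝ} {b K s : ℝ} {x y : E}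
    (hg : g y ≤ ‖y‖ ^ 2 / 2 + b * ‖y‖ + K) :
    Real.exp (s + g y - cost x y)
      ≤ Real.exp (s + K - ‖x‖ ^ 2 / 2) * Real.exp ((‖x‖ + b) * ‖y‖) := by
  rw [← Real.exp_add, Real.exp_le_exp]
  have := le_cost x y
  nlinarith

variable [MeasurableSpace E]

/-- The soft `c`-transform `x ↦ -log ∫ exp (g(y) - ½‖x - y‖²) dQ(y)`. -/
noncomputable def softTransform (Q : Measure E) (g : E → ℝ) (x : E) : ℝ :=
  -Real.log (∫ y, Real.exp (g y - cost x y) ∂Q)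

theorem integral_exp_softTransform {Q : Measure E} [NeZero Q] {g : E → ℝ} {x : E}
    (h : Integrable (fun y => Real.exp (g y - cost x y)) Q) :
    ∫ y, Real.exp (softTransform Q g x + g y - cost x y) ∂Q = 1 := by
  have hp : 0 < ∫ y, Real.exp (g y - cost x y) ∂Q := integral_exp_pos h
  have : ∀ y, Real.exp (softTransform Q g x + g y - cost x y)
      = (∫ y, Real.exp (g y - cost x y) ∂Q)⁻¹ * Real.exp (g y - cost x y) := by
    intro y
    rw [add_sub_assoc, Real.exp_add, softTransform, Real.exp_neg, Real.exp_log hp]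
  simp only [this]
  rw [integral_const_mul, inv_mul_cancel₀ hp.ne']

theorem eq_softTransform {Q : Measure E} {g : E → ℝ} {x : E} {s : ℝ}
    (h : ∫ y, Real.exp (s + g y - cost x y) ∂Q = 1) : s = softTransform Q g x := by
  have : ∀ y, Real.exp (s + g y - cost x y) = Real.exp s * Real.exp (g y - cost x y) := by
    intro y
    rw [add_sub_assoc, Real.exp_add]
  simp only [this] at h
  rw [integral_const_mul] at h
  rw [softTransform, eq_comm, neg_eq_iff_eq_neg, eq_inv_of_mul_eq_one_right h, Real.log_inv,
    Real.log_exp]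

variable [BorelSpace E] [SecondCountableTopology E]

@[fun_prop]
theorem measurable_cost : Measurable (fun z : E × E => cost z.1 z.2) :=
  continuous_cost.measurable

@[fun_prop]
theorem measurable_cost_right (x : E) : Measurable (fun y : E => cost x y) :=
  measurable_cost.comp measurable_prodMk_left

theorem HasExpMoments.integrable_cost {κ : ℝ} {Q : Measure E} [IsProbabilityMeasure Q]
    (hQ : HasExpMoments κ Q) (x : E) : Integrable (fun y => cost x y) Q := by
  have h1 := hQ.integrable_norm_pow 1
  have h2 := hQ.integrable_norm_pow 2
  simp only [pow_one] at h1
  refine (((integrable_const (‖x‖ ^ 2 / 2)).add (h1.const_mul ‖x‖)).add (h2.div_const 2)).mono'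
    (measurable_cost_right x).aestronglyMeasurable (Eventually.of_forall fun y => ?_)
  rw [Real.norm_eq_abs, abs_of_nonneg (cost_nonneg x y)]
  exact cost_le x y

theorem HasExpMoments.integral_cost_le {κ : ℝ} {Q : Measure E} [IsProbabilityMeasure Q]
    (hQ : HasExpMoments κ Q) (x : E) :
    ∫ y, cost x y ∂Q ≤ ‖x‖ ^ 2 / 2 + ‖x‖ * ∫ y, ‖y‖ ∂Q + (∫ y, ‖y‖ ^ 2 ∂Q) / 2 := by
  have h1 := hQ.integrable_norm_pow 1
  have h2 := hQ.integrable_norm_pow 2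
  simp only [pow_one] at h1
  have h3 : Integrable (fun y => ‖x‖ ^ 2 / 2 + ‖x‖ * ‖y‖) Q :=
    (integrable_const (‖x‖ ^ 2 / 2)).add (h1.const_mul ‖x‖)
  calc ∫ y, cost x y ∂Q ≤ ∫ y, (‖x‖ ^ 2 / 2 + ‖x‖ * ‖y‖ + ‖y‖ ^ 2 / 2) ∂Q :=
        integral_mono (hQ.integrable_cost x)
          (h3.add (h2.div_const 2)) (cost_le x)
    _ = _ := by
        rw [integral_add h3 (h2.div_const 2),
          integral_add (integrable_const (‖x‖ ^ 2 / 2)) (h1.const_mul ‖x‖), integral_const_mul]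
        simp [integral_div]

/-- The Bochner integral of a nonintegrable function is 0, so the value 1 already certifies
integrability. -/
theorem integrable_of_integral_exp_eq_one {α : Type*} [MeasurableSpace α] {μ : Measure α} {u : α → ℝ}
    (h : ∫ x, Real.exp (u x) ∂μ = 1) : Integrable (fun x => Real.exp (u x)) μ := by
  by_contra hc
  rw [integral_undef hc] at h
  exact zero_ne_one h

theorem integral_nonpos_of_integral_exp_eq_one {α : Type*} [MeasurableSpace α] {Q : Measure α}
    [IsProbabilityMeasure Q] {ψ : α → ℝ} (hψ : Integrable ψ Q)
    (h : ∫ y, Real.exp (ψ y) ∂Q = 1) : ∫ y, ψ y ∂Q ≤ 0 := by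
  have hi := integrable_of_integral_exp_eq_one h
  have := integral_mono (hψ.add (integrable_const 1)) hi fun y => Real.add_one_le_exp (ψ y)
  rw [h, integral_add' hψ (integrable_const 1)] at this
  simpa using this

/-- Jensen's inequality bounds a potential from above. -/
theorem potential_le {κ : ℝ} {Q : Measure E} [IsProbabilityMeasure Q] (hQ : HasExpMoments κ Q)
    {g : E → ℝ} (hg : Integrable g Q) {s : ℝ} {x : E}
    (h : ∫ y, Real.exp (s + g y - cost x y) ∂Q = 1) :
    s ≤ ‖x‖ ^ 2 / 2 + ‖x‖ * ∫ y, ‖y‖ ∂Q + (∫ y, ‖y‖ ^ 2 ∂Q) / 2 - ∫ y, g y ∂Q := by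
  have h0 := integral_nonpos_of_integral_exp_eq_one
    (((integrable_const s).add hg).sub (hQ.integrable_cost x)) h
  have h1 := integral_sub ((integrable_const s).add hg) (hQ.integrable_cost x)
  simp only [Pi.add_apply] at h1
  simp only [Pi.add_apply, Pi.sub_apply] at h0
  rw [h1, integral_add (integrable_const s) hg] at h0
  have := hQ.integral_cost_le x
  simp at h0
  linarith

theorem integrable_exp_sub_cost {κ : ℝ} {Q : Measure E} (hQ : HasExpMoments κ Q)
    {g : E → ℝ} (hgm : Measurable g) {b K : ℝ} (hb : 0 ≤ b)
    (hg : ∀ᵐ y ∂Q, g y ≤ ‖y‖ ^ 2 / 2 + b * ‖y‖ + K) (s : ℝ) (x : E) :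
    Integrable (fun y => Real.exp (s + g y - cost x y)) Q := by
  refine ((hQ.integrable (‖x‖ + b) (by positivity)).const_mul
    (Real.exp (s + K - ‖x‖ ^ 2 / 2))).mono' (by fun_prop) ?_
  filter_upwards [hg] with y hy
  rw [Real.norm_eq_abs, Real.abs_exp]
  exact exp_sub_cost_le hy

/-- Inserting the upper bound on g into the normalization leaves an exponential moment of Q; taking
logarithms bounds s from below. -/
theorem le_potential {κ : ℝ} {Q : Measure E} (hQ : HasExpMoments κ Q)
    {g : E → ℝ} (hgm : Measurable g) {b K : ℝ} (hb : 0 ≤ b)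
    (hg : ∀ᵐ y ∂Q, g y ≤ ‖y‖ ^ 2 / 2 + b * ‖y‖ + K) {s : ℝ} {x : E}
    (h : ∫ y, Real.exp (s + g y - cost x y) ∂Q = 1) :
    -K - Real.log 2 - κ * (‖x‖ + b) ^ 2 ≤ s := by
  have h1 : (1 : ℝ) ≤ Real.exp (s + K - ‖x‖ ^ 2 / 2) * (2 * Real.exp (κ * (‖x‖ + b) ^ 2)) := by
    rw [← h]
    calc _ ≤ ∫ y, Real.exp (s + K - ‖x‖ ^ 2 / 2) * Real.exp ((‖x‖ + b) * ‖y‖) ∂Q := by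
          refine integral_mono_ae (integrable_exp_sub_cost hQ hgm hb hg s x)
            ((hQ.integrable (‖x‖ + b) (by positivity)).const_mul _) ?_
          filter_upwards [hg] with y hy
          exact exp_sub_cost_le hy
      _ = Real.exp (s + K - ‖x‖ ^ 2 / 2) * ∫ y, Real.exp ((‖x‖ + b) * ‖y‖) ∂Q :=
          integral_const_mul _ _
      _ ≤ _ := by
          gcongr
          exact hQ.integral_le _ (by positivity)
  have h2 : Real.exp (s + K - ‖x‖ ^ 2 / 2) * (2 * Real.exp (κ * (‖x‖ + b) ^ 2))
      = Real.exp (s + K - ‖x‖ ^ 2 / 2 + (Real.log 2 + κ * (‖x‖ + b) ^ 2)) := by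
    rw [Real.exp_add, Real.exp_add, Real.exp_log (by norm_num)]
  rw [h2, ← Real.exp_zero, Real.exp_le_exp] at h1
  nlinarith [sq_nonneg ‖x‖]

theorem measurable_softTransform {Q : Measure E} [SFinite Q] {g : E → ℝ} (hg : Measurable g) :
    Measurable (softTransform Q g) := by
  have : Measurable (fun z : E × E => Real.exp (g z.2 - cost z.1 z.2)) :=
    ((hg.comp measurable_snd).sub measurable_cost).exp
  exact (this.stronglyMeasurable.integral_prod_right').measurable.log.neg

end Potentials

/-! ### Semiconcavity and local Lipschitz bounds for potentials. -/

section Lipschitz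

variable {E : Type*} [NormedAddCommGroup E] [InnerProductSpace ℝ E]

theorem cost_convexComb (x z y : E) (t : ℝ) :
    cost ((1 - t) • x + t • z) y
      = (1 - t) * cost x y + t * cost z y - t * (1 - t) / 2 * ‖x - z‖ ^ 2 := by
  have h1 : (1 - t) • x + t • z - y = (1 - t) • (x - y) + t • (z - y) := by module
  have h2 : x - z = (x - y) - (z - y) := by abel
  unfold cost
  rw [h1, h2, norm_add_sq_real, norm_sub_sq_real (x - y) (z - y), norm_smul, norm_smul,
    inner_smul_left, inner_smul_right, mul_pow, mul_pow, Real.norm_eq_abs, Real.norm_eq_abs,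
    sq_abs, sq_abs]
  simp only [conj_trivial]
  ring

variable [MeasurableSpace E]

/-- This says that f - ½‖·‖² is concave. It follows by integrating the convexity inequality of exp
along the segment, since all the normalizing integrals equal 1. -/
theorem potential_semiconcave {Q : Measure E} {f g : E → ℝ}
    (h : ∀ x, ∫ y, Real.exp (f x + g y - cost x y) ∂Q = 1) (x z : E) {t : ℝ} (ht0 : 0 ≤ t)
    (ht1 : t ≤ 1) :
    (1 - t) * f x + t * f z - t * (1 - t) / 2 * ‖x - z‖ ^ 2 ≤ f ((1 - t) • x + t • z) := by
  set w := (1 - t) • x + t • z with hw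
  have hi : ∀ x, Integrable (fun y => Real.exp (f x + g y - cost x y)) Q := fun x =>
    integrable_of_integral_exp_eq_one (h x)
  set δ := (1 - t) * f x + t * f z - t * (1 - t) / 2 * ‖x - z‖ ^ 2 - f w with hδ
  have hpt : ∀ y, Real.exp δ * Real.exp (f w + g y - cost w y)
      ≤ (1 - t) * Real.exp (f x + g y - cost x y) + t * Real.exp (f z + g y - cost z y) := by
    intro y
    have hc := convexOn_exp.2 (Set.mem_univ (f x + g y - cost x y))
      (Set.mem_univ (f z + g y - cost z y)) (sub_nonneg.2 ht1) ht0 (by ring)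
    simp only [smul_eq_mul] at hc
    refine le_trans (le_of_eq ?_) hc
    rw [← Real.exp_add, hw, cost_convexComb, hδ, hw]
    congr 1
    ring
  have := integral_mono ((hi w).const_mul (Real.exp δ))
    (((hi x).const_mul (1 - t)).add ((hi z).const_mul t)) hpt
  rw [integral_const_mul, integral_add' ((hi x).const_mul (1 - t)) ((hi z).const_mul t),
    integral_const_mul, integral_const_mul, h, h, h] at this
  have h1 : Real.exp δ ≤ Real.exp 0 := by rw [Real.exp_zero]; linarith
  rw [Real.exp_le_exp] at h1
  linarith

/-- A semiconcave function of quadratic growth is locally Lipschitz: continuing the segment from x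
through x' by unit length to z, semiconcavity at x' compares f x - f x' with the small fraction t of
f x - f z. -/
theorem potential_sub_le {Q : Measure E} {f g : E → ℝ}
    (h : ∀ x, ∫ y, Real.exp (f x + g y - cost x y) ∂Q = 1) {C : ℝ} (hC0 : 0 ≤ C)
    (hC : ∀ x, |f x| ≤ C * (1 + ‖x‖ ^ 2)) (x x' : E) :
    f x - f x' ≤ (4 * C + 1) * ((1 + ‖x‖ ^ 2 + ‖x'‖ ^ 2) * ‖x - x'‖) := by
  rcases eq_or_ne x x' with rfl | hne
  · simp
  set r := ‖x - x'‖ with hr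
  have hr0 : 0 < r := norm_pos_iff.2 (sub_ne_zero.2 hne)
  set t := r / (1 + r) with ht
  have ht0 : 0 ≤ t := by positivity
  have ht1 : t ≤ 1 := by rw [ht, div_le_one (by positivity)]; linarith
  have htr : t ≤ r := by rw [ht, div_le_iff₀ (by positivity)]; nlinarith
  set z := x' + r⁻¹ • (x' - x) with hz
  have hnorm : ‖x' - x‖ = r := by rw [norm_sub_rev]
  have hzn : ‖z‖ ≤ ‖x'‖ + 1 := by
    refine (norm_add_le _ _).trans ?_
    rw [norm_smul, hnorm, norm_inv, Real.norm_eq_abs, abs_of_pos hr0, inv_mul_cancel₀ hr0.ne']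
  have hxz : x - z = (-(1 + r⁻¹)) • (x' - x) := by rw [hz]; module
  have hxzn : ‖x - z‖ = 1 + r := by
    rw [hxz, norm_smul, hnorm, norm_neg, Real.norm_eq_abs, abs_of_pos (by positivity)]
    field_simp
    ring
  have hcomb : (1 - t) • x + t • z = x' := by
    have : t * (1 + r⁻¹) = 1 := by rw [ht]; field_simp; ring
    have e : (1 - t) • x + t • z = x + (t * (1 + r⁻¹)) • (x' - x) := by rw [hz]; module
    rw [e, this]
    module
  have hs := potential_semiconcave h x z ht0 ht1
  rw [hcomb, hxzn] at hs
  have h1 : f x - f z ≤ C * (1 + ‖x‖ ^ 2) + C * (1 + ‖z‖ ^ 2) := by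
    linarith [abs_le.1 (hC x), abs_le.1 (hC z)]
  have hz2 : ‖z‖ ^ 2 ≤ 2 * ‖x'‖ ^ 2 + 2 := by
    nlinarith [norm_nonneg z, sq_nonneg (‖x'‖ - 1), norm_nonneg x']
  have h2 : f x - f z ≤ 4 * C * (1 + ‖x‖ ^ 2 + ‖x'‖ ^ 2) := by
    nlinarith [mul_le_mul_of_nonneg_left hz2 hC0, mul_nonneg hC0 (sq_nonneg ‖x‖),
      mul_nonneg hC0 (sq_nonneg ‖x'‖)]
  have hrle : r ≤ 1 + ‖x‖ ^ 2 + ‖x'‖ ^ 2 := by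
    have := norm_sub_le x x'
    nlinarith [sq_nonneg (‖x‖ - 1), sq_nonneg (‖x'‖ - 1), sq_nonneg (‖x‖), sq_nonneg (‖x'‖)]
  have hD0 : 0 ≤ 1 + ‖x‖ ^ 2 + ‖x'‖ ^ 2 := by positivity
  have ht2 : t * (1 + r) = r := by rw [ht]; field_simp
  have h3 : t * (1 - t) / 2 * (1 + r) ^ 2 ≤ r * (1 + ‖x‖ ^ 2 + ‖x'‖ ^ 2) := by
    have e : t * (1 - t) / 2 * (1 + r) ^ 2 = r * (1 + r - r) / 2 := by
      have : t * (1 - t) / 2 * (1 + r) ^ 2 = (t * (1 + r)) * (1 + r - t * (1 + r)) / 2 := by ring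
      rw [this, ht2]
    rw [e]
    nlinarith [sq_nonneg ‖x‖, sq_nonneg ‖x'‖, mul_nonneg hr0.le (sq_nonneg ‖x‖),
      mul_nonneg hr0.le (sq_nonneg ‖x'‖)]
  have h4 : t * (f x - f z) ≤ r * (4 * C * (1 + ‖x‖ ^ 2 + ‖x'‖ ^ 2)) :=
    (mul_le_mul_of_nonneg_left h2 ht0).trans
      (mul_le_mul_of_nonneg_right htr (by positivity))
  nlinarith

theorem abs_potential_sub_le {Q : Measure E} {f g : E → ℝ}
    (h : ∀ x, ∫ y, Real.exp (f x + g y - cost x y) ∂Q = 1) {C : ℝ} (hC0 : 0 ≤ C)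
    (hC : ∀ x, |f x| ≤ C * (1 + ‖x‖ ^ 2)) (x x' : E) :
    |f x - f x'| ≤ (4 * C + 1) * ((1 + ‖x‖ ^ 2 + ‖x'‖ ^ 2) * ‖x - x'‖) := by
  refine abs_le.2 ⟨?_, potential_sub_le h hC0 hC x x'⟩
  have := potential_sub_le h hC0 hC x' x
  rw [norm_sub_rev x' x] at this
  linarith

end Lipschitz

/-! ### First-order optimality: optimal potentials solve the Schrödinger system. -/

section Schrodinger

/-- `f`, `g` solve the Schrödinger system of `P` and `Q`: the measure with density
`exp (f(x) + g(y) - ½‖x - y‖²)` with respect to `P ⊗ Q` has marginals `P` and `Q`. -/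
structure IsSchrodingerPair {E : Type*} [NormedAddCommGroup E] [MeasurableSpace E]
    (P Q : Measure E) (f g : E → ℝ) : Prop where
  measurable_left : Measurable f
  measurable_right : Measurable g
  integrable_left : Integrable f P
  integrable_right : Integrable g Q
  integrable_exp : Integrable (fun z : E × E => Real.exp (f z.1 + g z.2 - cost z.1 z.2)) (P.prod Q)
  left : ∀ᵐ x ∂P, ∫ y, Real.exp (f x + g y - cost x y) ∂Q = 1
  right : ∀ᵐ y ∂Q, ∫ x, Real.exp (f x + g y - cost x y) ∂P = 1

/-- The difference of the two sides is minimal at t = 0, so its derivative vanishes there. -/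
theorem eq_of_forall_mul_le {p m : ℝ} (h : ∀ t : ℝ, t * p ≤ (Real.exp t - 1) * m) : m = p := by
  set φ : ℝ → ℝ := fun t => (Real.exp t - 1) * m - t * p with hφ
  have hmin : IsLocalMin φ 0 := Eventually.of_forall fun t => by
    simp only [hφ, Real.exp_zero, sub_self, zero_mul]
    linarith [h t]
  have hd : HasDerivAt φ (Real.exp 0 * m - 1 * p) 0 :=
    (((Real.hasDerivAt_exp 0).sub_const 1).mul_const m).sub ((hasDerivAt_id 0).mul_const p)
  have := hmin.hasDerivAt_eq_zero hd
  rw [Real.exp_zero] at this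
  linarith

/-- The hypothesis is optimality against perturbing one potential by t on a set A. Its derivative at
t = 0 identifies the mass of u over A with P(A), for every A. -/
theorem ae_integral_eq_one {α β : Type*} [MeasurableSpace α] [MeasurableSpace β]
    {P : Measure α} {Q : Measure β} [IsProbabilityMeasure P] [IsProbabilityMeasure Q]
    {u : α × β → ℝ} (hu : Integrable u (P.prod Q))
    (h : ∀ A : Set α, MeasurableSet A → ∀ t : ℝ, t * P.real A + ∫ z, u z ∂(P.prod Q)
      ≤ ∫ z, Real.exp (A.indicator (fun _ => t) z.1) * u z ∂(P.prod Q)) :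
    ∀ᵐ x ∂P, ∫ y, u (x, y) ∂Q = 1 := by
  refine Integrable.ae_eq_of_forall_setIntegral_eq _ (fun _ => 1) hu.integral_prod_left
    (integrable_const _) fun A hA _ => ?_
  have hA' : MeasurableSet (A ×ˢ (Set.univ : Set β)) := hA.prod MeasurableSet.univ
  have h1 : ∫ z in A ×ˢ Set.univ, u z ∂(P.prod Q) = P.real A := by
    refine eq_of_forall_mul_le fun t => ?_
    have h2 : ∀ z : α × β, Real.exp (A.indicator (fun _ => t) z.1) * u z
        = u z + (Real.exp t - 1) * (A ×ˢ Set.univ).indicator u z := by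
      intro z
      by_cases hz : z.1 ∈ A
      · rw [Set.indicator_of_mem hz, Set.indicator_of_mem (by simpa using hz)]
        ring
      · rw [Set.indicator_of_notMem hz, Set.indicator_of_notMem (by simpa using hz)]
        simp
    have h3 := h A hA t
    simp only [h2] at h3
    rw [integral_add hu ((hu.indicator hA').const_mul _), integral_const_mul,
      integral_indicator hA'] at h3
    linarith
  have h4 := setIntegral_prod (μ := P) (ν := Q) (s := A) (t := Set.univ) u hu.integrableOn
  simp only [Measure.restrict_univ] at h4
  rw [← h4, h1]
  simp

variable {d : ℕ} {P Q : Measure (EuclideanSpace ℝ (Fin d))}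

/-- Potentials are only a.e. strongly measurable; this permits replacing them by measurable
representatives. -/
theorem IsOptimalPotentials.congr [IsProbabilityMeasure P] [IsProbabilityMeasure Q]
    {f g f' g' : EuclideanSpace ℝ (Fin d) → ℝ} (h : IsOptimalPotentials P Q f g)
    (hf : f =ᵐ[P] f') (hg : g =ᵐ[Q] g') : IsOptimalPotentials P Q f' g' := by
  have : dualValue P Q f g = dualValue P Q f' g' := by
    unfold dualValue
    rw [integral_congr_ae hf, integral_congr_ae hg]
    congr 3
    refine lintegral_congr_ae ?_
    filter_upwards [Measure.quasiMeasurePreserving_fst.ae_eq_comp hf,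
      Measure.quasiMeasurePreserving_snd.ae_eq_comp hg] with z h1 h2
    simp only [Function.comp_apply] at h1 h2
    rw [h1, h2]
  exact ⟨h.integrable_left.congr hf, h.integrable_right.congr hg, fun a b ha hb =>
    this ▸ h.le_dualValue a b ha hb⟩

theorem dualValue_of_integrable [IsProbabilityMeasure P] [IsProbabilityMeasure Q]
    {f g : EuclideanSpace ℝ (Fin d) → ℝ}
    (h : Integrable (fun z : EuclideanSpace ℝ (Fin d) × EuclideanSpace ℝ (Fin d) =>
      Real.exp (f z.1 + g z.2 - cost z.1 z.2)) (P.prod Q)) :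
    dualValue P Q f g = ((∫ x, f x ∂P + ∫ y, g y ∂Q
      - ∫ z, Real.exp (f z.1 + g z.2 - cost z.1 z.2) ∂(P.prod Q) + 1 : ℝ) : EReal) := by
  have h1 := ofReal_integral_eq_lintegral_ofReal h (Eventually.of_forall fun z =>
      (Real.exp_pos _).le)
  simp only [cost] at h1 ⊢
  rw [dualValue, ← h1]
  rw [EReal.coe_ennreal_ofReal, max_eq_left (integral_nonneg fun z => (Real.exp_pos _).le)]
  push_cast
  rfl

theorem IsOptimalPotentials.isSchrodingerPair [IsProbabilityMeasure P] [IsProbabilityMeasure Q]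
    {f g : EuclideanSpace ℝ (Fin d) → ℝ} (h : IsOptimalPotentials P Q f g) (hf : Measurable f)
    (hg : Measurable g) : IsSchrodingerPair P Q f g := by
  have hmeas : ∀ f g : EuclideanSpace ℝ (Fin d) → ℝ, Measurable f → Measurable g →
      Measurable (fun z : EuclideanSpace ℝ (Fin d) × EuclideanSpace ℝ (Fin d) =>
          Real.exp (f z.1 + g z.2 - cost z.1 z.2)) := fun f g hf hg =>
    (((hf.comp measurable_fst).add (hg.comp measurable_snd)).sub measurable_cost).exp
  have hint : Integrable (fun z : EuclideanSpace ℝ (Fin d) × EuclideanSpace ℝ (Fin d) =>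
      Real.exp (f z.1 + g z.2 - cost z.1 z.2)) (P.prod Q) := by
    -- The zero pair has finite dual value because exp(-cost) ≤ 1, so the optimal value cannot be -∞
    -- and its exponential integral is finite.
    have h00 : Integrable (fun z : EuclideanSpace ℝ (Fin d) × EuclideanSpace ℝ (Fin d) =>
        Real.exp ((fun _ => (0 : ℝ)) z.1 + (fun _ => (0 : ℝ)) z.2
        - cost z.1 z.2)) (P.prod Q) := by
      refine Integrable.of_bound (C := 1)
        (hmeas _ _ measurable_const measurable_const).aestronglyMeasurable
        (Eventually.of_forall fun z => ?_)
      rw [Real.norm_eq_abs, Real.abs_exp, Real.exp_le_one_iff]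
      have := cost_nonneg z.1 z.2
      simpa using this
    have h0 := h.le_dualValue (fun _ => 0) (fun _ => 0) (integrable_const 0) (integrable_const 0)
    rw [dualValue_of_integrable h00] at h0
    refine ⟨(hmeas f g hf hg).aestronglyMeasurable, ?_⟩
    rw [hasFiniteIntegral_iff_ofReal (Eventually.of_forall fun z => (Real.exp_pos _).le),
        lt_top_iff_ne_top]
    intro htop
    have hb : dualValue P Q f g = ⊥ := by
      simp only [cost] at htop
      rw [dualValue, htop]
      simp
    rw [hb, le_bot_iff] at h0
    exact EReal.coe_ne_bot _ h0
  have hle : ∀ f' g' : EuclideanSpace ℝ (Fin d) → ℝ, Integrable f' P → Integrable g' Q →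
      Integrable (fun z : EuclideanSpace ℝ (Fin d) × EuclideanSpace ℝ (Fin d) =>
          Real.exp (f' z.1 + g' z.2 - cost z.1 z.2)) (P.prod Q) →
      ∫ x, f' x ∂P + ∫ y, g' y ∂Q
        - ∫ z, Real.exp (f' z.1 + g' z.2 - cost z.1 z.2) ∂(P.prod Q) ≤ ∫ x, f x ∂P + ∫ y, g y ∂Q
        - ∫ z, Real.exp (f z.1 + g z.2 - cost z.1 z.2) ∂(P.prod Q) := by
    intro f' g' hf' hg' hi
    have := h.le_dualValue f' g' hf' hg'
    rw [dualValue_of_integrable hi, dualValue_of_integrable hint, EReal.coe_le_coe_iff] at this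
    linarith
  have hexp : ∀ (A : Set (EuclideanSpace ℝ (Fin d))) (_ : MeasurableSet A) (t : ℝ)
      (p : EuclideanSpace ℝ (Fin d) × EuclideanSpace ℝ (Fin d) → EuclideanSpace ℝ (Fin d))
      (_ : Measurable p)
      (u : EuclideanSpace ℝ (Fin d) × EuclideanSpace ℝ (Fin d) → ℝ)
          (ρ : Measure (EuclideanSpace ℝ (Fin d) × EuclideanSpace ℝ (Fin d))), Integrable u ρ →
      Integrable (fun z : EuclideanSpace ℝ (Fin d) × EuclideanSpace ℝ (Fin d) =>
          Real.exp (A.indicator (fun _ => t) (p z)) * u z) ρ := by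
    intro A hA t p hp u ρ hu
    refine hu.bdd_mul (c := Real.exp |t|)
      (((measurable_const.indicator hA).comp hp).exp.aestronglyMeasurable)
      (Eventually.of_forall fun z => ?_)
    rw [Real.norm_eq_abs, Real.abs_exp, Real.exp_le_exp]
    by_cases hz : p z ∈ A
    · rw [Set.indicator_of_mem hz]; exact le_abs_self t
    · rw [Set.indicator_of_notMem hz]; exact abs_nonneg t
  refine ⟨hf, hg, h.integrable_left, h.integrable_right, hint, ?_, ?_⟩
  · refine ae_integral_eq_one hint fun A hA t => ?_
    have hAi : Integrable (A.indicator fun _ => t) P := (integrable_const t).indicator hA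
    have he : ∀ z : EuclideanSpace ℝ (Fin d) × EuclideanSpace ℝ (Fin d),
        Real.exp (A.indicator (fun _ => t) z.1)
        * Real.exp (f z.1 + g z.2 - cost z.1 z.2)
        = Real.exp ((f + A.indicator fun _ => t) z.1 + g z.2 - cost z.1 z.2) := by
      intro z
      rw [← Real.exp_add, Pi.add_apply]
      congr 1
      ring
    have hi := hexp A hA t _ measurable_fst _ _ hint
    simp only [he] at hi ⊢
    have := hle _ _ (h.integrable_left.add hAi) h.integrable_right hi
    rw [integral_add' h.integrable_left hAi, integral_indicator hA] at this
    simp at this ⊢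
    linarith
  · have hint' := hint.swap
    refine ae_integral_eq_one (u :=
        fun z : EuclideanSpace ℝ (Fin d) × EuclideanSpace ℝ (Fin d) =>
        Real.exp (f z.2 + g z.1 - cost z.2 z.1)) hint'
      fun A hA t => ?_
    have hAi : Integrable (A.indicator fun _ => t) Q := (integrable_const t).indicator hA
    have he : ∀ z : EuclideanSpace ℝ (Fin d) × EuclideanSpace ℝ (Fin d),
        Real.exp (A.indicator (fun _ => t) z.2)
        * Real.exp (f z.1 + g z.2 - cost z.1 z.2)
        = Real.exp (f z.1 + (g + A.indicator fun _ => t) z.2 - cost z.1 z.2) := by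
      intro z
      rw [← Real.exp_add, Pi.add_apply]
      congr 1
      ring
    have hi := hexp A hA t _ measurable_snd _ _ hint
    have s1 := integral_prod_swap (μ := P) (ν := Q)
      (fun z : EuclideanSpace ℝ (Fin d) × EuclideanSpace ℝ (Fin d) =>
          Real.exp (f z.1 + g z.2 - cost z.1 z.2))
    have s2 := integral_prod_swap (μ := P) (ν := Q)
      (fun z : EuclideanSpace ℝ (Fin d) × EuclideanSpace ℝ (Fin d) =>
          Real.exp (A.indicator (fun _ => t) z.2)
        * Real.exp (f z.1 + g z.2 - cost z.1 z.2))
    simp only [Prod.fst_swap, Prod.snd_swap] at s1 s2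
    rw [s1, s2]
    simp only [he] at hi ⊢
    have := hle _ _ h.integrable_left (h.integrable_right.add hAi) hi
    rw [integral_add' h.integrable_right hAi, integral_indicator hA] at this
    simp at this ⊢
    linarith

end Schrodinger

/-! ### Weak and strong duality. -/

section Duality

open InformationTheory

/-- The Fenchel–Young inequality between `klFun` and u ↦ exp u - 1, with equality at r = exp u. -/
theorem mul_sub_exp_add_one_le_klFun {r : ℝ} (hr : 0 ≤ r) (u : ℝ) :
    r * u - Real.exp u + 1 ≤ klFun r := by
  rw [klFun_apply]
  rcases hr.eq_or_lt with rfl | hr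
  · simp [(Real.exp_pos u).le]
  · have h := Real.add_one_le_exp (u - Real.log r)
    rw [Real.exp_sub, Real.exp_log hr, le_div_iff₀ hr] at h
    nlinarith

variable {d : ℕ} {P Q : Measure (EuclideanSpace ℝ (Fin d))}

theorem IsCoupling.measurePreserving_fst
    {π : Measure (EuclideanSpace ℝ (Fin d) × EuclideanSpace ℝ (Fin d))} (h : IsCoupling P Q π) :
    MeasurePreserving Prod.fst π P := ⟨measurable_fst, h.1⟩

theorem IsCoupling.measurePreserving_snd
    {π : Measure (EuclideanSpace ℝ (Fin d) × EuclideanSpace ℝ (Fin d))} (h : IsCoupling P Q π) :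
    MeasurePreserving Prod.snd π Q := ⟨measurable_snd, h.2⟩

theorem IsCoupling.integrable_add
    {π : Measure (EuclideanSpace ℝ (Fin d) × EuclideanSpace ℝ (Fin d))} (h : IsCoupling P Q π)
    {f g : EuclideanSpace ℝ (Fin d) → ℝ} (hf : Integrable f P) (hg : Integrable g Q) :
    Integrable (fun z => f z.1 + g z.2) π :=
  (h.measurePreserving_fst.integrable_comp_of_integrable hf).add
    (h.measurePreserving_snd.integrable_comp_of_integrable hg)

theorem IsCoupling.integral_add
    {π : Measure (EuclideanSpace ℝ (Fin d) × EuclideanSpace ℝ (Fin d))} (h : IsCoupling P Q π)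
    {f g : EuclideanSpace ℝ (Fin d) → ℝ} (hf : Integrable f P) (hg : Integrable g Q) :
    ∫ z, (f z.1 + g z.2) ∂π = ∫ x, f x ∂P + ∫ y, g y ∂Q := by
  have h1 := integral_map (μ := π) measurable_fst.aemeasurable (f := f)
    (by rw [h.1]; exact hf.aestronglyMeasurable)
  have h2 := integral_map (μ := π) measurable_snd.aemeasurable (f := g)
    (by rw [h.2]; exact hg.aestronglyMeasurable)
  rw [h.1] at h1
  rw [h.2] at h2
  rw [h1, h2]
  exact MeasureTheory.integral_add (h.measurePreserving_fst.integrable_comp_of_integrable hf)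
    (h.measurePreserving_snd.integrable_comp_of_integrable hg)

theorem IsCoupling.isProbabilityMeasure [IsProbabilityMeasure P]
    {π : Measure (EuclideanSpace ℝ (Fin d) × EuclideanSpace ℝ (Fin d))} (h : IsCoupling P Q π) :
    IsProbabilityMeasure π :=
  ⟨by rw [← Set.preimage_univ (f := Prod.fst),
      ← Measure.map_apply measurable_fst MeasurableSet.univ,
    h.1, measure_univ]⟩

theorem IsCoupling.integrable_cost
    {π : Measure (EuclideanSpace ℝ (Fin d) × EuclideanSpace ℝ (Fin d))} (h : IsCoupling P Q π)
    (hP2 : Integrable (fun x => ‖x‖ ^ 2) P) (hQ2 : Integrable (fun x => ‖x‖ ^ 2) Q) :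
    Integrable (fun z => cost z.1 z.2) π := by
  refine (h.integrable_add hP2 hQ2).mono' measurable_cost.aestronglyMeasurable
    (Eventually.of_forall fun z => ?_)
  rw [Real.norm_eq_abs, abs_of_nonneg (cost_nonneg _ _)]
  nlinarith [cost_le z.1 z.2, sq_nonneg (‖z.1‖ - ‖z.2‖)]

/-- Weak duality: Fenchel–Young is applied pointwise to the density of π and u = f + g - cost.
Integrating f + g against π sees only the marginals. -/
theorem le_primalCost [IsProbabilityMeasure P] [IsProbabilityMeasure Q]
    {f g : EuclideanSpace ℝ (Fin d) → ℝ} (hf : Integrable f P) (hg : Integrable g Q)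
    (hi : Integrable (fun z : EuclideanSpace ℝ (Fin d) × EuclideanSpace ℝ (Fin d) =>
      Real.exp (f z.1 + g z.2 - cost z.1 z.2)) (P.prod Q))
    (h1 : ∫ z, Real.exp (f z.1 + g z.2 - cost z.1 z.2) ∂(P.prod Q) ≤ 1)
    {π : Measure (EuclideanSpace ℝ (Fin d) × EuclideanSpace ℝ (Fin d))} (hπ : IsCoupling P Q π) :
    ENNReal.ofReal (∫ x, f x ∂P + ∫ y, g y ∂Q) ≤ primalCost P Q π := by
  have := hπ.isProbabilityMeasure
  rcases eq_or_ne (primalCost P Q π) ∞ with htop | htop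
  · rw [htop]; exact le_top
  rw [primalCost, ENNReal.add_ne_top] at htop
  have hac : π ≪ P.prod Q := (klDiv_ne_top_iff.1 htop.2).1
  have hc : Integrable (fun z : EuclideanSpace ℝ (Fin d) × EuclideanSpace ℝ (Fin d) =>
      cost z.1 z.2) π := by
    refine ⟨measurable_cost.aestronglyMeasurable, ?_⟩
    rw [hasFiniteIntegral_iff_ofReal (Eventually.of_forall fun z => cost_nonneg _ _)]
    exact lt_top_iff_ne_top.2 htop.1
  set r : EuclideanSpace ℝ (Fin d) × EuclideanSpace ℝ (Fin d) → ℝ :=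
    fun z => (π.rnDeriv (P.prod Q) z).toReal with hr
  have hk0 : ∀ z, 0 ≤ klFun (r z) := fun z => klFun_nonneg ENNReal.toReal_nonneg
  have hkm : Measurable (fun z => klFun (r z)) :=
    measurable_klFun.comp (Measure.measurable_rnDeriv _ _).ennreal_toReal
  have hki : Integrable (fun z => klFun (r z)) (P.prod Q) := by
    refine ⟨hkm.aestronglyMeasurable, ?_⟩
    rw [hasFiniteIntegral_iff_ofReal (Eventually.of_forall hk0),
        ← klDiv_eq_lintegral_klFun_of_ac hac]
    exact lt_top_iff_ne_top.2 htop.2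
  set u : EuclideanSpace ℝ (Fin d) × EuclideanSpace ℝ (Fin d) → ℝ :=
    fun z => f z.1 + g z.2 - cost z.1 z.2 with hu
  have hui : Integrable u π := (hπ.integrable_add hf hg).sub hc
  have huI : ∫ z, u z ∂π = ∫ x, f x ∂P + ∫ y, g y ∂Q - ∫ z, cost z.1 z.2 ∂π := by
    rw [← hπ.integral_add hf hg]
    exact integral_sub (hπ.integrable_add hf hg) hc
  have hru : Integrable (fun z => r z * u z) (P.prod Q) :=
    (integrable_rnDeriv_smul_iff hac).2 hui
  have hruI : ∫ z, r z * u z ∂(P.prod Q) = ∫ z, u z ∂π := integral_rnDeriv_smul hac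
  have hle : ∫ z, u z ∂π ≤ ∫ z, klFun (r z) ∂(P.prod Q) := by
    have hm := integral_mono ((hru.sub hi).add (integrable_const 1)) hki
      fun z => mul_sub_exp_add_one_le_klFun ENNReal.toReal_nonneg (u z)
    rw [integral_add' (hru.sub hi) (integrable_const 1), integral_sub' hru hi, hruI] at hm
    simp at hm
    linarith
  have e1 : ∫⁻ z, ENNReal.ofReal (‖z.1 - z.2‖ ^ 2 / 2) ∂π
      = ENNReal.ofReal (∫ z, cost z.1 z.2 ∂π) :=
    (ofReal_integral_eq_lintegral_ofReal hc (Eventually.of_forall fun z => cost_nonneg _ _)).symm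
  have e2 : klDiv π (P.prod Q) = ENNReal.ofReal (∫ z, klFun (r z) ∂(P.prod Q)) := by
    rw [klDiv_eq_lintegral_klFun_of_ac hac]
    exact (ofReal_integral_eq_lintegral_ofReal hki (Eventually.of_forall hk0)).symm
  rw [primalCost, e1, e2, ← ENNReal.ofReal_add (integral_nonneg fun z => cost_nonneg _ _)
    (integral_nonneg hk0)]
  exact ENNReal.ofReal_le_ofReal (by linarith)

theorem lintegral_exp_eq_one {α : Type*} [MeasurableSpace α] {μ : Measure α} {u : α → ℝ}
    (h : ∫ x, Real.exp (u x) ∂μ = 1) : ∫⁻ x, ENNReal.ofReal (Real.exp (u x)) ∂μ = 1 := by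
  have hi := integrable_of_integral_exp_eq_one h
  rw [← ofReal_integral_eq_lintegral_ofReal hi (Eventually.of_forall fun x =>
      (Real.exp_pos _).le), h,
    ENNReal.ofReal_one]

/-- The measure with density `exp (f(x) + g(y) - ½‖x - y‖²)` with respect to `P ⊗ Q`. -/
noncomputable def gibbsCoupling (P Q : Measure (EuclideanSpace ℝ (Fin d)))
    (f g : EuclideanSpace ℝ (Fin d) → ℝ) :
    Measure (EuclideanSpace ℝ (Fin d) × EuclideanSpace ℝ (Fin d)) :=
  (P.prod Q).withDensity fun z => ENNReal.ofReal (Real.exp (f z.1 + g z.2 - cost z.1 z.2))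

variable {f g : EuclideanSpace ℝ (Fin d) → ℝ}

theorem IsSchrodingerPair.measurable_density (h : IsSchrodingerPair P Q f g) :
    Measurable (fun z : EuclideanSpace ℝ (Fin d) × EuclideanSpace ℝ (Fin d) =>
      ENNReal.ofReal (Real.exp (f z.1 + g z.2 - cost z.1 z.2))) :=
  (((h.measurable_left.comp measurable_fst).add (h.measurable_right.comp measurable_snd)).sub
    measurable_cost).exp.ennreal_ofReal

variable [IsProbabilityMeasure P] [IsProbabilityMeasure Q]

theorem IsSchrodingerPair.isCoupling (h : IsSchrodingerPair P Q f g) :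
    IsCoupling P Q (gibbsCoupling P Q f g) := by
  have hm := h.measurable_density
  constructor
  · ext A hA
    rw [Measure.map_apply measurable_fst hA, gibbsCoupling,
      withDensity_apply _ (measurable_fst hA), ← lintegral_indicator (measurable_fst hA),
      lintegral_prod _ (hm.indicator (measurable_fst hA)).aemeasurable]
    have : ∀ᵐ x ∂P, ∫⁻ y, (Prod.fst ⁻¹' A).indicator (fun z : EuclideanSpace ℝ (Fin d) ×
        EuclideanSpace ℝ (Fin d) => ENNReal.ofReal (Real.exp (f z.1 + g z.2 - cost z.1 z.2))) (x,
            y) ∂Q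
        = A.indicator (fun _ => 1) x := by
      filter_upwards [h.left] with x hx
      by_cases hxA : x ∈ A
      · have hmem : ∀ y : EuclideanSpace ℝ (Fin d), (x, y) ∈ Prod.fst ⁻¹' A := fun y => hxA
        simp only [Set.indicator_of_mem, hmem, hxA]
        exact lintegral_exp_eq_one hx
      · have hmem : ∀ y : EuclideanSpace ℝ (Fin d), (x, y) ∉ Prod.fst ⁻¹' A := fun y => hxA
        simp only [Set.indicator_of_notMem, hmem, hxA, not_false_eq_true, lintegral_zero]
    rw [lintegral_congr_ae this, lintegral_indicator hA]
    simp
  · ext A hA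
    rw [Measure.map_apply measurable_snd hA, gibbsCoupling,
      withDensity_apply _ (measurable_snd hA), ← lintegral_indicator (measurable_snd hA),
      lintegral_prod_symm _ (hm.indicator (measurable_snd hA)).aemeasurable]
    have : ∀ᵐ y ∂Q, ∫⁻ x, (Prod.snd ⁻¹' A).indicator (fun z : EuclideanSpace ℝ (Fin d) ×
        EuclideanSpace ℝ (Fin d) => ENNReal.ofReal (Real.exp (f z.1 + g z.2 - cost z.1 z.2))) (x,
            y) ∂P
        = A.indicator (fun _ => 1) y := by
      filter_upwards [h.right] with y hy
      by_cases hyA : y ∈ A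
      · have hmem : ∀ x : EuclideanSpace ℝ (Fin d), (x, y) ∈ Prod.snd ⁻¹' A := fun x => hyA
        simp only [Set.indicator_of_mem, hmem, hyA]
        exact lintegral_exp_eq_one hy
      · have hmem : ∀ x : EuclideanSpace ℝ (Fin d), (x, y) ∉ Prod.snd ⁻¹' A := fun x => hyA
        simp only [Set.indicator_of_notMem, hmem, hyA, not_false_eq_true, lintegral_zero]
    rw [lintegral_congr_ae this, lintegral_indicator hA]
    simp

theorem IsSchrodingerPair.integral_exp_eq_one (h : IsSchrodingerPair P Q f g) :
    ∫ z, Real.exp (f z.1 + g z.2 - cost z.1 z.2) ∂(P.prod Q) = 1 := by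
  rw [integral_prod _ h.integrable_exp, integral_congr_ae (g := fun _ => 1) h.left]
  simp

/-- The Gibbs coupling has density exp u, the equality case of Fenchel–Young, so its cost meets the
weak lower bound. Nonnegativity is recorded so that the value survives passage from [0, ∞] to ℝ. -/
theorem IsSchrodingerPair.iInf_primalCost (h : IsSchrodingerPair P Q f g)
    (hP2 : Integrable (fun x => ‖x‖ ^ 2) P) (hQ2 : Integrable (fun x => ‖x‖ ^ 2) Q) :
    (⨅ (π : Measure (EuclideanSpace ℝ (Fin d) × EuclideanSpace ℝ (Fin d))) (_ : IsCoupling P Q π),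
      primalCost P Q π) = ENNReal.ofReal (∫ x, f x ∂P + ∫ y, g y ∂Q) ∧
    0 ≤ ∫ x, f x ∂P + ∫ y, g y ∂Q := by
  set π := gibbsCoupling P Q f g with hπdef
  have hπ : IsCoupling P Q π := h.isCoupling
  have := hπ.isProbabilityMeasure
  have hc := hπ.integrable_cost hP2 hQ2
  have hac : π ≪ P.prod Q := withDensity_absolutelyContinuous _ _
  set u : EuclideanSpace ℝ (Fin d) × EuclideanSpace ℝ (Fin d) → ℝ :=
    fun z => f z.1 + g z.2 - cost z.1 z.2 with hu
  have hm : Measurable (fun z => ENNReal.ofReal (Real.exp (u z))) := h.measurable_density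
  have hui : Integrable u π := (hπ.integrable_add h.integrable_left h.integrable_right).sub hc
  have huI : ∫ z, u z ∂π = ∫ x, f x ∂P + ∫ y, g y ∂Q - ∫ z, cost z.1 z.2 ∂π := by
    rw [← hπ.integral_add h.integrable_left h.integrable_right]
    exact integral_sub (hπ.integrable_add h.integrable_left h.integrable_right) hc
  have hexp : ∀ z, (ENNReal.ofReal (Real.exp (u z))).toReal = Real.exp (u z) := fun z =>
    ENNReal.toReal_ofReal (Real.exp_pos _).le
  have hru : Integrable (fun z => Real.exp (u z) * u z) (P.prod Q) := by
    have := (integrable_withDensity_iff_integrable_smul' hm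
      (Eventually.of_forall fun z => ENNReal.ofReal_lt_top)).1 hui
    simpa only [hexp, smul_eq_mul] using this
  have hruI : ∫ z, Real.exp (u z) * u z ∂(P.prod Q) = ∫ z, u z ∂π := by
    have := integral_withDensity_eq_integral_toReal_smul (μ := P.prod Q) hm
      (Eventually.of_forall fun z => ENNReal.ofReal_lt_top) u
    simp only [hexp, smul_eq_mul] at this
    exact this.symm
  have hk : ∀ z, klFun (Real.exp (u z)) = Real.exp (u z) * u z + 1 - Real.exp (u z) := by
    intro z
    rw [klFun_apply, Real.log_exp]
  have hki : Integrable (fun z => klFun (Real.exp (u z))) (P.prod Q) := by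
    simp only [hk]
    exact (hru.add (integrable_const 1)).sub h.integrable_exp
  have hkI : ∫ z, klFun (Real.exp (u z)) ∂(P.prod Q) = ∫ z, u z ∂π := by
    simp only [hk]
    have e := integral_sub' (hru.add (integrable_const 1)) h.integrable_exp
    rw [integral_add' hru (integrable_const 1), hruI, h.integral_exp_eq_one] at e
    simp at e
    exact e
  have hk0 : ∀ z, 0 ≤ klFun (Real.exp (u z)) := fun z => klFun_nonneg (Real.exp_pos _).le
  have e1 : ∫⁻ z, ENNReal.ofReal (‖z.1 - z.2‖ ^ 2 / 2) ∂π
      = ENNReal.ofReal (∫ z, cost z.1 z.2 ∂π) :=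
    (ofReal_integral_eq_lintegral_ofReal hc (Eventually.of_forall fun z => cost_nonneg _ _)).symm
  have e2 : klDiv π (P.prod Q) = ENNReal.ofReal (∫ z, klFun (Real.exp (u z)) ∂(P.prod Q)) := by
    rw [klDiv_eq_lintegral_klFun_of_ac hac, ofReal_integral_eq_lintegral_ofReal hki
      (Eventually.of_forall hk0)]
    refine lintegral_congr_ae ?_
    filter_upwards [Measure.rnDeriv_withDensity (P.prod Q) hm] with z hz
    rw [hπdef, gibbsCoupling, hz, hexp]
  have hc0 : 0 ≤ ∫ z, cost z.1 z.2 ∂π := integral_nonneg fun z => cost_nonneg _ _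
  have hK0 : 0 ≤ ∫ z, klFun (Real.exp (u z)) ∂(P.prod Q) := integral_nonneg hk0
  have hval : primalCost P Q π = ENNReal.ofReal (∫ x, f x ∂P + ∫ y, g y ∂Q) := by
    rw [primalCost, e1, e2, ← ENNReal.ofReal_add hc0 hK0]
    congr 1
    linarith
  refine ⟨le_antisymm ((iInf₂_le π hπ).trans hval.le) (le_iInf₂ fun π' hπ' => ?_), by linarith⟩
  exact le_primalCost h.integrable_left h.integrable_right h.integrable_exp
    h.integral_exp_eq_one.le hπ'

/-- A Schrödinger pair attains the entropic transportation cost. -/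
theorem IsSchrodingerPair.entropicCost_eq (h : IsSchrodingerPair P Q f g)
    (hP2 : Integrable (fun x => ‖x‖ ^ 2) P) (hQ2 : Integrable (fun x => ‖x‖ ^ 2) Q) :
    entropicCost P Q = ∫ x, f x ∂P + ∫ y, g y ∂Q := by
  obtain ⟨h1, h2⟩ := h.iInf_primalCost hP2 hQ2
  rw [entropicCost, h1, ENNReal.toReal_ofReal h2]

/-- The Schrödinger pair (f, g) serves to identify the infimum with a finite nonnegative real, which
allows weak duality for f', g' to be read in ℝ. -/
theorem IsSchrodingerPair.le_entropicCost {f' g' : EuclideanSpace ℝ (Fin d) → ℝ}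
    (h : IsSchrodingerPair P Q f g)
    (hP2 : Integrable (fun x => ‖x‖ ^ 2) P) (hQ2 : Integrable (fun x => ‖x‖ ^ 2) Q)
    (hf : Integrable f' P) (hg : Integrable g' Q)
    (hi : Integrable (fun z : EuclideanSpace ℝ (Fin d) × EuclideanSpace ℝ (Fin d) =>
      Real.exp (f' z.1 + g' z.2 - cost z.1 z.2)) (P.prod Q))
    (h1 : ∫ z, Real.exp (f' z.1 + g' z.2 - cost z.1 z.2) ∂(P.prod Q) ≤ 1) :
    ∫ x, f' x ∂P + ∫ y, g' y ∂Q ≤ entropicCost P Q := by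
  obtain ⟨h2, h3⟩ := h.iInf_primalCost hP2 hQ2
  have hle := le_iInf₂ fun π' (hπ' : IsCoupling P Q π') => le_primalCost hf hg hi h1 hπ'
  rw [h2, ENNReal.ofReal_le_ofReal_iff h3] at hle
  rwa [h.entropicCost_eq hP2 hQ2]

end Duality

/-! ### Integration against the empirical measure. -/

section Empirical

variable {d : ℕ}

theorem integrable_empiricalMeasure (n : ℕ) (x : ℕ → EuclideanSpace ℝ (Fin d))
    (ψ : EuclideanSpace ℝ (Fin d) → ℝ) : Integrable ψ (empiricalMeasure n x) := by
  rcases Nat.eq_zero_or_pos n with rfl | hn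
  · simp [empiricalMeasure]
  · refine Integrable.smul_measure ?_ (by simp; omega)
    exact integrable_finsetSum_measure.2 fun i _ => integrable_dirac (by simp)

theorem integral_empiricalMeasure (n : ℕ) (x : ℕ → EuclideanSpace ℝ (Fin d))
    (ψ : EuclideanSpace ℝ (Fin d) → ℝ) : ∫ z, ψ z ∂(empiricalMeasure n x) = avg n ψ x := by
  rw [empiricalMeasure, integral_smul_measure, integral_finsetSum_measure
    fun i _ => integrable_dirac (by simp)]
  simp [avg, integral_dirac]

theorem isProbabilityMeasure_empiricalMeasure {n : ℕ} (hn : 1 ≤ n)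
    (x : ℕ → EuclideanSpace ℝ (Fin d)) : IsProbabilityMeasure (empiricalMeasure n x) := by
  refine ⟨?_⟩
  simp only [empiricalMeasure, Measure.smul_apply, Measure.finsetSum_apply, measure_univ,
    Finset.sum_const, Finset.card_range, smul_eq_mul, nsmul_eq_mul, mul_one]
  exact ENNReal.inv_mul_cancel (by simp; omega) (by simp)

theorem ae_empiricalMeasure {n : ℕ} {x : ℕ → EuclideanSpace ℝ (Fin d)}
    {p : EuclideanSpace ℝ (Fin d) → Prop} (h : ∀ i < n, p (x i)) :
    ∀ᵐ z ∂(empiricalMeasure n x), p z := by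
  refine Measure.ae_smul_measure ?_ _
  rw [ae_finsetSum_measure_iff]
  intro i hi
  rw [ae_dirac_eq]
  exact h i (Finset.mem_range.1 hi)

end Empirical

/-! ### The dual problem for finitely many points, with the second potential eliminated. -/

section SemiDiscrete

variable {E ι : Type*} [NormedAddCommGroup E] [Fintype ι]

/-- `log (N⁻¹ ∑ i, exp (a i - ½‖p i - y‖²))`, where `N` is the number of indices. -/
noncomputable def logMean (p : ι → E) (a : ι → ℝ) (y : E) : ℝ :=
  Real.log ((Fintype.card ι : ℝ)⁻¹ * ∑ i, Real.exp (a i - cost (p i) y))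

section NonemptyIndex

variable [Nonempty ι]

theorem card_pos_real : (0 : ℝ) < Fintype.card ι := by exact_mod_cast Fintype.card_pos

theorem mean_exp_pos (p : ι → E) (a : ι → ℝ) (y : E) :
    0 < (Fintype.card ι : ℝ)⁻¹ * ∑ i, Real.exp (a i - cost (p i) y) :=
  mul_pos (inv_pos.2 card_pos_real)
    (Finset.sum_pos (fun _ _ => Real.exp_pos _) Finset.univ_nonempty)

theorem exp_logMean (p : ι → E) (a : ι → ℝ) (y : E) : Real.exp (logMean p a y)
    = (Fintype.card ι : ℝ)⁻¹ * ∑ i, Real.exp (a i - cost (p i) y) :=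
  Real.exp_log (mean_exp_pos p a y)

/-- With second potential `-logMean`, the marginal condition on the Q side holds identically. -/
theorem mean_exp_sub_logMean (p : ι → E) (a : ι → ℝ) (y : E) :
    (Fintype.card ι : ℝ)⁻¹ * ∑ i, Real.exp (a i - cost (p i) y - logMean p a y) = 1 := by
  simp only [Real.exp_sub _ (logMean p a y)]
  rw [← Finset.sum_div, mul_div_assoc', exp_logMean, div_self (mean_exp_pos p a y).ne']

theorem logMean_add_const (p : ι → E) (a : ι → ℝ) (s : ℝ) (y : E) :
    logMean p (fun i => a i + s) y = logMean p a y + s := by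
  rw [← Real.exp_eq_exp, Real.exp_add, exp_logMean, exp_logMean, mul_assoc, Finset.sum_mul]
  congr 2
  funext i
  rw [← Real.exp_add]
  congr 1
  ring

theorem logMean_mono (p : ι → E) {a b : ι → ℝ} (h : ∀ i, a i ≤ b i) (y : E) :
    logMean p a y ≤ logMean p b y := by
  rw [← Real.exp_le_exp, exp_logMean, exp_logMean]
  gcongr with i
  exact h i

theorem logMean_le_add_norm (p : ι → E) (a b : ι → ℝ) (y : E) :
    logMean p a y ≤ logMean p b y + ‖a - b‖ := by
  rw [← logMean_add_const]
  refine logMean_mono p (fun i => ?_) y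
  have := (le_abs_self _).trans (norm_le_pi_norm (a - b) i)
  simp only [Pi.sub_apply] at this
  linarith

theorem logMean_zero_le (p : ι → E) (y : E) : logMean p 0 y ≤ 0 := by
  rw [← Real.exp_le_exp, exp_logMean, Real.exp_zero]
  have : ∑ i, Real.exp ((0 : ι → ℝ) i - cost (p i) y) ≤ ∑ _i : ι, (1 : ℝ) :=
    Finset.sum_le_sum fun i _ => by
      rw [Real.exp_le_one_iff]
      simpa using cost_nonneg (p i) y
  calc _ ≤ (Fintype.card ι : ℝ)⁻¹ * ∑ _i : ι, (1 : ℝ) := by gcongr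
    _ = 1 := by
      rw [Finset.sum_const, Finset.card_univ, nsmul_eq_mul, mul_one]
      exact inv_mul_cancel₀ card_pos_real.ne'

theorem le_logMean (p : ι → E) (a : ι → ℝ) (i : ι) (y : E) :
    a i - cost (p i) y - Real.log (Fintype.card ι) ≤ logMean p a y := by
  rw [← Real.exp_le_exp, exp_logMean, Real.exp_sub, Real.exp_log card_pos_real, div_eq_inv_mul]
  gcongr
  exact Finset.single_le_sum (f := fun i => Real.exp (a i - cost (p i) y))
    (fun i _ => (Real.exp_pos _).le) (Finset.mem_univ i)

/-- Jensen's inequality, obtained by averaging u + 1 ≤ exp u at the normalized exponents. -/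
theorem mean_le_logMean (p : ι → E) (a : ι → ℝ) (y : E) :
    (Fintype.card ι : ℝ)⁻¹ * ∑ i, (a i - cost (p i) y) ≤ logMean p a y := by
  have h1 : (Fintype.card ι : ℝ)⁻¹ * ∑ i, (a i - cost (p i) y - logMean p a y + 1) ≤ 1 := by
    refine le_trans ?_ (mean_exp_sub_logMean p a y).le
    gcongr
    exact Real.add_one_le_exp _
  simp only [Finset.sum_add_distrib, Finset.sum_sub_distrib, Finset.sum_const, Finset.card_univ,
    nsmul_eq_mul, mul_one] at h1 ⊢
  have hN := card_pos_real (ι := ι)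
  have e1 : (Fintype.card ι : ℝ)⁻¹ * (Fintype.card ι : ℝ) = 1 := inv_mul_cancel₀ hN.ne'
  have e2 : (Fintype.card ι : ℝ)⁻¹ * ((Fintype.card ι : ℝ) * logMean p a y) = logMean p a y := by
    rw [← mul_assoc, e1, one_mul]
  rw [mul_add, mul_sub, e1, e2] at h1
  linarith

/-- Apply log r ≤ r - 1 to the ratio of the two means. The one-sided estimate suffices for the
first-order condition at a maximum. -/
theorem logMean_update_le [DecidableEq ι] (p : ι → E) (a : ι → ℝ) (i : ι) (t : ℝ) (y : E) :
    logMean p (Function.update a i (a i + t)) y ≤ logMean p a y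
      + (Fintype.card ι : ℝ)⁻¹ * ((Real.exp t - 1)
          * Real.exp (a i - cost (p i) y - logMean p a y)) := by
  set S := (Fintype.card ι : ℝ)⁻¹ * ∑ j, Real.exp (a j - cost (p j) y) with hS
  have hS0 : 0 < S := mean_exp_pos p a y
  have h1 : ∑ j, Real.exp (Function.update a i (a i + t) j - cost (p j) y)
      = ∑ j, Real.exp (a j - cost (p j) y) + (Real.exp t - 1) * Real.exp (a i - cost (p i) y) := by
    rw [← Finset.add_sum_erase _ _ (Finset.mem_univ i),
      ← Finset.add_sum_erase (a := i) _ _ (Finset.mem_univ i)]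
    have : ∑ j ∈ Finset.univ.erase i, Real.exp (Function.update a i (a i + t) j - cost (p j) y)
        = ∑ j ∈ Finset.univ.erase i, Real.exp (a j - cost (p j) y) :=
      Finset.sum_congr rfl fun j hj => by
        rw [Function.update_of_ne (Finset.ne_of_mem_erase hj)]
    rw [this, Function.update_self, add_sub_right_comm, Real.exp_add]
    ring
  set S' := (Fintype.card ι : ℝ)⁻¹ * ∑ j, Real.exp (Function.update a i (a i + t) j - cost (p j) y)
    with hS'
  have hS'0 : 0 < S' := mean_exp_pos p _ y
  have h2 : S' / S - 1 = (Fintype.card ι : ℝ)⁻¹ * ((Real.exp t - 1)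
      * Real.exp (a i - cost (p i) y - logMean p a y)) := by
    rw [Real.exp_sub _ (logMean p a y), exp_logMean, ← hS, hS', h1, mul_add, ← hS, add_div,
      div_self hS0.ne']
    ring
  have h3 := Real.log_le_sub_one_of_pos (div_pos hS'0 hS0)
  rw [Real.log_div hS'0.ne' hS0.ne', h2] at h3
  simp only [logMean, ← hS, ← hS'] at h3 ⊢
  linarith

end NonemptyIndex

variable [MeasurableSpace E]

/-- The dual functional of the entropic problem between the uniform measure on the points `p i` and
`Q`, as a function of the values of the first potential at these points. -/
noncomputable def semiDual (Q : Measure E) (p : ι → E) (a : ι → ℝ) : ℝ :=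
  (Fintype.card ι : ℝ)⁻¹ * ∑ i, a i - ∫ y, logMean p a y ∂Q

theorem semiDual_zero_nonneg [Nonempty ι] {Q : Measure E} (p : ι → E) : 0 ≤ semiDual Q p 0 := by
  have : ∫ y, logMean p 0 y ∂Q ≤ 0 := integral_nonpos fun y => logMean_zero_le p y
  simp only [semiDual, Pi.zero_apply, Finset.sum_const_zero, mul_zero]
  linarith

variable [BorelSpace E] [SecondCountableTopology E]

theorem measurable_logMean (p : ι → E) (a : ι → ℝ) : Measurable (logMean p a) := by
  unfold logMean
  fun_prop

variable [Nonempty ι] {κ : ℝ} {Q : Measure E} [IsProbabilityMeasure Q]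

theorem HasExpMoments.integrable_logMean (hQ : HasExpMoments κ Q) (p : ι → E) (a : ι → ℝ) :
    Integrable (logMean p a) Q := by
  obtain ⟨i⟩ := ‹Nonempty ι›
  refine (((hQ.integrable_cost (p i)).add (integrable_const (Real.log (Fintype.card ι)))).add
    (integrable_const ‖a‖)).mono' (measurable_logMean p a).aestronglyMeasurable
    (Eventually.of_forall fun y => ?_)
  have : Nonempty ι := ⟨i⟩
  have h1 := le_logMean p a i y
  have h2 := logMean_le_add_norm p a 0 y
  have h3 := logMean_zero_le p y
  have h4 := (neg_abs_le _).trans' (neg_le_neg (norm_le_pi_norm a i))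
  have h5 : 0 ≤ Real.log (Fintype.card ι) := Real.log_natCast_nonneg _
  have h6 := cost_nonneg (p i) y
  rw [sub_zero] at h2
  rw [Real.norm_eq_abs, abs_le]
  simp only [Pi.add_apply]
  exact ⟨by linarith, by linarith⟩

theorem semiDual_add_const (hQ : HasExpMoments κ Q) (p : ι → E) (a : ι → ℝ) (s : ℝ) :
    semiDual Q p (fun i => a i + s) = semiDual Q p a := by
  unfold semiDual
  simp only [logMean_add_const]
  rw [integral_add (hQ.integrable_logMean p a) (integrable_const s), Finset.sum_add_distrib,
    Finset.sum_const, Finset.card_univ, nsmul_eq_mul, mul_add, ← mul_assoc,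
    inv_mul_cancel₀ card_pos_real.ne']
  simp

theorem semiDual_le_add (hQ : HasExpMoments κ Q) (p : ι → E) (a b : ι → ℝ) :
    semiDual Q p a ≤ semiDual Q p b + 2 * ‖a - b‖ := by
  unfold semiDual
  have h1 : ∫ y, logMean p b y ∂Q ≤ ∫ y, logMean p a y ∂Q + ‖b - a‖ := by
    calc _ ≤ ∫ y, (logMean p a y + ‖b - a‖) ∂Q :=
          integral_mono (hQ.integrable_logMean p b)
            ((hQ.integrable_logMean p a).add (integrable_const _)) (logMean_le_add_norm p b a)
      _ = _ := by
          rw [integral_add (hQ.integrable_logMean p a) (integrable_const _)]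
          simp
  have h2 : (Fintype.card ι : ℝ)⁻¹ * ∑ i, a i ≤ (Fintype.card ι : ℝ)⁻¹ * ∑ i, (b i + ‖a - b‖) := by
    gcongr with i
    have := (le_abs_self _).trans (norm_le_pi_norm (a - b) i)
    simp only [Pi.sub_apply] at this
    linarith
  rw [Finset.sum_add_distrib, Finset.sum_const, Finset.card_univ, nsmul_eq_mul, mul_add,
      ← mul_assoc,
    inv_mul_cancel₀ card_pos_real.ne', one_mul] at h2
  rw [norm_sub_rev] at h1
  linarith

theorem continuous_semiDual (hQ : HasExpMoments κ Q) (p : ι → E) : Continuous (semiDual Q p) := by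
  refine (LipschitzWith.of_dist_le_mul (K := 2) fun a b => ?_).continuous
  rw [Real.dist_eq, dist_eq_norm, abs_le]
  have h1 := semiDual_le_add hQ p a b
  have h2 := semiDual_le_add hQ p b a
  rw [norm_sub_rev b a] at h2
  norm_num
  exact ⟨by linarith, by linarith⟩

/-- The dual is invariant under constants, so the largest coordinate may be taken to be 0. If
another coordinate is below -M, the value is at most 0, which a = 0 already attains or exceeds;
compactness of the box does the rest. -/
theorem exists_isMax_semiDual (hQ : HasExpMoments κ Q) (p : ι → E) :
    ∃ b : ι → ℝ, (∀ a, semiDual Q p a ≤ semiDual Q p b) ∧ ∫ y, logMean p b y ∂Q = 0 := by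
  classical
  have hN := card_pos_real (ι := ι)
  set C : ℝ := ∑ i, ∫ y, cost (p i) y ∂Q + Real.log (Fintype.card ι) with hC
  have hc0 : ∀ i, 0 ≤ ∫ y, cost (p i) y ∂Q := fun i => integral_nonneg fun y => cost_nonneg _ _
  have hC0 : 0 ≤ C := add_nonneg (Finset.sum_nonneg fun i _ => hc0 i) (Real.log_natCast_nonneg _)
  set M : ℝ := Fintype.card ι * C with hM
  have hM0 : 0 ≤ M := by positivity
  obtain ⟨b, hbK, hb⟩ := (isCompact_Icc (a := fun _ : ι => -M) (b := fun _ =>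
      (0 : ℝ))).exists_isMaxOn
    ⟨0, fun i => by simpa using hM0, fun i => le_refl _⟩ (continuous_semiDual hQ p).continuousOn
  have hmax : ∀ a, semiDual Q p a ≤ semiDual Q p b := by
    intro a
    obtain ⟨j, hj⟩ := Finite.exists_max a
    set a' : ι → ℝ := fun i => a i + -a j with ha'
    have hle : ∀ i, a' i ≤ 0 := fun i => by simp only [ha']; linarith [hj i]
    rw [← semiDual_add_const hQ p a (-a j)]
    change semiDual Q p a' ≤ _
    by_cases hK : ∀ i, -M ≤ a' i
    · exact hb ⟨hK, hle⟩
    · push Not at hK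
      obtain ⟨i, hi⟩ := hK
      have h0 : semiDual Q p 0 ≤ semiDual Q p b :=
        hb ⟨fun i => by simpa using hM0, fun i => le_refl _⟩
      have h1 : semiDual Q p a' ≤ 0 := by
        have h2 : (Fintype.card ι : ℝ)⁻¹ * ∑ i, a' i ≤ (Fintype.card ι : ℝ)⁻¹ * (-M) := by
          gcongr
          rw [← Finset.add_sum_erase _ _ (Finset.mem_univ i)]
          have := Finset.sum_nonpos (s := Finset.univ.erase i) fun k _ => hle k
          linarith
        have h3 : (Fintype.card ι : ℝ)⁻¹ * (-M) = -C := by rw [hM]; field_simp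
        have h4 : ∫ y, (-cost (p j) y - Real.log (Fintype.card ι)) ∂Q ≤ ∫ y, logMean p a' y ∂Q := by
          refine integral_mono ((hQ.integrable_cost (p j)).neg.sub (integrable_const _))
            (hQ.integrable_logMean p a') fun y => ?_
          have := le_logMean p a' j y
          simp only [ha', add_neg_cancel, zero_sub] at this
          exact this
        rw [integral_sub (f := fun y => -cost (p j) y) (hQ.integrable_cost (p j)).neg
          (integrable_const _), integral_neg] at h4
        have h5 := Finset.single_le_sum (f := fun i => ∫ y, cost (p i) y ∂Q) (fun i _ => hc0 i)
          (Finset.mem_univ j)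
        simp only [integral_const, probReal_univ, one_smul] at h4
        unfold semiDual
        linarith
      linarith [semiDual_zero_nonneg (Q := Q) p]
  -- The remaining freedom of a constant normalizes the second potential to Q-mean zero.
  refine ⟨fun i => b i + -∫ y, logMean p b y ∂Q, fun a => ?_, ?_⟩
  · rw [semiDual_add_const hQ]; exact hmax a
  · simp only [logMean_add_const]
    rw [integral_add (hQ.integrable_logMean p b) (integrable_const _)]
    simp

/-- Varying only the i-th coordinate of a maximizer gives the normalization equation at the i-th
point. -/
theorem integral_exp_of_isMax_semiDual (hQ : HasExpMoments κ Q) {p : ι → E} {b : ι → ℝ}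
    (hb : ∀ a, semiDual Q p a ≤ semiDual Q p b) (i : ι) :
    ∫ y, Real.exp (b i + -logMean p b y - cost (p i) y) ∂Q = 1 := by
  classical
  have hN := card_pos_real (ι := ι)
  have hwm : Measurable (fun y => Real.exp (b i - cost (p i) y - logMean p b y)) := by
    have := measurable_logMean p b
    fun_prop
  have hw : Integrable (fun y => Real.exp (b i - cost (p i) y - logMean p b y)) Q := by
    refine Integrable.of_bound hwm.aestronglyMeasurable (Fintype.card ι : ℝ)
      (Eventually.of_forall fun y => ?_)
    rw [Real.norm_eq_abs, Real.abs_exp, ← Real.le_log_iff_exp_le hN]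
    linarith [le_logMean p b i y]
  have e : ∀ y, b i + -logMean p b y - cost (p i) y = b i - cost (p i) y - logMean p b y := by
    intro y; ring
  simp only [e]
  refine eq_of_forall_mul_le fun t => ?_
  have h1 := hb (Function.update b i (b i + t))
  have h2 : ∫ y, logMean p (Function.update b i (b i + t)) y ∂Q ≤ ∫ y, logMean p b y ∂Q
      + (Fintype.card ι : ℝ)⁻¹ * ((Real.exp t - 1)
        * ∫ y, Real.exp (b i - cost (p i) y - logMean p b y) ∂Q) := by
    rw [← integral_const_mul, ← integral_const_mul,
      ← integral_add (hQ.integrable_logMean p b) ((hw.const_mul _).const_mul _)]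
    exact integral_mono (hQ.integrable_logMean p _)
      ((hQ.integrable_logMean p b).add ((hw.const_mul _).const_mul _)) (logMean_update_le p b i t)
  have h3 : ∑ j, Function.update b i (b i + t) j = ∑ j, b j + t := by
    rw [Finset.sum_update_of_mem (Finset.mem_univ i),
      ← Finset.add_sum_erase _ _ (Finset.mem_univ i), Finset.sdiff_singleton_eq_erase]
    ring
  unfold semiDual at h1
  rw [h3] at h1
  have h4 : (Fintype.card ι : ℝ)⁻¹ * t ≤ (Fintype.card ι : ℝ)⁻¹ * ((Real.exp t - 1)
        * ∫ y, Real.exp (b i - cost (p i) y - logMean p b y) ∂Q) := by linarith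
  rw [mul_one]
  exact le_of_mul_le_mul_left h4 (inv_pos.2 hN)

end SemiDiscrete

/-! ### Empirical potentials and measurability of the empirical cost. -/

section EmpiricalPotentials

variable {d : ℕ}

/-- `f`, `g` are optimal potentials for the empirical measure of `x 0, …, x (n - 1)` and `Q`,
normalized by `∫ g dQ = 0`. -/
structure IsEmpiricalPotentials (Q : Measure (EuclideanSpace ℝ (Fin d))) (n : ℕ)
    (x : ℕ → EuclideanSpace ℝ (Fin d)) (f g : EuclideanSpace ℝ (Fin d) → ℝ) : Prop where
  measurable_left : Measurable f
  measurable_right : Measurable g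
  integrable_right : Integrable g Q
  integral_right : ∫ y, g y ∂Q = 0
  integral_exp : ∀ z, ∫ y, Real.exp (f z + g y - cost z y) ∂Q = 1
  right_le : ∀ y, g y ≤ ‖y‖ ^ 2 / 2 + avg n (fun z => ‖z‖) x * ‖y‖ + avg n (fun z => ‖z‖ ^ 2) x / 2
  entropicCost_eq : entropicCost (empiricalMeasure n x) Q = avg n f x
  nonneg : 0 ≤ avg n f x

theorem integrable_exp_empiricalMeasure_prod {Q : Measure (EuclideanSpace ℝ (Fin d))}
    [IsProbabilityMeasure Q] {n : ℕ} {x : ℕ → EuclideanSpace ℝ (Fin d)}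
    {f g : EuclideanSpace ℝ (Fin d) → ℝ} (hf : Measurable f) (hg : Measurable g)
    (h : ∀ i < n, ∫ y, Real.exp (f (x i) + g y - cost (x i) y) ∂Q = 1) :
    Integrable (fun z : EuclideanSpace ℝ (Fin d) × EuclideanSpace ℝ (Fin d) =>
      Real.exp (f z.1 + g z.2 - cost z.1 z.2)) ((empiricalMeasure n x).prod Q) := by
  refine (integrable_prod_iff ?_).2 ⟨?_, integrable_empiricalMeasure n x _⟩
  · exact (((hf.comp measurable_fst).add (hg.comp measurable_snd)).sub
      measurable_cost).exp.aestronglyMeasurable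
  · exact ae_empiricalMeasure fun i hi => integrable_of_integral_exp_eq_one (h i hi)

theorem integral_exp_empiricalMeasure_prod {Q : Measure (EuclideanSpace ℝ (Fin d))}
    [IsProbabilityMeasure Q] {n : ℕ} (hn : 1 ≤ n) {x : ℕ → EuclideanSpace ℝ (Fin d)}
    {f g : EuclideanSpace ℝ (Fin d) → ℝ} (hf : Measurable f) (hg : Measurable g)
    (h : ∀ i < n, ∫ y, Real.exp (f (x i) + g y - cost (x i) y) ∂Q = 1) :
    ∫ z, Real.exp (f z.1 + g z.2 - cost z.1 z.2) ∂((empiricalMeasure n x).prod Q) = 1 := by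
  have := isProbabilityMeasure_empiricalMeasure hn x
  rw [integral_prod _ (integrable_exp_empiricalMeasure_prod hf hg h),
    integral_congr_ae (g := fun _ => 1) (ae_empiricalMeasure h)]
  simp

variable {κ : ℝ} {Q : Measure (EuclideanSpace ℝ (Fin d))} [IsProbabilityMeasure Q]

/-- The maximizer of the semi-discrete dual gives g, and its soft transform extends the finitely
many values b to the whole space, with normalization at every point. The maximum characterization is
kept for the measurability proof. -/
theorem exists_isEmpiricalPotentials (hQ : HasExpMoments κ Q) {n : ℕ} (hn : 1 ≤ n)
    (x : ℕ → EuclideanSpace ℝ (Fin d)) :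
    ∃ f g, IsEmpiricalPotentials Q n x f g ∧
      IsSchrodingerPair (empiricalMeasure n x) Q f g ∧
      IsGreatest (Set.range (semiDual Q (fun i : Fin n => x i)))
        (entropicCost (empiricalMeasure n x) Q) := by
  have : Nonempty (Fin n) := ⟨⟨0, hn⟩⟩
  have hP := isProbabilityMeasure_empiricalMeasure hn x
  set p : Fin n → EuclideanSpace ℝ (Fin d) := fun i => x i with hp
  obtain ⟨b, hb, hb0⟩ := exists_isMax_semiDual hQ p
  set g : EuclideanSpace ℝ (Fin d) → ℝ := fun y => -logMean p b y with hg
  set f := softTransform Q g with hf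
  have hgm : Measurable g := (measurable_logMean p b).neg
  have hfm : Measurable f := measurable_softTransform hgm
  have hgi : Integrable g Q := (hQ.integrable_logMean p b).neg
  have hg0 : ∫ y, g y ∂Q = 0 := by rw [hg, integral_neg, hb0, neg_zero]
  have havg : ∀ ψ : EuclideanSpace ℝ (Fin d) → ℝ,
      avg n ψ x = (Fintype.card (Fin n) : ℝ)⁻¹ * ∑ i, ψ (p i) := by
    intro ψ
    rw [avg, Finset.sum_range, Fintype.card_fin]
  have hbi : ∀ i, b i = f (p i) := fun i =>
    eq_softTransform (integral_exp_of_isMax_semiDual hQ hb i)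
  have hD : semiDual Q p b = avg n f x := by
    rw [semiDual, hb0, sub_zero, havg]
    simp only [hbi]
  have h0 : 0 ≤ avg n f x := hD ▸ (semiDual_zero_nonneg p).trans (hb 0)
  -- Jensen bounds g by the mean cost minus the mean of f; the latter is nonnegative because the
  -- zero vector has nonnegative dual value.
  have hgle : ∀ y, g y ≤ ‖y‖ ^ 2 / 2 + avg n (fun z => ‖z‖) x * ‖y‖
      + avg n (fun z => ‖z‖ ^ 2) x / 2 := by
    intro y
    have h1 := mean_le_logMean p b y
    rw [Finset.sum_sub_distrib, mul_sub] at h1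
    simp only [hbi] at h1
    rw [← havg] at h1
    have h2 : (Fintype.card (Fin n) : ℝ)⁻¹ * ∑ i, cost (p i) y ≤ (Fintype.card (Fin n) : ℝ)⁻¹ *
        ∑ i, (‖p i‖ ^ 2 / 2 + ‖p i‖ * ‖y‖ + ‖y‖ ^ 2 / 2) := by
      gcongr with i
      exact cost_le (p i) y
    rw [Finset.sum_add_distrib, Finset.sum_add_distrib, ← Finset.sum_div, ← Finset.sum_mul,
      Finset.sum_const, Finset.card_univ, nsmul_eq_mul, mul_add, mul_add, ← mul_assoc, ← mul_assoc,
      inv_mul_cancel₀ card_pos_real.ne', one_mul, ← mul_div_assoc, ← havg (fun z => ‖z‖ ^ 2),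
      ← havg (fun z => ‖z‖)] at h2
    simp only [hg]
    linarith
  have hexp : ∀ z, ∫ y, Real.exp (f z + g y - cost z y) ∂Q = 1 := by
    intro z
    refine integral_exp_softTransform ?_
    have := integrable_exp_sub_cost hQ hgm (b := avg n (fun z => ‖z‖) x)
      (K := avg n (fun z => ‖z‖ ^ 2) x / 2) (by unfold avg; positivity)
      (Eventually.of_forall hgle) 0 z
    simpa only [zero_add] using this
  have hpair : IsSchrodingerPair (empiricalMeasure n x) Q f g := by
    refine ⟨hfm, hgm, integrable_empiricalMeasure n x f, hgi,
      integrable_exp_empiricalMeasure_prod hfm hgm fun i _ => hexp _,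
      ae_empiricalMeasure fun i _ => hexp _, Eventually.of_forall fun y => ?_⟩
    rw [integral_empiricalMeasure, havg, ← mean_exp_sub_logMean p b y]
    congr 2
    funext i
    rw [← hbi, hg]
    ring_nf
  have hcost : entropicCost (empiricalMeasure n x) Q = avg n f x := by
    rw [hpair.entropicCost_eq (integrable_empiricalMeasure n x _) (hQ.integrable_norm_pow 2), hg0,
      add_zero, integral_empiricalMeasure]
  refine ⟨f, g, ⟨hfm, hgm, hgi, hg0, hexp, hgle, hcost, h0⟩, hpair, ?_⟩
  rw [hcost, ← hD]
  refine ⟨⟨b, rfl⟩, ?_⟩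
  rintro _ ⟨a, rfl⟩
  exact hb a

/-- Weak duality for the empirical problem. -/
theorem avg_add_integral_le_entropicCost (hQ : HasExpMoments κ Q) {n : ℕ} (hn : 1 ≤ n)
    {x : ℕ → EuclideanSpace ℝ (Fin d)} {f g : EuclideanSpace ℝ (Fin d) → ℝ} (hf : Measurable f)
    (hg : Measurable g) (hgi : Integrable g Q)
    (h : ∀ i < n, ∫ y, Real.exp (f (x i) + g y - cost (x i) y) ∂Q = 1) :
    avg n f x + ∫ y, g y ∂Q ≤ entropicCost (empiricalMeasure n x) Q := by
  have hP := isProbabilityMeasure_empiricalMeasure hn x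
  obtain ⟨f₀, g₀, -, h₀, -⟩ := exists_isEmpiricalPotentials hQ hn x
  rw [← integral_empiricalMeasure]
  exact h₀.le_entropicCost (integrable_empiricalMeasure n x _) (hQ.integrable_norm_pow 2)
    (integrable_empiricalMeasure n x _) hgi (integrable_exp_empiricalMeasure_prod hf hg h)
    (integral_exp_empiricalMeasure_prod hn hf hg h).le

/-- The cost is the supremum of functions measurable in the sample and continuous in a, so a
countable dense set of a suffices. -/
theorem measurable_entropicCost_empiricalMeasure (hQ : HasExpMoments κ Q) {n : ℕ} (hn : 1 ≤ n) :
    Measurable (fun x : ℕ → EuclideanSpace ℝ (Fin d) => entropicCost (empiricalMeasure n x) Q) := by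
  have : Nonempty (Fin n) := ⟨⟨0, hn⟩⟩
  have hmeas : ∀ a : Fin n → ℝ, Measurable (fun x : ℕ → EuclideanSpace ℝ (Fin d) =>
      semiDual Q (fun i : Fin n => x i) a) := by
    intro a
    have : Measurable (fun z : (ℕ → EuclideanSpace ℝ (Fin d)) × EuclideanSpace ℝ (Fin d) =>
        logMean (fun i : Fin n => z.1 i) a z.2) := by
      unfold logMean
      refine (measurable_const.mul (Finset.measurable_sum _ fun i _ => ?_)).log
      refine (measurable_const.sub (measurable_cost.comp (Measurable.prodMk ?_ measurable_snd))).exp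
      exact (measurable_pi_apply (i : ℕ)).comp measurable_fst
    exact measurable_const.sub (this.stronglyMeasurable.integral_prod_right').measurable
  obtain ⟨T, hTc, hTd⟩ := TopologicalSpace.exists_countable_dense (Fin n → ℝ)
  refine measurable_of_Ioi fun t => ?_
  have e : (fun x : ℕ → EuclideanSpace ℝ (Fin d) =>
      entropicCost (empiricalMeasure n x) Q) ⁻¹' Set.Ioi t
      = ⋃ a ∈ T, {x | t < semiDual Q (fun i : Fin n => x i) a} := by
    ext x
    obtain ⟨f, g, -, -, ⟨b, hb⟩, hmax⟩ := exists_isEmpiricalPotentials hQ hn x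
    simp only [Set.mem_preimage, Set.mem_Ioi, Set.mem_iUnion, Set.mem_ofPred_eq, exists_prop]
    constructor
    · intro ht
      rw [← hb] at ht
      obtain ⟨a, ha, haT⟩ := hTd.exists_mem_open
        ((isOpen_Ioi (a := t)).preimage (continuous_semiDual hQ (fun i : Fin n => x i))) ⟨b, ht⟩
      exact ⟨a, ha, haT⟩
    · rintro ⟨a, -, ha⟩
      exact ha.trans_le (hmax ⟨a, rfl⟩)
  rw [e]
  exact MeasurableSet.biUnion hTc fun a _ => measurableSet_lt measurable_const (hmeas a)

end EmpiricalPotentials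

/-! ### Elementary properties of sample averages. -/

section Averages

variable {E : Type*}

theorem avg_sub (n : ℕ) (φ ψ : E → ℝ) (x : ℕ → E) :
    avg n (fun z => φ z - ψ z) x = avg n φ x - avg n ψ x := by
  simp only [avg, Finset.sum_sub_distrib, mul_sub]

theorem avg_mono {n : ℕ} {φ ψ : E → ℝ} (h : ∀ z, φ z ≤ ψ z) (x : ℕ → E) :
    avg n φ x ≤ avg n ψ x := by
  unfold avg
  gcongr with i
  exact h _

theorem avg_const_mul (n : ℕ) (c : ℝ) (ψ : E → ℝ) (x : ℕ → E) :
    avg n (fun z => c * ψ z) x = c * avg n ψ x := by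
  simp only [avg, ← Finset.mul_sum]
  ring

theorem abs_avg_le (n : ℕ) (ψ : E → ℝ) (x : ℕ → E) : |avg n ψ x| ≤ avg n (fun z => |ψ z|) x := by
  unfold avg
  rw [abs_mul, abs_of_nonneg (by positivity : (0 : ℝ) ≤ (n : ℝ)⁻¹)]
  gcongr
  exact Finset.abs_sum_le_sum_abs _ _

theorem avg_sq_le (n : ℕ) (ψ : E → ℝ) (x : ℕ → E) : avg n ψ x ^ 2 ≤ avg n (fun z => ψ z ^ 2) x := by
  rcases Nat.eq_zero_or_pos n with rfl | hn
  · simp [avg]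
  have hn' : (0 : ℝ) < n := by exact_mod_cast hn
  have h := sq_sum_le_card_mul_sum_sq (s := Finset.range n) (f := fun i => ψ (x i))
  rw [Finset.card_range] at h
  unfold avg
  calc ((n : ℝ)⁻¹ * ∑ i ∈ Finset.range n, ψ (x i)) ^ 2
      = (n : ℝ)⁻¹ ^ 2 * (∑ i ∈ Finset.range n, ψ (x i)) ^ 2 := by ring
    _ ≤ (n : ℝ)⁻¹ ^ 2 * (n * ∑ i ∈ Finset.range n, ψ (x i) ^ 2) := by gcongr
    _ = _ := by field_simp

theorem avg_nonneg {n : ℕ} {ψ : E → ℝ} (h : ∀ z, 0 ≤ ψ z) (x : ℕ → E) : 0 ≤ avg n ψ x :=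
  mul_nonneg (by positivity) (Finset.sum_nonneg fun _ _ => h _)

end Averages

/-! ### Quadratic growth of empirical potentials. -/

section PotentialBounds

variable {d : ℕ} {κ : ℝ} {Q : Measure (EuclideanSpace ℝ (Fin d))} [IsProbabilityMeasure Q]

/-- The constant depends on neither n nor the sample: `potential_le` and `le_potential` apply with ∫
g dQ = 0, and the sample enters only through its mean squared norm. -/
theorem exists_abs_potential_le (hQ : HasExpMoments κ Q) :
    ∃ C : ℝ, 0 ≤ C ∧ ∀ (n : ℕ) (x : ℕ → EuclideanSpace ℝ (Fin d))
      (f g : EuclideanSpace ℝ (Fin d) → ℝ), IsEmpiricalPotentials Q n x f g →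
      ∀ z, |f z| ≤ C * (1 + ‖z‖ ^ 2 + avg n (fun z => ‖z‖ ^ 2) x) := by
  set m₁ := ∫ y, ‖y‖ ∂Q with hm₁
  set m₂ := ∫ y, ‖y‖ ^ 2 ∂Q with hm₂
  have h₁ : 0 ≤ m₁ := integral_nonneg fun y => norm_nonneg y
  have h₂ : 0 ≤ m₂ := integral_nonneg fun y => by positivity
  have hκ := hQ.nonneg
  have hlog : 0 ≤ Real.log 2 := Real.log_nonneg (by norm_num)
  have hlog1 : Real.log 2 ≤ 1 := by linarith [Real.log_two_lt_d9]
  refine ⟨1 + m₁ + m₂ + 2 * κ, by positivity, fun n x f g h z => ?_⟩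
  have hA0 : 0 ≤ avg n (fun z => ‖z‖ ^ 2) x := avg_nonneg (fun z => by positivity) x
  have hB0 : 0 ≤ avg n (fun z => ‖z‖) x := avg_nonneg (fun z => norm_nonneg z) x
  have hBA := avg_sq_le n (fun z => ‖z‖) x
  have hup := potential_le hQ h.integrable_right (h.integral_exp z)
  have hlow := le_potential hQ h.measurable_right hB0
    (Eventually.of_forall h.right_le) (h.integral_exp z)
  rw [h.integral_right, sub_zero, ← hm₁, ← hm₂] at hup
  set A := avg n (fun z => ‖z‖ ^ 2) x
  set B := avg n (fun z => ‖z‖) x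
  have hz := norm_nonneg z
  have hsq : (‖z‖ + B) ^ 2 ≤ 2 * (‖z‖ ^ 2 + A) := by nlinarith [sq_nonneg (‖z‖ - B)]
  have hκsq := mul_le_mul_of_nonneg_left hsq hκ
  have hz1 : ‖z‖ ≤ 1 + ‖z‖ ^ 2 := by nlinarith [sq_nonneg (‖z‖ - 1)]
  have hzm := mul_le_mul_of_nonneg_right hz1 h₁
  have hz2 : 0 ≤ ‖z‖ ^ 2 := by positivity
  have p1 := mul_nonneg h₁ hA0
  have p2 := mul_nonneg h₂ hA0
  have p3 := mul_nonneg h₂ hz2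
  have p4 := mul_nonneg h₁ hz2
  have p5 := mul_nonneg hκ hA0
  have p6 := mul_nonneg hκ hz2
  rw [abs_le]
  constructor <;> nlinarith

end PotentialBounds

/-! ### A uniform law of large numbers by quantization. -/

section UniformLaw

variable {E : Type*} [NormedAddCommGroup E] [MeasurableSpace E] [BorelSpace E]
  [SecondCountableTopology E]

/-- Simple functions that approximate the identity. -/
noncomputable def quantizer (k : ℕ) : SimpleFunc E E :=
  SimpleFunc.approxOn id measurable_id Set.univ 0 (Set.mem_univ 0) k

theorem tendsto_quantizer (z : E) : Tendsto (fun k => quantizer k z) atTop (𝓝 z) :=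
  SimpleFunc.tendsto_approxOn measurable_id (Set.mem_univ 0) (by simp)

theorem norm_sub_quantizer_le (k : ℕ) (z : E) : ‖z - quantizer k z‖ ≤ ‖z‖ := by
  have := SimpleFunc.edist_approxOn_le (f := (id : E → E)) measurable_id (Set.mem_univ 0) z k
  rw [edist_dist, edist_dist, ENNReal.ofReal_le_ofReal_iff dist_nonneg, dist_comm,
    dist_eq_norm, dist_eq_norm] at this
  simpa [quantizer] using this

theorem norm_quantizer_le (k : ℕ) (z : E) : ‖quantizer k z‖ ≤ 2 * ‖z‖ := by
  have h1 := norm_sub_quantizer_le k z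
  have h2 := norm_sub_norm_le (quantizer k z) z
  rw [norm_sub_rev] at h2
  linarith

/-- The weighted error of the approximation of the identity by `quantizer k`. -/
noncomputable def quantizationError (k : ℕ) (z : E) : ℝ := (1 + ‖z‖ ^ 2) * ‖z - quantizer k z‖

theorem measurable_quantizationError (k : ℕ) : Measurable (quantizationError (E := E) k) :=
  (measurable_const.add (measurable_norm.pow_const 2)).mul
    (measurable_id.sub (quantizer k).measurable).norm

theorem quantizationError_nonneg (k : ℕ) (z : E) : 0 ≤ quantizationError k z := by
  unfold quantizationError; positivity

theorem quantizationError_le (k : ℕ) (z : E) : quantizationError k z ≤ ‖z‖ + ‖z‖ ^ 3 := by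
  unfold quantizationError
  nlinarith [norm_sub_quantizer_le k z, mul_le_mul_of_nonneg_left (norm_sub_quantizer_le k z)
    (sq_nonneg ‖z‖)]

variable {κ : ℝ} {P : Measure E}

theorem HasExpMoments.integrable_norm_add_pow (hP : HasExpMoments κ P) :
    Integrable (fun z => ‖z‖ + ‖z‖ ^ 3) P := by
  have h1 := hP.integrable_norm_pow 1
  simp only [pow_one] at h1
  exact h1.add (hP.integrable_norm_pow 3)

theorem integrable_quantizationError (hP : HasExpMoments κ P) (k : ℕ) :
    Integrable (quantizationError k) P :=
  hP.integrable_norm_add_pow.mono' (measurable_quantizationError k).aestronglyMeasurable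
    (Eventually.of_forall fun z => by
      rw [Real.norm_eq_abs, abs_of_nonneg (quantizationError_nonneg k z)]
      exact quantizationError_le k z)

theorem tendsto_integral_quantizationError (hP : HasExpMoments κ P) :
    Tendsto (fun k => ∫ z, quantizationError k z ∂P) atTop (𝓝 0) := by
  have h := tendsto_integral_of_dominated_convergence (μ := P) (F := quantizationError)
    (f := fun _ => 0) (fun z => ‖z‖ + ‖z‖ ^ 3)
    (fun k => (measurable_quantizationError k).aestronglyMeasurable) hP.integrable_norm_add_pow
    (fun k => Eventually.of_forall fun z => by
      rw [Real.norm_eq_abs, abs_of_nonneg (quantizationError_nonneg k z)]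
      exact quantizationError_le k z)
    (Eventually.of_forall fun z => by
      have : Tendsto (fun k => z - quantizer k z) atTop (𝓝 (z - z)) :=
        tendsto_const_nhds.sub (tendsto_quantizer z)
      have := (this.norm).const_mul (1 + ‖z‖ ^ 2)
      simpa [quantizationError] using this)
  simpa using h

variable [IsProbabilityMeasure P]

/-- The averages along `x` of the test functions used to discretize locally Lipschitz functions
converge to their means under `P`. -/
structure IsEquidistributed (P : Measure E) (x : ℕ → E) : Prop where
  sq_norm : Tendsto (fun n => avg n (fun z => ‖z‖ ^ 2) x) atTop (𝓝 (∫ z, ‖z‖ ^ 2 ∂P))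
  error : ∀ k, Tendsto (fun n => avg n (quantizationError k) x) atTop
    (𝓝 (∫ z, quantizationError k z ∂P))
  cell : ∀ k, ∀ v ∈ (quantizer (E := E) k).range,
    Tendsto (fun n => avg n ((quantizer k ⁻¹' {v}).indicator fun _ => 1) x) atTop
      (𝓝 (∫ z, (quantizer k ⁻¹' {v}).indicator (fun _ => 1) z ∂P))

/-- Only countably many test functions occur, so a single null set serves for all the functions to
be averaged, including those that depend on the sample. -/
theorem ae_isEquidistributed (hP : HasExpMoments κ P) :
    ∀ᵐ x ∂(iidLaw P), IsEquidistributed P x := by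
  have hcell : ∀ k, ∀ v, MeasurableSet (quantizer (E := E) k ⁻¹' {v}) := fun k v =>
    (quantizer k).measurableSet_fiber v
  have h1 := ae_tendsto_avg P (hP.integrable_norm_pow 2) (by fun_prop)
  have h2 : ∀ᵐ x ∂(iidLaw P), ∀ k, Tendsto (fun n => avg n (quantizationError k) x) atTop
      (𝓝 (∫ z, quantizationError k z ∂P)) := ae_all_iff.2 fun k =>
    ae_tendsto_avg P (integrable_quantizationError hP k) (measurable_quantizationError k)
  have h3 : ∀ᵐ x ∂(iidLaw P), ∀ k, ∀ v ∈ (quantizer (E := E) k).range,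
      Tendsto (fun n => avg n ((quantizer k ⁻¹' {v}).indicator fun _ => 1) x) atTop
      (𝓝 (∫ z, (quantizer k ⁻¹' {v}).indicator (fun _ => 1) z ∂P)) := by
    refine ae_all_iff.2 fun k => ?_
    refine (ae_ball_iff (quantizer (E := E) k).range.countable_toSet).2 fun v _ => ?_
    exact ae_tendsto_avg P ((integrable_const (1 : ℝ)).indicator (hcell k v))
      (measurable_const.indicator (hcell k v))
  filter_upwards [h1, h2, h3] with x a b c
  exact ⟨a, b, c⟩

theorem comp_quantizer_eq_sum (k : ℕ) (F : E → ℝ) (z : E) :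
    F (quantizer k z) = ∑ v ∈ (quantizer (E := E) k).range,
      F v * (quantizer k ⁻¹' {v}).indicator (fun _ => 1) z := by
  rw [Finset.sum_eq_single (quantizer k z)]
  · simp
  · intro v _ hv
    rw [Set.indicator_of_notMem, mul_zero]
    simpa using hv.symm
  · intro h
    exact absurd (SimpleFunc.mem_range_self _ z) h

/-- A uniform law of large numbers for locally Lipschitz functions of quadratic growth. -/
theorem IsEquidistributed.tendsto_avg_sub_integral {x : ℕ → E} (hx : IsEquidistributed P x)
    (hP : HasExpMoments κ P) {F : ℕ → E → ℝ} {C L : ℝ} (hL : 0 ≤ L)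
    (hm : ∀ n, 1 ≤ n → Measurable (F n)) (hC : ∀ n, 1 ≤ n → ∀ z, |F n z| ≤ C * (1 + ‖z‖ ^ 2))
    (hF : ∀ n, 1 ≤ n → ∀ z z', |F n z - F n z'| ≤ L * ((1 + ‖z‖ ^ 2 + ‖z'‖ ^ 2) * ‖z - z'‖)) :
    Tendsto (fun n => avg n (F n) x - ∫ z, F n z ∂P) atTop (𝓝 0) := by
  have hlim := (tendsto_integral_quantizationError hP).const_mul (10 * L)
  rw [mul_zero] at hlim
  have hqi : ∀ k v, Integrable ((quantizer (E := E) k ⁻¹' {v}).indicator fun _ => (1 : ℝ)) P :=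
    fun k v => (integrable_const (1 : ℝ)).indicator ((quantizer k).measurableSet_fiber v)
  have hbound : ∀ k n, 1 ≤ n → |avg n (F n) x - ∫ z, F n z ∂P| ≤
      5 * L * avg n (quantizationError k) x + (∑ v ∈ (quantizer (E := E) k).range,
        C * (1 + ‖v‖ ^ 2) * |avg n ((quantizer k ⁻¹' {v}).indicator fun _ => 1) x
          - ∫ z, (quantizer k ⁻¹' {v}).indicator (fun _ => 1) z ∂P|)
      + 5 * L * ∫ z, quantizationError k z ∂P := by
    intro k n hn
    have hFi : Integrable (F n) P :=
      (((integrable_const 1).add (hP.integrable_norm_pow 2)).const_mul C).mono'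
        (hm n hn).aestronglyMeasurable (Eventually.of_forall (hC n hn))
    have hsum : (fun z => F n (quantizer k z)) = fun z => ∑ v ∈ (quantizer (E := E) k).range,
        F n v * (quantizer k ⁻¹' {v}).indicator (fun _ => 1) z :=
      funext (comp_quantizer_eq_sum k (F n))
    have hFqi : Integrable (fun z => F n (quantizer k z)) P := by
      rw [hsum]
      exact integrable_finsetSum _ fun v _ => (hqi k v).const_mul _
    -- The factor 5 comes from ‖quantizer k z‖ ≤ 2‖z‖, which gives 1 + ‖z‖² + ‖quantizer k z‖² ≤ 5(1
    -- + ‖z‖²).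
    have hpt : ∀ z, |F n z - F n (quantizer k z)| ≤ 5 * L * quantizationError k z := by
      intro z
      refine (hF n hn z (quantizer k z)).trans ?_
      rw [quantizationError, mul_comm 5 L, mul_assoc]
      refine mul_le_mul_of_nonneg_left ?_ hL
      rw [← mul_assoc]
      refine mul_le_mul_of_nonneg_right ?_ (norm_nonneg _)
      nlinarith [norm_quantizer_le k z, norm_nonneg (quantizer k z), norm_nonneg z]
    have t1 : |avg n (F n) x - avg n (fun z => F n (quantizer k z)) x|
        ≤ 5 * L * avg n (quantizationError k) x := by
      rw [← avg_sub, ← avg_const_mul]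
      exact (abs_avg_le _ _ _).trans (avg_mono hpt x)
    have t3 : |∫ z, F n (quantizer k z) ∂P - ∫ z, F n z ∂P|
        ≤ 5 * L * ∫ z, quantizationError k z ∂P := by
      rw [← integral_sub hFqi hFi, ← integral_const_mul]
      refine (abs_integral_le_integral_abs).trans (integral_mono (hFqi.sub hFi).abs
        ((integrable_quantizationError hP k).const_mul _) fun z => ?_)
      rw [abs_sub_comm]
      exact hpt z
    have t2 : |avg n (fun z => F n (quantizer k z)) x - ∫ z, F n (quantizer k z) ∂P|
        ≤ ∑ v ∈ (quantizer (E := E) k).range,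
        C * (1 + ‖v‖ ^ 2) * |avg n ((quantizer k ⁻¹' {v}).indicator fun _ => 1) x
          - ∫ z, (quantizer k ⁻¹' {v}).indicator (fun _ => 1) z ∂P| := by
      have e1 : avg n (fun z => F n (quantizer k z)) x = ∑ v ∈ (quantizer (E := E) k).range,
          F n v * avg n ((quantizer k ⁻¹' {v}).indicator fun _ => 1) x := by
        rw [hsum]
        simp only [avg]
        rw [Finset.sum_comm, Finset.mul_sum]
        refine Finset.sum_congr rfl fun v _ => ?_
        rw [← Finset.mul_sum]
        ring
      have e2 : ∫ z, F n (quantizer k z) ∂P = ∑ v ∈ (quantizer (E := E) k).range,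
          F n v * ∫ z, (quantizer k ⁻¹' {v}).indicator (fun _ => 1) z ∂P := by
        rw [hsum, integral_finsetSum _ fun v _ => (hqi k v).const_mul _]
        exact Finset.sum_congr rfl fun v _ => integral_const_mul _ _
      rw [e1, e2, ← Finset.sum_sub_distrib]
      refine (Finset.abs_sum_le_sum_abs _ _).trans (Finset.sum_le_sum fun v _ => ?_)
      rw [← mul_sub, abs_mul]
      exact mul_le_mul_of_nonneg_right (hC n hn v) (abs_nonneg _)
    have e : avg n (F n) x - ∫ z, F n z ∂P = (avg n (F n) x - avg n (fun z =>
        F n (quantizer k z)) x)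
        + (avg n (fun z => F n (quantizer k z)) x - ∫ z, F n (quantizer k z) ∂P)
        + (∫ z, F n (quantizer k z) ∂P - ∫ z, F n z ∂P) := by ring
    rw [e]
    exact (abs_add_three _ _ _).trans (add_le_add (add_le_add t1 t2) t3)
  rw [Metric.tendsto_atTop']
  intro ε hε
  -- k is fixed before n: both quantization errors together tend to 10 L times the mean error, below
  -- ε, and then only finitely many cells remain.
  obtain ⟨k, hk⟩ := ((hlim.eventually (gt_mem_nhds hε))).exists
  have hcells : Tendsto (fun n => ∑ v ∈ (quantizer (E := E) k).range,
      C * (1 + ‖v‖ ^ 2) * |avg n ((quantizer k ⁻¹' {v}).indicator fun _ => 1) x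
        - ∫ z, (quantizer k ⁻¹' {v}).indicator (fun _ => 1) z ∂P|) atTop (𝓝 0) := by
    rw [← Finset.sum_const_zero (s := (quantizer (E := E) k).range)]
    refine tendsto_finsetSum _ fun v hv => ?_
    have := (((hx.cell k v hv).sub_const
      (∫ z, (quantizer k ⁻¹' {v}).indicator (fun _ => (1 : ℝ)) z ∂P)).abs.const_mul (C
          * (1 + ‖v‖ ^ 2)))
    rwa [sub_self, abs_zero, mul_zero] at this
  have htend := (((hx.error k).const_mul (5 * L)).add hcells).add_const
    (5 * L * ∫ z, quantizationError k z ∂P)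
  have hlt : 5 * L * ∫ z, quantizationError k z ∂P + 0
      + 5 * L * ∫ z, quantizationError k z ∂P < ε := by linarith
  obtain ⟨N, hN⟩ := eventually_atTop.1 (htend.eventually (gt_mem_nhds hlt))
  refine ⟨max N 1, fun n hn => ?_⟩
  rw [Real.dist_eq, sub_zero]
  exact (hbound k n ((le_max_right N 1).trans hn.le)).trans_lt (hN n ((le_max_left N 1).trans hn.le))

end UniformLaw

/-! ### Convergence of the empirical potentials. -/

section Stability

variable {d : ℕ} {P Q : Measure (EuclideanSpace ℝ (Fin d))} {f g : EuclideanSpace ℝ (Fin d) → ℝ}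

/-- The sample points are generic for `P`, `Q` and the potentials `f`, `g`. -/
structure IsTypical (P Q : Measure (EuclideanSpace ℝ (Fin d)))
    (f g : EuclideanSpace ℝ (Fin d) → ℝ) (x : ℕ → EuclideanSpace ℝ (Fin d)) : Prop where
  isEquidistributed : IsEquidistributed P x
  tendsto_avg : Tendsto (fun n => avg n f x) atTop (𝓝 (∫ z, f z ∂P))
  integral_exp : ∀ i, ∫ y, Real.exp (f (x i) + g y - cost (x i) y) ∂Q = 1

theorem IsSchrodingerPair.ae_isTypical [IsProbabilityMeasure P] {κ : ℝ} (h : IsSchrodingerPair P Q f g)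
    (hP : HasExpMoments κ P) : ∀ᵐ x ∂(iidLaw P), IsTypical P Q f g x := by
  have h3 : ∀ᵐ x ∂(iidLaw P), ∀ i, ∫ y, Real.exp (f (x i) + g y - cost (x i) y) ∂Q = 1 :=
    ae_all_iff.2 fun i => (measurePreserving_eval P i).quasiMeasurePreserving.ae h.left
  filter_upwards [ae_isEquidistributed hP, ae_tendsto_avg P h.integrable_left h.measurable_left, h3]
    with x a b c
  exact ⟨a, b, c⟩

theorem IsEquidistributed.exists_abs_potential_le [IsProbabilityMeasure Q] {κ : ℝ} {x : ℕ →
    EuclideanSpace ℝ (Fin d)}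
    (hx : IsEquidistributed P x) (hQ : HasExpMoments κ Q) :
    ∃ B C : ℝ, 0 ≤ B ∧ 0 ≤ C ∧ (∀ n, avg n (fun z => ‖z‖ ^ 2) x ≤ B) ∧
      ∀ n f g, IsEmpiricalPotentials Q n x f g → ∀ z, |f z| ≤ C * (1 + ‖z‖ ^ 2) := by
  obtain ⟨C₀, hC₀, hb⟩ := EntropicOT.exists_abs_potential_le hQ
  obtain ⟨B, hB⟩ := hx.sq_norm.bddAbove_range
  have hB' : ∀ n, avg n (fun z => ‖z‖ ^ 2) x ≤ B := fun n => hB ⟨n, rfl⟩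
  have hB0 : 0 ≤ B := (avg_nonneg (fun z => by positivity) x).trans (hB' 0)
  refine ⟨B, C₀ * (1 + B), hB0, by positivity, hB', fun n f g h z => (hb n x f g h z).trans ?_⟩
  rw [mul_assoc]
  refine mul_le_mul_of_nonneg_left ?_ hC₀
  nlinarith [hB' n, sq_nonneg ‖z‖, mul_nonneg hB0 (sq_nonneg ‖z‖)]

theorem tendsto_of_tendsto_exp_mul {u : ℕ → ℝ} {c : ℝ} (hc : 0 < c)
    (h : Tendsto (fun n => (1 - Real.exp (u n / 2)) ^ 2 * c) atTop (𝓝 0)) :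
    Tendsto u atTop (𝓝 0) := by
  have h1 := h.mul_const c⁻¹
  simp only [mul_assoc, mul_inv_cancel₀ hc.ne', mul_one, zero_mul] at h1
  have h2 := h1.sqrt
  simp only [Real.sqrt_sq_eq_abs, Real.sqrt_zero] at h2
  have h3 := (tendsto_zero_iff_abs_tendsto_zero _).2 h2
  have h4 := (h3.const_sub 1)
  simp only [sub_sub_cancel, sub_zero] at h4
  have h5 := (h4.log one_ne_zero).const_mul 2
  simp only [Real.log_exp, Real.log_one, mul_zero] at h5
  refine h5.congr fun n => ?_
  ring

/-- If the second potentials converge almost everywhere after adding constants, then so do the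
first potentials, at every point. -/
theorem tendsto_left_of_tendsto_right {κ : ℝ} (hQ : HasExpMoments κ Q)
    {F G : ℕ → EuclideanSpace ℝ (Fin d) → ℝ} {c : ℕ → ℝ} {a : EuclideanSpace ℝ (Fin d)}
    (hGm : ∀ n, Measurable (G n)) (hFG : ∀ n, ∫ y, Real.exp (F n a + G n y - cost a y) ∂Q = 1)
    (hfg : ∫ y, Real.exp (f a + g y - cost a y) ∂Q = 1) {b K : ℝ} (hb : 0 ≤ b)
    (hG : ∀ n y, c n + G n y ≤ ‖y‖ ^ 2 / 2 + b * ‖y‖ + K)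
    (hlim : ∀ᵐ y ∂Q, Tendsto (fun n => c n + G n y) atTop (𝓝 (g y))) :
    Tendsto (fun n => F n a - c n) atTop (𝓝 (f a)) := by
  have key : ∀ (s : ℝ) (ψ : EuclideanSpace ℝ (Fin d) → ℝ),
      ∫ y, Real.exp (s + ψ y - cost a y) ∂Q = 1 →
      ∫ y, Real.exp (0 + ψ y - cost a y) ∂Q = Real.exp (-s) := by
    intro s ψ h
    have e : ∀ y, Real.exp (0 + ψ y - cost a y) = Real.exp (-s)
        * Real.exp (s + ψ y - cost a y) := by
      intro y
      rw [← Real.exp_add]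
      congr 1
      ring
    simp only [e]
    rw [integral_const_mul, h, mul_one]
  -- Normalization expresses F n a - c n as minus the logarithm of an integral involving only c n +
  -- G n, to which dominated convergence applies.
  have h1 : ∀ n, ∫ y, Real.exp (0 + (c n + G n y) - cost a y) ∂Q = Real.exp (-(F n a - c n)) := by
    intro n
    refine key _ _ ?_
    rw [← hFG n]
    congr 1
    funext y
    congr 1
    ring
  have h2 := tendsto_integral_of_dominated_convergence (μ := Q)
    (F := fun n y => Real.exp (0 + (c n + G n y) - cost a y))
    (f := fun y => Real.exp (0 + g y - cost a y))
    (fun y => Real.exp (0 + K - ‖a‖ ^ 2 / 2) * Real.exp ((‖a‖ + b) * ‖y‖))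
    (fun n => by
      have := hGm n
      exact Measurable.aestronglyMeasurable (by fun_prop))
    ((hQ.integrable _ (by positivity)).const_mul _)
    (fun n => Eventually.of_forall fun y => by
      rw [Real.norm_eq_abs, Real.abs_exp]
      exact exp_sub_cost_le (g := fun y => c n + G n y) (s := 0) (x := a) (hG n y))
    (by
      filter_upwards [hlim] with y hy
      have h3 : Tendsto (fun n => 0 + (c n + G n y) - cost a y) atTop (𝓝 (0 + g y - cost a y)) :=
        (hy.const_add 0).sub_const (cost a y)
      exact (Real.continuous_exp.tendsto _).comp h3)
  simp only [h1] at h2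
  rw [key _ _ hfg] at h2
  have h3 := (h2.log (Real.exp_pos _).ne').neg
  simpa only [Real.log_exp, neg_neg] using h3

variable [IsProbabilityMeasure P] [IsProbabilityMeasure Q]

theorem IsSchrodingerPair.integrable_exp_mul_add (h : IsSchrodingerPair P Q f g)
    {φ ψ : EuclideanSpace ℝ (Fin d) → ℝ} (hφ : Integrable φ P) (hψ : Integrable ψ Q) :
    Integrable (fun z : EuclideanSpace ℝ (Fin d) × EuclideanSpace ℝ (Fin d) =>
      Real.exp (f z.1 + g z.2 - cost z.1 z.2) * (φ z.1 + ψ z.2)) (P.prod Q) := by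
  have := (integrable_withDensity_iff_integrable_smul' h.measurable_density
    (Eventually.of_forall fun z => ENNReal.ofReal_lt_top)).1 (h.isCoupling.integrable_add hφ hψ)
  simpa only [ENNReal.toReal_ofReal (Real.exp_pos _).le, smul_eq_mul] using this

/-- The Gibbs coupling has marginals P and Q, so it integrates a separable sum as P and Q do. -/
theorem IsSchrodingerPair.integral_exp_mul_add (h : IsSchrodingerPair P Q f g)
    {φ ψ : EuclideanSpace ℝ (Fin d) → ℝ} (hφ : Integrable φ P) (hψ : Integrable ψ Q) :
    ∫ z, Real.exp (f z.1 + g z.2 - cost z.1 z.2) * (φ z.1 + ψ z.2) ∂(P.prod Q)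
      = ∫ x, φ x ∂P + ∫ y, ψ y ∂Q := by
  have := integral_withDensity_eq_integral_toReal_smul (μ := P.prod Q) h.measurable_density
    (Eventually.of_forall fun z => ENNReal.ofReal_lt_top) (fun z => φ z.1 + ψ z.2)
  simp only [ENNReal.toReal_ofReal (Real.exp_pos _).le, smul_eq_mul] at this
  rw [← this, ← h.isCoupling.integral_add hφ hψ, gibbsCoupling]

/-- The right side is the pointwise dual gap, the left side (exp(U/2) - exp(V/2))². Expand the
square and use exp s ≥ 1 + s at s = (V - U)/2. -/
theorem hellinger_le (U V : ℝ) : (1 - Real.exp ((V - U) / 2)) ^ 2 * Real.exp U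
    ≤ Real.exp U * (U - V) - Real.exp U + Real.exp V := by
  have h1 := Real.add_one_le_exp ((V - U) / 2)
  have h2 : Real.exp ((V - U) / 2) ^ 2 * Real.exp U = Real.exp V := by
    rw [← Real.exp_nat_mul, ← Real.exp_add]
    congr 1
    push_cast
    ring
  have h3 := mul_le_mul_of_nonneg_left h1 (Real.exp_pos U).le
  nlinarith

/-- The weighted squared difference of two Gibbs densities. -/
noncomputable def densityGap (f g f' g' : EuclideanSpace ℝ (Fin d) → ℝ)
    (z : EuclideanSpace ℝ (Fin d) × EuclideanSpace ℝ (Fin d)) : ℝ :=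
  (1 - Real.exp ((f' z.1 + g' z.2 - cost z.1 z.2 - (f z.1 + g z.2 - cost z.1 z.2)) / 2)) ^ 2
    * Real.exp (f z.1 + g z.2 - cost z.1 z.2)

theorem densityGap_nonneg (f g f' g' : EuclideanSpace ℝ (Fin d) → ℝ)
    (z : EuclideanSpace ℝ (Fin d) × EuclideanSpace ℝ (Fin d)) : 0 ≤ densityGap f g f' g' z := by
  unfold densityGap; positivity

theorem measurable_densityGap {f g f' g' : EuclideanSpace ℝ (Fin d) → ℝ} (hf : Measurable f)
    (hg : Measurable g) (hf' : Measurable f') (hg' : Measurable g') :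
    Measurable (densityGap f g f' g') := by
  unfold densityGap
  have h1 : Measurable (fun z : EuclideanSpace ℝ (Fin d) × EuclideanSpace ℝ (Fin d) => f z.1) :=
    hf.comp measurable_fst
  have h2 : Measurable (fun z : EuclideanSpace ℝ (Fin d) × EuclideanSpace ℝ (Fin d) => g z.2) :=
    hg.comp measurable_snd
  have h3 : Measurable (fun z : EuclideanSpace ℝ (Fin d) × EuclideanSpace ℝ (Fin d) => f' z.1) :=
    hf'.comp measurable_fst
  have h4 : Measurable (fun z : EuclideanSpace ℝ (Fin d) × EuclideanSpace ℝ (Fin d) => g' z.2) :=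
    hg'.comp measurable_snd
  have h5 := measurable_cost (E := EuclideanSpace ℝ (Fin d))
  exact ((measurable_const.sub ((((h3.add h4).sub h5).sub ((h1.add h2).sub h5)).div_const 2).exp).pow_const
    2).mul ((h1.add h2).sub h5).exp

/-- Strong concavity of the dual functional at an optimal pair. -/
theorem IsSchrodingerPair.integral_densityGap_le (h : IsSchrodingerPair P Q f g)
    {f' g' : EuclideanSpace ℝ (Fin d) → ℝ} (hf : Measurable f') (hg : Measurable g')
    (hfi : Integrable f' P) (hgi : Integrable g' Q)
    (h' : ∀ z, ∫ y, Real.exp (f' z + g' y - cost z y) ∂Q = 1) :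
    Integrable (densityGap f g f' g') (P.prod Q) ∧ ∫ z, densityGap f g f' g' z ∂(P.prod Q)
      ≤ ∫ x, f x ∂P + ∫ y, g y ∂Q - (∫ x, f' x ∂P + ∫ y, g' y ∂Q) := by
  have hm : Measurable (fun z : EuclideanSpace ℝ (Fin d) × EuclideanSpace ℝ (Fin d) =>
      Real.exp (f' z.1 + g' z.2 - cost z.1 z.2)) :=
    (((hf.comp measurable_fst).add (hg.comp measurable_snd)).sub measurable_cost).exp
  have hi' : Integrable (fun z : EuclideanSpace ℝ (Fin d) × EuclideanSpace ℝ (Fin d) =>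
      Real.exp (f' z.1 + g' z.2 - cost z.1 z.2)) (P.prod Q) := by
    refine (integrable_prod_iff hm.aestronglyMeasurable).2
      ⟨Eventually.of_forall fun z => integrable_of_integral_exp_eq_one (h' z), ?_⟩
    simp only [Real.norm_eq_abs, Real.abs_exp, h']
    exact integrable_const 1
  have hI' : ∫ z, Real.exp (f' z.1 + g' z.2 - cost z.1 z.2) ∂(P.prod Q) = 1 := by
    rw [integral_prod _ hi']
    simp [h']
  have h1 := h.integrable_exp_mul_add (h.integrable_left.sub hfi) (h.integrable_right.sub hgi)
  have h2 := h.integral_exp_mul_add (h.integrable_left.sub hfi) (h.integrable_right.sub hgi)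
  have hle : ∀ z, densityGap f g f' g' z ≤ Real.exp (f z.1 + g z.2 - cost z.1 z.2)
      * ((f - f') z.1 + (g - g') z.2) - Real.exp (f z.1 + g z.2 - cost z.1 z.2)
      + Real.exp (f' z.1 + g' z.2 - cost z.1 z.2) := by
    intro z
    refine (hellinger_le _ _).trans (le_of_eq ?_)
    simp only [Pi.sub_apply]
    ring
  have hR := (h1.sub h.integrable_exp).add hi'
  have hgap : Integrable (densityGap f g f' g') (P.prod Q) :=
    hR.mono' (measurable_densityGap h.measurable_left h.measurable_right hf hg).aestronglyMeasurable
      (Eventually.of_forall fun z => by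
        rw [Real.norm_eq_abs, abs_of_nonneg (densityGap_nonneg _ _ _ _ z)]
        exact hle z)
  refine ⟨hgap, ?_⟩
  have hint := integral_mono hgap hR hle
  rw [integral_add' (h1.sub h.integrable_exp) hi', integral_sub' h1 h.integrable_exp, h2, hI',
    h.integral_exp_eq_one, integral_sub' h.integrable_left hfi,
    integral_sub' h.integrable_right hgi] at hint
  linarith

variable {κ κ' : ℝ}

/-- The empirical potentials converge to `f`, `g` in the sense of `densityGap`. -/
theorem IsTypical.tendsto_densityGap {x : ℕ → EuclideanSpace ℝ (Fin d)}
    (hx : IsTypical P Q f g x) (hP : HasExpMoments κ' P) (hQ : HasExpMoments κ Q)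
    (h : IsSchrodingerPair P Q f g) {F G : ℕ → EuclideanSpace ℝ (Fin d) → ℝ}
    (hFG : ∀ n, 1 ≤ n → IsEmpiricalPotentials Q n x (F n) (G n)) :
    Tendsto (fun n => ∫ z, densityGap f g (F n) (G n) z ∂(P.prod Q)) atTop (𝓝 0) := by
  obtain ⟨B, C, -, hC0, -, hC⟩ := hx.isEquidistributed.exists_abs_potential_le hQ
  have hC' : ∀ n, 1 ≤ n → ∀ z, |F n z| ≤ C * (1 + ‖z‖ ^ 2) := fun n hn => hC n _ _ (hFG n hn)
  have hgc := hx.isEquidistributed.tendsto_avg_sub_integral hP (L := 4 * C + 1) (by positivity)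
    (fun n hn => (hFG n hn).measurable_left) hC'
    (fun n hn => abs_potential_sub_le (hFG n hn).integral_exp hC0 (hC' n hn))
  -- Since avg f + ∫ g dQ ≤ avg F_n by weak duality, the population gap is at most (avg F_n - ∫ F_n
  -- dP) + (∫ f dP - avg f).
  have hlim := hgc.add (hx.tendsto_avg.const_sub (∫ z, f z ∂P))
  rw [sub_self, add_zero] at hlim
  refine tendsto_of_tendsto_of_tendsto_of_le_of_le' tendsto_const_nhds hlim
    (Eventually.of_forall fun n => integral_nonneg fun z => densityGap_nonneg _ _ _ _ z) ?_
  filter_upwards [eventually_ge_atTop 1] with n hn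
  have hn' := hFG n hn
  have hFi : Integrable (F n) P :=
    (((integrable_const 1).add (hP.integrable_norm_pow 2)).const_mul C).mono'
      hn'.measurable_left.aestronglyMeasurable (Eventually.of_forall (hC' n hn))
  have h1 := (h.integral_densityGap_le hn'.measurable_left hn'.measurable_right hFi
    hn'.integrable_right hn'.integral_exp).2
  have h2 := avg_add_integral_le_entropicCost hQ hn h.measurable_left h.measurable_right
    h.integrable_right fun i _ => hx.integral_exp i
  rw [hn'.entropicCost_eq] at h2
  rw [hn'.integral_right] at h1
  linarith

/-- Differences of the empirical potentials converge to differences of the population potential. -/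
theorem IsTypical.tendsto_sub {x : ℕ → EuclideanSpace ℝ (Fin d)}
    (hx : IsTypical P Q f g x) (hP : HasExpMoments κ' P) (hQ : HasExpMoments κ Q)
    (h : IsSchrodingerPair P Q f g) {F G : ℕ → EuclideanSpace ℝ (Fin d) → ℝ}
    (hFG : ∀ n, 1 ≤ n → IsEmpiricalPotentials Q n x (F n) (G n)) {a b : EuclideanSpace ℝ (Fin d)}
    (ha : ∫ y, Real.exp (f a + g y - cost a y) ∂Q = 1)
    (hb : ∫ y, Real.exp (f b + g y - cost b y) ∂Q = 1) :
    Tendsto (fun n => F n a - f a - (F n b - f b)) atTop (𝓝 0) := by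
  obtain ⟨B, C, hB0, hC0, hB, hC⟩ := hx.isEquidistributed.exists_abs_potential_le hQ
  have hgap := hx.tendsto_densityGap hP hQ h hFG
  -- The gap tends to 0 only in mean, so almost everywhere convergence needs a further subsequence;
  -- the limit 0 is the same for all of them.
  refine tendsto_of_subseq_tendsto fun ns hns => ?_
  obtain ⟨N, hN⟩ := eventually_atTop.1 (hns.eventually (eventually_ge_atTop 1))
  have hns' : ∀ k, 1 ≤ ns (k + N) := fun k => hN _ (Nat.le_add_left _ _)
  have hFi : ∀ k, Integrable (F (ns (k + N))) P := fun k =>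
    (((integrable_const 1).add (hP.integrable_norm_pow 2)).const_mul C).mono'
      (hFG _ (hns' k)).measurable_left.aestronglyMeasurable
      (Eventually.of_forall (hC _ _ _ (hFG _ (hns' k))))
  have hgi : ∀ k, Integrable (densityGap f g (F (ns (k + N))) (G (ns (k + N)))) (P.prod Q) :=
      fun k =>
    (h.integral_densityGap_le (hFG _ (hns' k)).measurable_left (hFG _ (hns' k)).measurable_right
      (hFi k) (hFG _ (hns' k)).integrable_right (hFG _ (hns' k)).integral_exp).1
  have hmeas : TendstoInMeasure (P.prod Q) (fun k => densityGap f g (F (ns (k + N)))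
      (G (ns (k + N))))
      atTop (fun _ => 0) := by
    refine tendstoInMeasure_of_tendsto_eLpNorm one_ne_zero (fun k => (hgi k).aestronglyMeasurable)
      aestronglyMeasurable_const ?_
    have h1 := ENNReal.tendsto_ofReal (hgap.comp (hns.comp (tendsto_add_atTop_nat N)))
    rw [ENNReal.ofReal_zero] at h1
    refine h1.congr fun k => ?_
    have e : (densityGap f g (F (ns (k + N))) (G (ns (k + N))) - fun _ => (0 : ℝ))
        = densityGap f g (F (ns (k + N))) (G (ns (k + N))) := by
      funext z; simp
    rw [e, eLpNorm_one_eq_lintegral_enorm, ← ofReal_integral_norm_eq_lintegral_enorm (hgi k)]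
    simp only [Function.comp_apply, Real.norm_eq_abs, abs_of_nonneg (densityGap_nonneg _ _ _ _ _)]
  obtain ⟨ms, hms, hae⟩ := hmeas.exists_seq_tendsto_ae
  -- Freezing one good first coordinate decouples the sum: the shift c, read off at x₀, makes the
  -- second potentials converge Q-almost everywhere.
  obtain ⟨x₀, hx₀⟩ := (Measure.ae_ae_of_ae_prod hae).exists
  refine ⟨fun k => ms k + N, ?_⟩
  set ks : ℕ → ℕ := fun k => ns (ms k + N) with hks
  have hks1 : ∀ k, IsEmpiricalPotentials Q (ks k) x (F (ks k)) (G (ks k)) := fun k =>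
    hFG _ (hns' (ms k))
  set c : ℕ → ℝ := fun k => F (ks k) x₀ - f x₀ with hc
  have hlim : ∀ᵐ y ∂Q, Tendsto (fun k => c k + G (ks k) y) atTop (𝓝 (g y)) := by
    filter_upwards [hx₀] with y hy
    have h1 := tendsto_of_tendsto_exp_mul (Real.exp_pos _) hy
    have h2 := h1.add_const (g y)
    rw [zero_add] at h2
    refine h2.congr fun k => ?_
    simp only [hc, hks]
    ring
  have hcle : ∀ k, c k ≤ C * (1 + ‖x₀‖ ^ 2) + |f x₀| := fun k => by
    have h1 := (le_abs_self _).trans (hC _ _ _ (hks1 k) x₀)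
    have h2 := neg_abs_le (f x₀)
    simp only [hc]
    linarith
  have hGle : ∀ k y, c k + G (ks k) y
      ≤ ‖y‖ ^ 2 / 2 + (1 + B) * ‖y‖ + (C * (1 + ‖x₀‖ ^ 2) + |f x₀| + B / 2) := by
    intro k y
    have h1 := (hks1 k).right_le y
    have h2 := avg_sq_le (ks k) (fun z => ‖z‖) x
    have h3 : avg (ks k) (fun z => ‖z‖) x ≤ 1 + B := by
      nlinarith [hB (ks k), sq_nonneg (avg (ks k) (fun z => ‖z‖) x - 1)]
    have h4 := mul_le_mul_of_nonneg_right h3 (norm_nonneg y)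
    linarith [hcle k, hB (ks k)]
  have hpt : ∀ a, ∫ y, Real.exp (f a + g y - cost a y) ∂Q = 1 →
      Tendsto (fun k => F (ks k) a - c k) atTop (𝓝 (f a)) := fun a ha =>
    tendsto_left_of_tendsto_right hQ (F := fun k => F (ks k)) (fun k => (hks1 k).measurable_right)
      (fun k => (hks1 k).integral_exp a) ha (by positivity) hGle hlim
  have h1 := ((hpt a ha).sub_const (f a)).sub ((hpt b hb).sub_const (f b))
  rw [sub_self, sub_self, sub_self] at h1
  refine h1.congr fun k => ?_
  simp only [hks]
  ring

end Stability

/-! ### Dominated convergence with a vanishing L¹ error. -/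

section DominatedByL1

/-- Dominated convergence with a dominating sequence `V + W n` where `W n → 0` in `L¹`. -/
theorem tendsto_integral_zero_of_le_add {α : Type*} [MeasurableSpace α] {μ : Measure α}
    {D W : ℕ → α → ℝ} {V : α → ℝ} (hD : ∀ n, Measurable (D n)) (hD0 : ∀ n x, 0 ≤ D n x)
    (hV : Integrable V μ) (hVm : Measurable V) (hV0 : ∀ x, 0 ≤ V x) (hW : ∀ n, Integrable (W n) μ)
    (hWlim : Tendsto (fun n => ∫ x, |W n x| ∂μ) atTop (𝓝 0))
    (hle : ∀ n, ∀ᵐ x ∂μ, D n x ≤ V x + W n x)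
    (hlim : ∀ᵐ x ∂μ, Tendsto (fun n => D n x) atTop (𝓝 0)) :
    Tendsto (fun n => ∫ x, D n x ∂μ) atTop (𝓝 0) := by
  have hmin : ∀ n x, ‖min (D n x) (V x)‖ ≤ V x := fun n x => by
    rw [Real.norm_eq_abs, abs_of_nonneg (le_min (hD0 n x) (hV0 x))]
    exact min_le_right _ _
  -- The part of D n below V is treated by ordinary dominated convergence; the excess over V is at
  -- most |W n|.
  have h1 := tendsto_integral_of_dominated_convergence (μ := μ) (F := fun n x => min (D n x) (V x))
    (f := fun _ => 0) V (fun n => ((hD n).min hVm).aestronglyMeasurable) hV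
    (fun n => Eventually.of_forall (hmin n)) (by
      filter_upwards [hlim] with x hx
      have := hx.min (tendsto_const_nhds (x := V x))
      rwa [min_eq_left (hV0 x)] at this)
  rw [integral_zero] at h1
  have h2 := h1.add hWlim
  rw [add_zero] at h2
  refine tendsto_of_tendsto_of_tendsto_of_le_of_le tendsto_const_nhds h2
    (fun n => integral_nonneg (hD0 n)) fun n => ?_
  have hmi : Integrable (fun x => min (D n x) (V x)) μ :=
    hV.mono' ((hD n).min hVm).aestronglyMeasurable (Eventually.of_forall (hmin n))
  change ∫ x, D n x ∂μ ≤ ∫ x, min (D n x) (V x) ∂μ + ∫ x, |W n x| ∂μ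
  rw [← integral_add hmi (hW n).abs]
  refine integral_mono_of_nonneg (Eventually.of_forall (hD0 n)) (hmi.add (hW n).abs) ?_
  filter_upwards [hle n] with x hx
  rcases le_total (D n x) (V x) with h | h
  · simp only [min_eq_left h]
    linarith [abs_nonneg (W n x)]
  · simp only [min_eq_right h]
    linarith [le_abs_self (W n x)]

end DominatedByL1

/-! ### Moments and L¹ convergence of sample averages. -/

section AverageMoments

variable {E : Type*} [MeasurableSpace E] (P : Measure E) [IsProbabilityMeasure P]

theorem measurable_avg (n : ℕ) {ψ : E → ℝ} (hψ : Measurable ψ) : Measurable (avg n ψ) :=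
  measurable_const.mul (Finset.measurable_sum _ fun i _ => hψ.comp (measurable_pi_apply i))

theorem memLp_avg (n : ℕ) {p : ℝ≥0∞} {ψ : E → ℝ} (hψ : MemLp ψ p P) :
    MemLp (avg n ψ) p (iidLaw P) :=
  (memLp_finsetSum (Finset.range n) fun i _ =>
    hψ.comp_measurePreserving (measurePreserving_eval P i)).const_mul _

theorem tendsto_integral_abs_avg_sub {ψ : E → ℝ} (hψ : Integrable ψ P) (hm : Measurable ψ) :
    Tendsto (fun n => ∫ x, |avg n ψ x - ∫ z, ψ z ∂P| ∂(iidLaw P)) atTop (𝓝 0) := by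
  have h := strong_law_Lp (μ := iidLaw P) le_rfl ENNReal.one_ne_top
    (fun (i : ℕ) (x : ℕ → E) => ψ (x i))
    (memLp_one_iff_integrable.2 ((measurePreserving_eval P 0).integrable_comp_of_integrable hψ))
    (fun i j hij => ((iIndepFun_eval P).indepFun hij).comp hm hm)
    fun i => (identDistrib_eval P i).comp hm
  simp only [integral_eval P 0 hm, smul_eq_mul] at h
  have h1 := (ENNReal.tendsto_toReal ENNReal.zero_ne_top).comp h
  rw [ENNReal.toReal_zero] at h1
  refine h1.congr fun n => ?_
  have hmm : Measurable (fun x => avg n ψ x - ∫ z, ψ z ∂P) := (measurable_avg n hm).sub_const _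
  have h2 := integral_norm_eq_lintegral_enorm (μ := iidLaw P) hmm.aestronglyMeasurable
  simp only [Real.norm_eq_abs] at h2
  rw [h2, Function.comp_apply, eLpNorm_one_eq_lintegral_enorm]
  rfl

end AverageMoments

/-! ### The remainder: replacement of one point, growth and second moment. -/

section Remainder

variable {d : ℕ}

theorem remainder_eq (Q : Measure (EuclideanSpace ℝ (Fin d))) (f : EuclideanSpace ℝ (Fin d) → ℝ)
    (n : ℕ) (x : ℕ → EuclideanSpace ℝ (Fin d)) :
    remainder Q f n x = entropicCost (empiricalMeasure n x) Q - avg n f x := by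
  rw [remainder, integral_empiricalMeasure]

theorem remainder_congr (Q : Measure (EuclideanSpace ℝ (Fin d))) (f : EuclideanSpace ℝ (Fin d) → ℝ)
    {n : ℕ} {x y : ℕ → EuclideanSpace ℝ (Fin d)} (h : ∀ i < n, x i = y i) :
    remainder Q f n x = remainder Q f n y := by
  have : empiricalMeasure n x = empiricalMeasure n y := by
    unfold empiricalMeasure
    rw [Finset.sum_congr rfl fun i hi => by rw [h i (Finset.mem_range.1 hi)]]
  rw [remainder, remainder, this]

theorem remainder_swap (Q : Measure (EuclideanSpace ℝ (Fin d))) (f : EuclideanSpace ℝ (Fin d) → ℝ)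
    {n : ℕ} (x : ℕ → EuclideanSpace ℝ (Fin d)) {i : ℕ} (hi : i < n) :
    remainder Q f n (fun j => x (Equiv.swap 0 i j)) = remainder Q f n x := by
  have : empiricalMeasure n (fun j => x (Equiv.swap 0 i j)) = empiricalMeasure n x := by
    unfold empiricalMeasure
    congr 1
    refine Finset.sum_equiv (Equiv.swap 0 i) (fun j => ?_) fun j _ => rfl
    simp only [Finset.mem_range, Equiv.swap_apply_def]
    split_ifs <;> omega
  rw [remainder, remainder, this]

theorem mul_avg_sub_avg {E : Type*} {n : ℕ} (hn : 1 ≤ n) (ψ : E → ℝ) {y y' : ℕ → E}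
    (h : ∀ j, 1 ≤ j → y j = y' j) : n * (avg n ψ y - avg n ψ y') = ψ (y 0) - ψ (y' 0) := by
  obtain ⟨m, rfl⟩ := Nat.exists_eq_add_of_le' hn
  have h1 : ∑ i ∈ Finset.range m, ψ (y (i + 1)) = ∑ i ∈ Finset.range m, ψ (y' (i + 1)) :=
    Finset.sum_congr rfl fun i _ => by rw [h (i + 1) (Nat.le_add_left _ _)]
  unfold avg
  rw [Finset.sum_range_succ', Finset.sum_range_succ', h1, ← mul_sub, ← mul_assoc, mul_inv_cancel₀
    (by positivity)]
  ring

variable {P Q : Measure (EuclideanSpace ℝ (Fin d))} [IsProbabilityMeasure Q] {κ κ' : ℝ}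
  {f g : EuclideanSpace ℝ (Fin d) → ℝ}

/-- The potentials of y are normalized at every point, hence feasible for y'; weak duality there and
optimality for y compare the two costs through the single changed point. -/
theorem mul_entropicCost_sub_le (hQ : HasExpMoments κ Q) {n : ℕ} (hn : 1 ≤ n)
    {y y' : ℕ → EuclideanSpace ℝ (Fin d)} (h : ∀ j, 1 ≤ j → y j = y' j)
    {F G : EuclideanSpace ℝ (Fin d) → ℝ} (hFG : IsEmpiricalPotentials Q n y F G) :
    n * (entropicCost (empiricalMeasure n y) Q - entropicCost (empiricalMeasure n y') Q)
      ≤ F (y 0) - F (y' 0) := by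
  have h1 := avg_add_integral_le_entropicCost hQ hn (x := y') hFG.measurable_left
    hFG.measurable_right hFG.integrable_right fun i _ => hFG.integral_exp _
  rw [hFG.integral_right, add_zero] at h1
  rw [hFG.entropicCost_eq, ← mul_avg_sub_avg hn F h]
  gcongr

theorem exists_abs_mul_entropicCost_sub_le (hQ : HasExpMoments κ Q) :
    ∃ C : ℝ, 0 ≤ C ∧ ∀ (n : ℕ), 1 ≤ n → ∀ y y' : ℕ → EuclideanSpace ℝ (Fin d),
      (∀ j, 1 ≤ j → y j = y' j) →
      |n * (entropicCost (empiricalMeasure n y) Q - entropicCost (empiricalMeasure n y') Q)|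
        ≤ C * (1 + ‖y 0‖ ^ 2 + ‖y' 0‖ ^ 2 + avg n (fun z => ‖z‖ ^ 2) y
          + avg n (fun z => ‖z‖ ^ 2) y') := by
  obtain ⟨C, hC0, hC⟩ := exists_abs_potential_le hQ
  have key : ∀ (n : ℕ), 1 ≤ n → ∀ y y' : ℕ → EuclideanSpace ℝ (Fin d),
      (∀ j, 1 ≤ j → y j = y' j) →
      n * (entropicCost (empiricalMeasure n y) Q - entropicCost (empiricalMeasure n y') Q)
        ≤ 2 * C * (1 + ‖y 0‖ ^ 2 + ‖y' 0‖ ^ 2 + avg n (fun z => ‖z‖ ^ 2) y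
          + avg n (fun z => ‖z‖ ^ 2) y') := by
    intro n hn y y' h
    obtain ⟨F, G, hFG, -⟩ := exists_isEmpiricalPotentials hQ hn y
    have h1 := mul_entropicCost_sub_le hQ hn h hFG
    have h2 := abs_le.1 (hC n y F G hFG (y 0))
    have h3 := abs_le.1 (hC n y F G hFG (y' 0))
    have h4 : 0 ≤ avg n (fun z => ‖z‖ ^ 2) y' := avg_nonneg (fun z => by positivity) y'
    nlinarith [mul_nonneg hC0 h4, mul_nonneg hC0 (sq_nonneg ‖y 0‖),
        mul_nonneg hC0 (sq_nonneg ‖y' 0‖)]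
  refine ⟨2 * C, by positivity, fun n hn y y' h => ?_⟩
  have h1 := key n hn y y' h
  have h2 := key n hn y' y fun j hj => (h j hj).symm
  rw [abs_le]
  constructor <;> linarith

theorem cost_comm {E : Type*} [NormedAddCommGroup E] (x y : E) : cost x y = cost y x := by
  unfold cost; rw [norm_sub_rev]

theorem abs_le_of_quadratic_bounds {s r m m' K K' l κ : ℝ} (hm0' : 0 ≤ m')
    (hl : 0 ≤ l) (hκ : 0 ≤ κ) (hlow : -K - l - κ * (r + m) ^ 2 ≤ s)
    (hup : s ≤ r ^ 2 / 2 + r * m' + K') :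
    |s| ≤ (1 + m' + |K'| + |K| + l + 2 * κ * (1 + m ^ 2)) * (1 + r ^ 2) := by
  have hx1 : r ≤ 1 + r ^ 2 := by nlinarith [sq_nonneg (r - 1)]
  have hx2 : 0 ≤ r ^ 2 := by positivity
  have hsq : (r + m) ^ 2 ≤ 2 * (1 + m ^ 2) * (1 + r ^ 2) := by
    linarith [sq_nonneg (r - m), sq_nonneg (r * m)]
  have h1 := mul_le_mul_of_nonneg_left hsq hκ
  have h2 := mul_le_mul_of_nonneg_right hx1 hm0'
  have h3 := le_abs_self K
  have h4 := le_abs_self K'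
  have h5 := mul_nonneg (abs_nonneg K) hx2
  have h6 := mul_nonneg (abs_nonneg K') hx2
  have h7 := mul_nonneg hl hx2
  have h8 := mul_nonneg hm0' hx2
  have h9 : 0 ≤ 2 * κ * (1 + m ^ 2) * (1 + r ^ 2) := by positivity
  have h10 := abs_nonneg K
  have h11 := abs_nonneg K'
  have e : (1 + m' + |K'| + |K| + l + 2 * κ * (1 + m ^ 2)) * (1 + r ^ 2)
      = 1 + r ^ 2 + m' * (1 + r ^ 2) + (|K'| + |K'| * r ^ 2) + (|K| + |K| * r ^ 2)
        + (l + l * r ^ 2) + 2 * κ * (1 + m ^ 2) * (1 + r ^ 2) := by ring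
  rw [e, abs_le]
  constructor <;> linarith

/-- Jensen on the P side bounds g from above, which bounds f from below; Jensen on the Q side bounds
f from above. The normalization is known only almost everywhere, and so is the bound. -/
theorem IsSchrodingerPair.exists_abs_left_le [IsProbabilityMeasure P] (h : IsSchrodingerPair P Q f g)
    (hP : HasExpMoments κ' P) (hQ : HasExpMoments κ Q) :
    ∃ C : ℝ, 0 ≤ C ∧ ∀ᵐ x ∂P, |f x| ≤ C * (1 + ‖x‖ ^ 2) := by
  set m := ∫ y, ‖y‖ ∂P with hm
  set m' := ∫ y, ‖y‖ ∂Q with hm'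
  have hm0 : 0 ≤ m := integral_nonneg fun y => norm_nonneg y
  have hm0' : 0 ≤ m' := integral_nonneg fun y => norm_nonneg y
  have hκ := hQ.nonneg
  set K := (∫ y, ‖y‖ ^ 2 ∂P) / 2 - ∫ x, f x ∂P with hK
  set K' := (∫ y, ‖y‖ ^ 2 ∂Q) / 2 - ∫ x, g x ∂Q with hK'
  have hg : ∀ᵐ y ∂Q, g y ≤ ‖y‖ ^ 2 / 2 + m * ‖y‖ + K := by
    filter_upwards [h.right] with y hy
    have h1 := potential_le hP h.integrable_left (s := g y) (x := y) (by
      rw [← hy]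
      congr 1
      funext x
      rw [cost_comm, add_comm])
    rw [← hm] at h1
    rw [hK]
    linarith
  refine ⟨1 + m' + |K'| + |K| + Real.log 2 + 2 * κ * (1 + m ^ 2), by positivity, ?_⟩
  filter_upwards [h.left] with x hx
  have hlow := le_potential hQ h.measurable_right hm0 hg hx
  have hup := potential_le hQ h.integrable_right hx
  rw [← hm', add_sub_assoc, ← hK'] at hup
  exact abs_le_of_quadratic_bounds hm0' (Real.log_nonneg (by norm_num)) hκ
    hlow hup

theorem measurable_remainder (hQ : HasExpMoments κ Q) (hf : Measurable f) {n : ℕ} (hn : 1 ≤ n) :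
    Measurable (remainder Q f n) := by
  have : remainder Q f n = fun x => entropicCost (empiricalMeasure n x) Q - avg n f x :=
    funext (remainder_eq Q f n)
  rw [this]
  exact (measurable_entropicCost_empiricalMeasure hQ hn).sub (measurable_avg n hf)

theorem memLp_two_of_abs_le {P : Measure (EuclideanSpace ℝ (Fin d))} [IsProbabilityMeasure P]
    (hP : HasExpMoments κ P) {ψ : EuclideanSpace ℝ (Fin d) → ℝ} (hψ : Measurable ψ) {C : ℝ}
    (h : ∀ᵐ x ∂P, |ψ x| ≤ C * (1 + ‖x‖ ^ 2)) : MemLp ψ 2 P := by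
  have h2 : MemLp (fun x : EuclideanSpace ℝ (Fin d) => ‖x‖ ^ 2) 2 P := by
    rw [memLp_two_iff_integrable_sq (by fun_prop)]
    simp only [← pow_mul]
    exact hP.integrable_norm_pow _
  have h3 : MemLp (fun x : EuclideanSpace ℝ (Fin d) => C * (1 + ‖x‖ ^ 2)) 2 P :=
    MemLp.const_mul ((memLp_const (1 : ℝ)).add h2) C
  exact h3.mono' hψ.aestronglyMeasurable h

theorem memLp_remainder [IsProbabilityMeasure P] (h : IsSchrodingerPair P Q f g)
    (hP : HasExpMoments κ' P) (hQ : HasExpMoments κ Q) {n : ℕ} (hn : 1 ≤ n) :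
    MemLp (remainder Q f n) 2 (iidLaw P) := by
  obtain ⟨C, hC0, hC⟩ := exists_abs_potential_le hQ
  obtain ⟨C', -, hC'⟩ := h.exists_abs_left_le hP hQ
  have hf2 : MemLp f 2 P := memLp_two_of_abs_le hP h.measurable_left hC'
  have hsq : MemLp (fun x : EuclideanSpace ℝ (Fin d) => ‖x‖ ^ 2) 2 P :=
    memLp_two_of_abs_le hP (C := 1) (by fun_prop) (Eventually.of_forall fun x => by
      rw [abs_of_nonneg (by positivity)]; linarith)
  have hS : MemLp (fun x : ℕ → EuclideanSpace ℝ (Fin d) => entropicCost (empiricalMeasure n x) Q) 2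
      (iidLaw P) := by
    have hB : MemLp (fun x : ℕ → EuclideanSpace ℝ (Fin d) =>
        C * (1 + 2 * avg n (fun z => ‖z‖ ^ 2) x)) 2 (iidLaw P) :=
      MemLp.const_mul ((memLp_const (1 : ℝ)).add ((memLp_avg P n hsq).const_mul 2)) C
    refine hB.mono'
      (measurable_entropicCost_empiricalMeasure hQ hn).aestronglyMeasurable
      (Eventually.of_forall fun x => ?_)
    obtain ⟨F, G, hFG, -⟩ := exists_isEmpiricalPotentials hQ hn x
    rw [hFG.entropicCost_eq, Real.norm_eq_abs]
    refine (abs_avg_le n F x).trans ((avg_mono (hC n x F G hFG) x).trans (le_of_eq ?_))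
    have hn' : (n : ℝ) ≠ 0 := by positivity
    simp only [avg, ← Finset.mul_sum, Finset.sum_add_distrib, Finset.sum_const, Finset.card_range,
      nsmul_eq_mul]
    field_simp
    ring
  have : remainder Q f n = fun x => entropicCost (empiricalMeasure n x) Q - avg n f x :=
    funext (remainder_eq Q f n)
  rw [this]
  exact hS.sub (memLp_avg P n hf2)

end Remainder

/-! ### The limit of the rescaled variance. -/

section VarianceLimit

variable {E : Type*}

/-- The sequence `x 1, x 2, …`. -/
def dropFirst (x : ℕ → E) (j : ℕ) : E := x (j + 1)

/-- The sequence `x 0, x 2, x 3, …`. -/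
def dropSecond (x : ℕ → E) (j : ℕ) : E := x (if j = 0 then 0 else j + 1)

theorem dropFirst_eq_dropSecond (x : ℕ → E) (j : ℕ) (hj : 1 ≤ j) :
    dropFirst x j = dropSecond x j := by
  rw [dropFirst, dropSecond, if_neg (by omega)]

theorem measurePreserving_dropFirst [MeasurableSpace E] (P : Measure E) [IsProbabilityMeasure P] :
    MeasurePreserving dropFirst (iidLaw P) (iidLaw P) :=
  measurePreserving_reindex P (e := fun j => j + 1) (add_left_injective 1)

theorem measurePreserving_dropSecond [MeasurableSpace E] (P : Measure E) [IsProbabilityMeasure P] :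
    MeasurePreserving dropSecond (iidLaw P) (iidLaw P) :=
  measurePreserving_reindex P (e := fun j => if j = 0 then 0 else j + 1) fun a b h => by
    simp only at h
    split_ifs at h <;> omega

theorem mul_remainder_sub {d : ℕ} {Q : Measure (EuclideanSpace ℝ (Fin d))}
    {f : EuclideanSpace ℝ (Fin d) → ℝ} {n : ℕ} (hn : 1 ≤ n)
    {y y' : ℕ → EuclideanSpace ℝ (Fin d)}
    (h : ∀ j, 1 ≤ j → y j = y' j) :
    n * (remainder Q f n y - remainder Q f n y')
      = n * (entropicCost (empiricalMeasure n y) Q - entropicCost (empiricalMeasure n y') Q)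
        - (f (y 0) - f (y' 0)) := by
  rw [remainder_eq, remainder_eq, ← mul_avg_sub_avg hn f h]
  ring

variable {d : ℕ} {P Q : Measure (EuclideanSpace ℝ (Fin d))} [IsProbabilityMeasure P]
  [IsProbabilityMeasure Q] {κ κ' : ℝ} {f g : EuclideanSpace ℝ (Fin d) → ℝ}

/-- The swap in Efron–Stein places the replacement at index n. Reindexing turns the two samples into
initial segments of two sequences that do not depend on n, so that almost sure limits make sense. -/
theorem mul_variance_remainder_le (h : IsSchrodingerPair P Q f g) (hP : HasExpMoments κ' P)
    (hQ : HasExpMoments κ Q) {n : ℕ} (hn : 1 ≤ n) :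
    n * variance (remainder Q f n) (iidLaw P) ≤ 1 / 2 *
      ∫ x, (n * (remainder Q f n (dropFirst x) - remainder Q f n (dropSecond x))) ^ 2 ∂(iidLaw P) := by
  have hm := measurable_remainder hQ h.measurable_left hn
  have h1 := variance_le_of_symmetric P hm (memLp_remainder h hP hQ hn)
    (fun x y hxy => remainder_congr Q f hxy) (fun x i hi => remainder_swap Q f x hi)
  set e : ℕ → ℕ := fun j => if j = n then 0 else j + 1 with he
  have hei : Function.Injective e := fun a b hab => by
    simp only [he] at hab
    split_ifs at hab <;> omega
  have hmG : Measurable (fun x : ℕ → EuclideanSpace ℝ (Fin d) => (remainder Q f n x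
      - remainder Q f n (fun j => x (Equiv.swap 0 n j))) ^ 2) :=
    (hm.sub (hm.comp (measurable_pi_lambda _ fun j => measurable_pi_apply _))).pow_const 2
  rw [← integral_reindex P hei hmG] at h1
  have h2 : ∀ x : ℕ → EuclideanSpace ℝ (Fin d), remainder Q f n (fun j => x (e j))
      = remainder Q f n (dropFirst x) := fun x => remainder_congr Q f fun i hi => by
    simp only [he, dropFirst]
    rw [if_neg (by omega)]
  have h3 : ∀ x : ℕ → EuclideanSpace ℝ (Fin d), remainder Q f n (fun j => x (e (Equiv.swap 0 n j)))
      = remainder Q f n (dropSecond x) := fun x => remainder_congr Q f fun i hi => by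
    simp only [he, dropSecond, Equiv.swap_apply_def]
    congr 1
    split_ifs <;> omega
  simp only [h2, h3] at h1
  simp only [mul_pow]
  rw [integral_const_mul]
  have h4 := mul_le_mul_of_nonneg_left h1 (Nat.cast_nonneg (α := ℝ) n)
  refine h4.trans (le_of_eq ?_)
  ring

/-- The effect on the remainder of replacing one sample point is `o(1 / n)`. -/
theorem ae_tendsto_mul_remainder_sub (h : IsSchrodingerPair P Q f g) (hP : HasExpMoments κ' P)
    (hQ : HasExpMoments κ Q) : ∀ᵐ x ∂(iidLaw P), Tendsto (fun n : ℕ =>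
      n * (remainder Q f n (dropFirst x) - remainder Q f n (dropSecond x))) atTop (𝓝 0) := by
  filter_upwards [(measurePreserving_dropFirst P).quasiMeasurePreserving.ae (h.ae_isTypical hP),
    (measurePreserving_dropSecond P).quasiMeasurePreserving.ae (h.ae_isTypical hP)] with x hA hB
  have hpot : ∀ y : ℕ → EuclideanSpace ℝ (Fin d), ∃ F G : ℕ → EuclideanSpace ℝ (Fin d) → ℝ,
      ∀ n, 1 ≤ n → IsEmpiricalPotentials Q n y (F n) (G n) := by
    intro y
    have : ∀ n, ∃ FG : (EuclideanSpace ℝ (Fin d) → ℝ) × (EuclideanSpace ℝ (Fin d) → ℝ),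
        1 ≤ n → IsEmpiricalPotentials Q n y FG.1 FG.2 := by
      intro n
      by_cases hn : 1 ≤ n
      · obtain ⟨F, G, hFG, -⟩ := exists_isEmpiricalPotentials hQ hn y
        exact ⟨(F, G), fun _ => hFG⟩
      · exact ⟨(0, 0), fun hc => absurd hc hn⟩
    choose FG hFG using this
    exact ⟨fun n => (FG n).1, fun n => (FG n).2, hFG⟩
  obtain ⟨F, G, hFG⟩ := hpot (dropFirst x)
  obtain ⟨F', G', hFG'⟩ := hpot (dropSecond x)
  have h1 := hA.tendsto_sub hP hQ h hFG (hA.integral_exp 0) (hB.integral_exp 0)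
  have h2 := (hB.tendsto_sub hP hQ h hFG' (hB.integral_exp 0) (hA.integral_exp 0)).neg
  rw [neg_zero] at h2
  have hAB := dropFirst_eq_dropSecond x
  -- The potentials of either sample bound the increment from one side; both bounds are differences
  -- at the points x 0 and x 1, which do not move with n.
  refine tendsto_of_tendsto_of_tendsto_of_le_of_le' h2 h1 ?_ ?_
  · filter_upwards [eventually_ge_atTop 1] with n hn
    have h3 := mul_entropicCost_sub_le hQ hn (fun j hj => (hAB j hj).symm) (hFG' n hn)
    rw [mul_remainder_sub hn hAB]
    linarith
  · filter_upwards [eventually_ge_atTop 1] with n hn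
    have h3 := mul_entropicCost_sub_le hQ hn hAB (hFG n hn)
    rw [mul_remainder_sub hn hAB]
    linarith

theorem exists_sq_mul_remainder_sub_le (h : IsSchrodingerPair P Q f g) (hP : HasExpMoments κ' P)
    (hQ : HasExpMoments κ Q) : ∃ C : ℝ, 0 ≤ C ∧ ∀ n : ℕ, 1 ≤ n → ∀ᵐ x ∂(iidLaw P),
      (n * (remainder Q f n (dropFirst x) - remainder Q f n (dropSecond x))) ^ 2
        ≤ C * (1 + ‖x 1‖ ^ 4 + ‖x 0‖ ^ 4 + avg n (fun z => ‖z‖ ^ 4) (dropFirst x)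
          + avg n (fun z => ‖z‖ ^ 4) (dropSecond x)) := by
  obtain ⟨C, hC0, hC⟩ := exists_abs_mul_entropicCost_sub_le hQ
  obtain ⟨C', hC0', hC'⟩ := h.exists_abs_left_le hP hQ
  refine ⟨5 * (C + 2 * C') ^ 2, by positivity, fun n hn => ?_⟩
  filter_upwards [(measurePreserving_eval P 0).quasiMeasurePreserving.ae hC',
    (measurePreserving_eval P 1).quasiMeasurePreserving.ae hC'] with x h0 h1
  have hAB := dropFirst_eq_dropSecond x
  have h2 := hC n hn _ _ hAB
  rw [mul_remainder_sub hn hAB]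
  have e0 : dropSecond x 0 = x 0 := rfl
  have e1 : dropFirst x 0 = x 1 := rfl
  rw [e0, e1] at h2 ⊢
  have hp := avg_sq_le n (fun z => ‖z‖ ^ 2) (dropFirst x)
  have hq := avg_sq_le n (fun z => ‖z‖ ^ 2) (dropSecond x)
  simp only [← pow_mul] at hp hq
  have hp0 : 0 ≤ avg n (fun z => ‖z‖ ^ 2) (dropFirst x) := avg_nonneg (fun z => by positivity) _
  have hq0 : 0 ≤ avg n (fun z => ‖z‖ ^ 2) (dropSecond x) := avg_nonneg (fun z => by positivity) _
  generalize avg n (fun z => ‖z‖ ^ 2) (dropFirst x) = p at *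
  generalize avg n (fun z => ‖z‖ ^ 2) (dropSecond x) = q at *
  generalize n * (entropicCost (empiricalMeasure n (dropFirst x)) Q
    - entropicCost (empiricalMeasure n (dropSecond x)) Q) = D at *
  have ha0 : 0 ≤ ‖x 1‖ ^ 2 := by positivity
  have hb0 : 0 ≤ ‖x 0‖ ^ 2 := by positivity
  have ea : ‖x 1‖ ^ 4 = (‖x 1‖ ^ 2) ^ 2 := by ring
  have eb : ‖x 0‖ ^ 4 = (‖x 0‖ ^ 2) ^ 2 := by ring
  rw [ea, eb]
  generalize ‖x 1‖ ^ 2 = a at *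
  generalize ‖x 0‖ ^ 2 = b at *
  have h3 : |D - (f (x 1) - f (x 0))| ≤ (C + 2 * C') * (1 + a + b + p + q) := by
    have h4 : |D - (f (x 1) - f (x 0))| ≤ |D| + (|f (x 1)| + |f (x 0)|) :=
      (abs_sub _ _).trans (add_le_add_right (abs_sub _ _) _)
    have h5 : C' * (1 + a) + C' * (1 + b) ≤ 2 * C' * (1 + a + b + p + q) := by
      nlinarith [mul_nonneg hC0' ha0, mul_nonneg hC0' hb0, mul_nonneg hC0' hp0, mul_nonneg hC0' hq0]
    linarith
  -- Cauchy–Schwarz for five summands.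
  have h6 : (1 + a + b + p + q) ^ 2 ≤ 5 * (1 + a ^ 2 + b ^ 2 + p ^ 2 + q ^ 2) := by
    nlinarith [sq_nonneg (1 - a), sq_nonneg (1 - b), sq_nonneg (1 - p), sq_nonneg (1 - q),
      sq_nonneg (a - b), sq_nonneg (a - p), sq_nonneg (a - q), sq_nonneg (b - p), sq_nonneg (b - q),
      sq_nonneg (p - q)]
  rw [← sq_abs]
  calc |D - (f (x 1) - f (x 0))| ^ 2 ≤ ((C + 2 * C') * (1 + a + b + p + q)) ^ 2 := by gcongr
    _ = (C + 2 * C') ^ 2 * (1 + a + b + p + q) ^ 2 := by ring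
    _ ≤ (C + 2 * C') ^ 2 * (5 * (1 + a ^ 2 + b ^ 2 + p ^ 2 + q ^ 2)) := by gcongr
    _ ≤ (C + 2 * C') ^ 2 * (5 * (1 + a ^ 2 + b ^ 2 + avg n (fun z => ‖z‖ ^ (2 * 2)) (dropFirst x)
          + avg n (fun z => ‖z‖ ^ (2 * 2)) (dropSecond x))) := by gcongr
    _ = _ := by norm_num; ring

theorem tendsto_integral_sq_mul_remainder_sub (h : IsSchrodingerPair P Q f g)
    (hP : HasExpMoments κ' P) (hQ : HasExpMoments κ Q) :
    Tendsto (fun n : ℕ => ∫ x, (n * (remainder Q f n (dropFirst x)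
      - remainder Q f n (dropSecond x))) ^ 2 ∂(iidLaw P)) atTop (𝓝 0) := by
  obtain ⟨C, hC0, hC⟩ := exists_sq_mul_remainder_sub_le h hP hQ
  have hA := measurePreserving_dropFirst P
  have hB := measurePreserving_dropSecond P
  have h4i := hP.integrable_norm_pow 4
  have h4m : Measurable (fun z : EuclideanSpace ℝ (Fin d) => ‖z‖ ^ 4) := by fun_prop
  set ψ : EuclideanSpace ℝ (Fin d) → ℝ := fun z => ‖z‖ ^ 4 with hψ
  set m := ∫ z, ψ z ∂P with hm
  have hm0 : 0 ≤ m := integral_nonneg fun z => by positivity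
  set S : ℕ → (ℕ → EuclideanSpace ℝ (Fin d)) → ℝ := fun n x => avg n ψ x - m with hS
  have hSm : ∀ n, Measurable (S n) := fun n => (measurable_avg n h4m).sub_const m
  have hSi : ∀ n, Integrable (S n) (iidLaw P) := fun n =>
    (memLp_one_iff_integrable.1 (memLp_avg P n (memLp_one_iff_integrable.2 h4i))).sub
      (integrable_const m)
  have hSA : ∀ n, Integrable (fun x => S n (dropFirst x)) (iidLaw P) := fun n =>
    hA.integrable_comp_of_integrable (hSi n)
  have hSB : ∀ n, Integrable (fun x => S n (dropSecond x)) (iidLaw P) := fun n =>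
    hB.integrable_comp_of_integrable (hSi n)
  have hψe : ∀ i, Integrable (fun x : ℕ → EuclideanSpace ℝ (Fin d) => ψ (x i)) (iidLaw P) :=
      fun i =>
    (measurePreserving_eval P i).integrable_comp_of_integrable h4i
  have hψm : ∀ i, Measurable (fun x : ℕ → EuclideanSpace ℝ (Fin d) => ψ (x i)) := fun i =>
    h4m.comp (measurable_pi_apply i)
  have hψ0 : ∀ z, 0 ≤ ψ z := fun z => by positivity
  clear_value ψ
  -- The estimates need a nonempty sample, while the convergence lemma asks for them at every index,
  -- hence the shift.
  rw [← tendsto_add_atTop_iff_nat 1]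
  refine tendsto_integral_zero_of_le_add
    (V := fun x => C * (1 + ψ (x 1) + ψ (x 0) + 2 * m))
    (W := fun n x => C * (S (n + 1) (dropFirst x) + S (n + 1) (dropSecond x)))
    (fun n => ?_) (fun n x => sq_nonneg _) ?_ ?_ (fun x => ?_) (fun n => ?_) ?_ (fun n => ?_) ?_
  · have hr := measurable_remainder hQ h.measurable_left (Nat.le_add_left 1 n)
    exact (((hr.comp hA.measurable).sub (hr.comp hB.measurable)).const_mul _).pow_const 2
  · exact Integrable.const_mul ((((integrable_const (1 : ℝ)).add (hψe 1)).add (hψe 0)).add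
      (integrable_const (2 * m))) C
  · exact Measurable.const_mul (((measurable_const.add (hψm 1)).add (hψm 0)).add measurable_const) C
  · have := hψ0 (x 0)
    have := hψ0 (x 1)
    positivity
  · exact Integrable.const_mul ((hSA _).add (hSB _)) C
  · have hlim := ((tendsto_add_atTop_iff_nat 1).2 (tendsto_integral_abs_avg_sub P h4i h4m)).const_mul
      (2 * C)
    rw [mul_zero] at hlim
    refine tendsto_of_tendsto_of_tendsto_of_le_of_le tendsto_const_nhds hlim
      (fun n => integral_nonneg fun x => abs_nonneg _) fun n => ?_
    have hiA := (hSA (n + 1)).abs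
    have hiB := (hSB (n + 1)).abs
    have hIA := integral_comp_measurePreserving hA (hSm (n + 1)).abs
    have hIB := integral_comp_measurePreserving hB (hSm (n + 1)).abs
    calc ∫ x, |C * (S (n + 1) (dropFirst x) + S (n + 1) (dropSecond x))| ∂(iidLaw P)
        ≤ ∫ x, C * (|S (n + 1) (dropFirst x)| + |S (n + 1) (dropSecond x)|) ∂(iidLaw P) := by
          refine integral_mono (Integrable.const_mul ((hSA _).add (hSB _)) C).abs
            (Integrable.const_mul (hiA.add hiB) C) fun x => ?_
          simp only [abs_mul, abs_of_nonneg hC0]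
          exact mul_le_mul_of_nonneg_left (abs_add_le _ _) hC0
      _ = C * (∫ x, |S (n + 1) (dropFirst x)| ∂(iidLaw P)
          + ∫ x, |S (n + 1) (dropSecond x)| ∂(iidLaw P)) := by
          rw [integral_const_mul]
          congr 1
          exact integral_add hiA hiB
      _ = 2 * C * ∫ x, |S (n + 1) x| ∂(iidLaw P) := by
          rw [hIA, hIB]
          ring
  · filter_upwards [hC (n + 1) (Nat.le_add_left 1 n)] with x hx
    refine hx.trans (le_of_eq ?_)
    simp only [hS, hψ]
    ring
  · filter_upwards [ae_tendsto_mul_remainder_sub h hP hQ] with x hx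
    have := ((tendsto_add_atTop_iff_nat 1).2 hx).pow 2
    simpa using this

theorem tendsto_mul_variance_remainder (h : IsSchrodingerPair P Q f g)
    (hP : HasExpMoments κ' P) (hQ : HasExpMoments κ Q) :
    Tendsto (fun n : ℕ => n * variance (remainder Q f n) (iidLaw P)) atTop (𝓝 0) := by
  have hlim := (tendsto_integral_sq_mul_remainder_sub h hP hQ).const_mul (1 / 2)
  rw [mul_zero] at hlim
  refine tendsto_of_tendsto_of_tendsto_of_le_of_le' tendsto_const_nhds hlim
    (Eventually.of_forall fun n => mul_nonneg (Nat.cast_nonneg n) (variance_nonneg _ _)) ?_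
  filter_upwards [eventually_ge_atTop 1] with n hn
  exact mul_variance_remainder_le h hP hQ hn

end VarianceLimit

end EntropicOT

/-! ### Transfer to the given probability space, with measurable versions of the potentials. -/

theorem proposition13 {d : ℕ} (P Q : Measure (EuclideanSpace ℝ (Fin d)))
    [IsProbabilityMeasure P] [IsProbabilityMeasure Q]
    (hP : EntropicOT.IsSubgaussian P) (hQ : EntropicOT.IsSubgaussian Q)
    (f g : EuclideanSpace ℝ (Fin d) → ℝ) (hfg : EntropicOT.IsOptimalPotentials P Q f g)
    {Ω : Type*} [MeasurableSpace Ω] (μ : Measure Ω) [IsProbabilityMeasure μ]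
    (X : ℕ → Ω → EuclideanSpace ℝ (Fin d)) (hlaw : ∀ i, HasLaw (X i) P μ)
    (hindep : iIndepFun X μ) :
    (∀ n : ℕ, 1 ≤ n → MemLp (fun ω => EntropicOT.remainder Q f n (fun i => X i ω)) 2 μ) ∧
      Tendsto
        (fun n : ℕ => (n : ℝ) * variance (fun ω => EntropicOT.remainder Q f n (fun i => X i ω)) μ)
        atTop (𝓝 0) := by
  obtain ⟨κ', hP'⟩ := hP.exists_hasExpMoments
  obtain ⟨κ, hQ'⟩ := hQ.exists_hasExpMoments
  have hfm := hfg.integrable_left.aestronglyMeasurable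
  have hgm := hfg.integrable_right.aestronglyMeasurable
  have hpair := (hfg.congr hfm.ae_eq_mk hgm.ae_eq_mk).isSchrodingerPair
    hfm.stronglyMeasurable_mk.measurable hgm.stronglyMeasurable_mk.measurable
  set f' := hfm.mk f with hf'
  have hXm : AEMeasurable (fun ω i => X i ω) μ := aemeasurable_pi_iff.2 fun i =>
      (hlaw i).aemeasurable
  have hmap : μ.map (fun ω i => X i ω) = EntropicOT.iidLaw P := EntropicOT.iidLaw_map_eq hlaw hindep
  have hae : ∀ᵐ ω ∂μ, ∀ i, f (X i ω) = f' (X i ω) := ae_all_iff.2 fun i =>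
    ae_of_ae_map (hlaw i).aemeasurable (by
      rw [(hlaw i).map_eq]
      exact hfm.ae_eq_mk)
  have hcongr : ∀ n, (fun ω => EntropicOT.remainder Q f n (fun i => X i ω))
      =ᵐ[μ] fun ω => EntropicOT.remainder Q f' n (fun i => X i ω) := fun n => by
    filter_upwards [hae] with ω hω
    simp only [EntropicOT.remainder_eq, EntropicOT.avg, hω]
  have hL : ∀ n, 1 ≤ n → MemLp (EntropicOT.remainder Q f' n) 2 (μ.map fun ω i => X i ω) :=
    fun n hn => by
      rw [hmap]
      exact EntropicOT.memLp_remainder hpair hP' hQ' hn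
  refine ⟨fun n hn => ?_, ?_⟩
  · exact (memLp_congr_ae (hcongr n)).2 ((hL n hn).comp_of_map hXm)
  · refine (EntropicOT.tendsto_mul_variance_remainder hpair hP' hQ').congr' ?_
    filter_upwards [eventually_ge_atTop 1] with n hn
    rw [variance_congr (hcongr n), ← hmap,
        variance_map (hL n hn).aestronglyMeasurable.aemeasurable hXm]
    rfl
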